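/- Let $A$ be a semilocal commutative ring (finitely many maximal ideals) and $d>0$ an integer. Let $\mathcal C_{A,d}$ be the category of $A$-schemes of the form $S\setminus W$ with $S$ a smooth affine $A$-scheme of pure relative dimension $d$ and $W\subset S$ an $A$-quasi-finite closed subscheme. A contravariant functor $F$ from $\mathcal C_{A,d}$ to pointed sets is called *excisive* if, whenever $S$ and $S'$ are smooth affine $A$-schemes of pure relative dimension $d$, or complements in such schemes of $A$-finite étale closed subschemes, $Z\subset S$ and $Z'\subset S'$ are $A$-quasi-finite closed subschemes, and $f\colon S\to S'$ is an étale $A$-morphism with $Z=Z'\times_{S'}S$ that induces an isomorphism $Z\xrightarrow{\sim}Z'$, the map $$F(S')\to F(S)\times_{F(S\setminus Z)}F(S'\setminus Z')$$ is surjective. (For $d=1$ the complement of an $A$-finite étale closed subscheme of a smooth affine $S$ is itself affine, so it suffices to consider smooth affine $S$, $S'$.) Let $C$ be a smooth affine $A$-scheme of pure relative dimension $d$, let $Y\subset C$ be a closed subscheme that is finite étale over $A$, and let $F\colon\mathcal C_{A,d}^{\mathrm{op}}\to\{\text{pointed sets}\}$ be excisive. For a map of pointed sets, $\operatorname{Ker}$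 denotes the preimage of the distinguished point. Suppose that the following holds for every finite étale $Y$-scheme $\mathscr Y$ and every integer $m\ge 0$ such that $m\le\deg(Y/A)$ at the image in $\operatorname{Spec}A$ of every point of $\mathscr Y$ and such that $\mathscr Y$ admits a morphism to $\operatorname{Spec}B$ for some commutative ring $B$ that is finite as a $\mathbb Z$-module and for which $\mathbb A^d_B$ contains $m$ disjoint copies of $\operatorname{Spec}B$ (that is, $\mathbb A^d_B\to\operatorname{Spec}B$ has $m$ sections with pairwise disjoint images): there is a closed subscheme $\mathscr Y'\subset\mathbb A^d_{\mathscr Y}$ that is a union of $m$ disjoint copies of $\mathscr Y$ (the union of the images of $m$ pairwise disjoint sections) such that for every $\mathscr Y$-finite closed subscheme $Z\subset\mathbb A^d_{\mathscr Y}$ containing $\mathscr Y'$ the map $$\operatorname{Ker}\bigl(F(\mathbb A^d_{\mathscr Y})\to F(\mathbb A^d_{\mathscr Y}\setminus Z)\bigr)\to\operatorname{Ker}\bigl(F(\mathbb A^d_{\mathscr Y}\setminus\mathscr Y')\to F(\mathbb A^d_{\mathscr Y}\setminus Z)\bigr)$$ is surjective. Then for every $A$-finite closed subscheme $Z\subset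 C$ containing $Y$ the map $$\operatorname{Ker}\bigl(F(C)\to F(C\setminus Z)\bigr)\to\operatorname{Ker}\bigl(F(C\setminus Y)\to F(C\setminus Z)\bigr)$$ is surjective; that is, every element of $F(C\setminus Y)$ that is trivial away from $Z$ extends to $F(C)$. -/

import Mathlib

open CategoryTheory Limits Opposite AlgebraicGeometry

universe u v

namespace Extension

/-- A polynomial ring in `d` variables is standard smooth of relative dimension `d`. -/
theorem mvPolynomial_isStandardSmooth (d : ℕ) (R : Type u) [CommRing R] :
    Algebra.IsStandardSmoothOfRelativeDimension d R (MvPolynomial (ULift.{u} (Fin d)) R) := by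
  let P : Algebra.SubmersivePresentation R (MvPolynomial (ULift.{u} (Fin d)) R)
      (ULift.{u} (Fin d)) PEmpty.{1} :=
    { toGenerators := Algebra.Generators.mvPolynomial R (ULift.{u} (Fin d))
      relation := PEmpty.elim
      span_range_relation_eq_ker := by
        rw [Set.range_eq_empty, Ideal.span_empty, eq_comm, eq_bot_iff]
        intro x hx
        have hx := (RingHom.mem_ker).1 hx
        have h : MvPolynomial.aeval (R := R) (MvPolynomial.X (σ := ULift.{u} (Fin d))) x = 0 := hx
        rw [MvPolynomial.aeval_X_left_apply] at h
        exact h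
      map := PEmpty.elim
      map_inj := fun a => a.elim
      jacobian_isUnit := by
        classical
        rw [Algebra.PreSubmersivePresentation.jacobian_eq_jacobiMatrix_det]
        simp }
  exact P.isStandardSmoothOfRelativeDimension
    (by simp [Algebra.Presentation.dimension])

/-- `𝔸ᵈ_T ⟶ T` is smooth of relative dimension `d`. -/
instance affineSpace_smooth (d : ℕ) (T : Scheme.{u}) :
    SmoothOfRelativeDimension d (𝔸(ULift.{u} (Fin d); T) ↘ T) := by
  let P : MorphismProperty Scheme.{u} := @SmoothOfRelativeDimension.{u} d
  have : P.IsStableUnderBaseChange := smoothOfRelativeDimension_isStableUnderBaseChange d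
  refine MorphismProperty.pullback_fst (P := P) _ _ ?_
  have := isIso_of_isTerminal specULiftZIsTerminal.{u} terminalIsTerminal (terminal.from _)
  rw [← terminal.comp_from (Spec.map (CommRingCat.ofHom MvPolynomial.C)),
    MorphismProperty.cancel_right_of_respectsIso (P := P)]
  change SmoothOfRelativeDimension d _
  rw [HasRingHomProperty.Spec_iff (P := @SmoothOfRelativeDimension.{u} d)]
  apply RingHom.locally_of RingHom.isStandardSmoothOfRelativeDimension_respectsIso
  rw [CommRingCat.hom_ofHom, RingHom.IsStandardSmoothOfRelativeDimension]
  convert! mvPolynomial_isStandardSmooth.{u} d (ULift.{u} ℤ)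
  exact Algebra.algebra_ext _ _ fun _ ↦ rfl

variable (A : Type u) [CommRing A] (d : ℕ)

/-- `X` is an `A`-scheme of the form `S ∖ W` with `S` a smooth affine `A`-scheme of pure relative
dimension `d` and `W ⊆ S` a closed subscheme whose structure morphism to `Spec A` satisfies `Q`. -/
def IsPuncture (Q : MorphismProperty Scheme.{u}) :
    ObjectProperty (Over (Spec (CommRingCat.of A))) := fun X =>
  ∃ (S W : Over (Spec (CommRingCat.of A))) (j : X ⟶ S) (w : W ⟶ S),
    IsAffine S.left ∧ SmoothOfRelativeDimension d S.hom ∧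
    IsClosedImmersion w.left ∧ Q W.hom ∧
    IsOpenImmersion j.left ∧ Set.range j.left = (Set.range w.left)ᶜ

/-- The category of `A`-schemes of the form `S ∖ W` with `S` a smooth affine `A`-scheme of pure
relative dimension `d` and `W ⊆ S` an `A`-quasi-finite closed subscheme. -/
abbrev Punctured : Type (u + 1) :=
  (IsPuncture A d @LocallyQuasiFinite).FullSubcategory

variable {A d}

/-- A smooth affine `A`-scheme of pure relative dimension `d`, as an object of `Punctured A d`. -/
noncomputable def Punctured.ofAffine {S : Scheme.{u}} (p : S ⟶ Spec (CommRingCat.of A))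
    (hS : IsAffine S) (hp : SmoothOfRelativeDimension d p) : Punctured A d where
  obj := Over.mk p
  property := by
    refine ⟨Over.mk p, Over.mk (initial.to (Spec (CommRingCat.of A))), 𝟙 _,
      Over.homMk (initial.to S) (by simp), hS, hp, ?_, ?_, ?_, ?_⟩
    · dsimp; infer_instance
    · dsimp; infer_instance
    · dsimp; infer_instance
    · simp [Set.range_eq_empty]

variable (d) in
/-- `𝔸ᵈ_T` for a finite étale `A`-scheme `T`, as an object of `Punctured A d`. -/
noncomputable def Punctured.affineSpace {T : Scheme.{u}} (t : T ⟶ Spec (CommRingCat.of A))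
    [IsFinite t] [Etale t] : Punctured A d :=
  .ofAffine ((𝔸(ULift.{u} (Fin d); T) ↘ T) ≫ t)
    (have : IsAffine T := isAffine_of_isAffineHom t
     inferInstance)
    (smoothOfRelativeDimension_comp (n := d) (m := 0) _ t)

/-- The morphism `j : U ⟶ X` exhibits `U` as the open subscheme `X ∖ K`. -/
structure IsComplement {U X : Punctured A d} (j : U ⟶ X) (K : Set X.obj.left) : Prop where
  isOpenImmersion : IsOpenImmersion j.hom.left
  range_eq : Set.range j.hom.left = Kᶜ

/-- The complement of an `A`-quasi-finite closed subscheme of a smooth affine `A`-scheme of pure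
relative dimension `d` exists in `Punctured A d`. -/
theorem exists_isComplement {S Z : Scheme.{u}} (p : S ⟶ Spec (CommRingCat.of A))
    (hS : IsAffine S) (hp : SmoothOfRelativeDimension d p) (z : Z ⟶ S) [hz : IsClosedImmersion z]
    [hq : LocallyQuasiFinite (z ≫ p)] :
    ∃ (U : Punctured A d) (j : U ⟶ Punctured.ofAffine p hS hp), IsComplement j (Set.range z) := by
  let V : S.Opens := ⟨(Set.range z)ᶜ, z.isClosedEmbedding.isClosed_range.isOpen_compl⟩
  have hV : IsOpenImmersion V.ι := inferInstance
  exact ⟨⟨Over.mk (V.ι ≫ p), Over.mk p, Over.mk (z ≫ p), Over.homMk V.ι rfl, Over.homMk z rfl,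
    hS, hp, hz, hq, hV, V.range_ι⟩, ObjectProperty.homMk (Over.homMk V.ι rfl), hV, V.range_ι⟩

/-- `F` is excisive: `F(S') ⟶ F(S) ×_{F(S ∖ Z)} F(S' ∖ Z')` is surjective for every étale
`f : S ⟶ S'` and all `A`-quasi-finite closed subschemes `z : Z ⟶ S`, `z' : Z' ⟶ S'` such that `f`
restricts to an isomorphism `e : Z ⟶ Z'` with `Z = Z' ×_{S'} S`. Here `S` and `S'` are smooth
affine `A`-schemes of pure relative dimension `d`, or complements in such schemes of `A`-finite
étale closed subschemes. The schemes `U` and `U'` are `S ∖ Z` and `S' ∖ Z'`. -/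
def IsExcisive (F : (Punctured A d)ᵒᵖ ⥤ Pointed.{v}) : Prop :=
  ∀ (S S' U U' : Punctured A d) (f : S ⟶ S') (j : U ⟶ S) (j' : U' ⟶ S') (g : U ⟶ U')
    (Z Z' : Scheme.{u}) (z : Z ⟶ S.obj.left) (z' : Z' ⟶ S'.obj.left) (e : Z ⟶ Z'),
    IsPuncture A d (@IsFinite ⊓ @Etale) S.obj → IsPuncture A d (@IsFinite ⊓ @Etale) S'.obj →
    Etale f.hom.left →
    IsClosedImmersion z → LocallyQuasiFinite (z ≫ S.obj.hom) →
    IsClosedImmersion z' → LocallyQuasiFinite (z' ≫ S'.obj.hom) →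
    IsIso e → IsPullback z e f.hom.left z' →
    IsComplement j (Set.range z) → IsComplement j' (Set.range z') → j ≫ f = g ≫ j' →
    ∀ (a : F.obj (op S)) (b : F.obj (op U')),
      (F.map j.op).toFun a = (F.map g.op).toFun b →
      ∃ c : F.obj (op S'), (F.map f.op).toFun c = a ∧ (F.map j'.op).toFun c = b

/-- For subsets `K ⊆ L` of `X` with `U = X ∖ K` and `V = X ∖ L`, the map
`Ker(F(X) ⟶ F(X ∖ L)) ⟶ Ker(F(X ∖ K) ⟶ F(X ∖ L))` is surjective. -/
def KerSurjective (F : (Punctured A d)ᵒᵖ ⥤ Pointed.{v}) (X : Punctured A d)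
    (K L : Set X.obj.left) : Prop :=
  ∀ (U V : Punctured A d) (j : U ⟶ X) (k : V ⟶ U),
    IsComplement j K → IsComplement (k ≫ j) L →
    ∀ a : F.obj (op U), (F.map k.op).toFun a = (F.obj (op V)).point →
      ∃ b : F.obj (op X), (F.map (k ≫ j).op).toFun b = (F.obj (op V)).point ∧
        (F.map j.op).toFun b = a

/-- The sections `s₁, …, sₘ` of `𝔸ᵈ_T ⟶ T` have pairwise disjoint images; equivalently, the union
of their images is a closed subscheme of `𝔸ᵈ_T` that is a union of `m` disjoint copies of `T`. -/
def IsDisjointCopies {d m : ℕ} {T : Scheme.{u}}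
    (s : Fin m → (T ⟶ 𝔸(ULift.{u} (Fin d); T))) : Prop :=
  (∀ i, s i ≫ (𝔸(ULift.{u} (Fin d); T) ↘ T) = 𝟙 T) ∧
    Pairwise fun i j => Disjoint (Set.range (s i)) (Set.range (s j))

end Extension

/-! Fix `a` in F(C ∖ Y) that is trivial off Z. For an affine étale `g : X ⟶ C`, write Y_X and Z_X
for the preimages of Y and Z; `ExtendsOff` records that the pullback of `a` extends to the
complement of a given closed part K of X. Excision makes extension a local question along Y: if a
finite étale scheme T is clopen both in Y_X and in Y_X', compatibly with an étale map X ⟶ X' over C,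
then extending over T in X suffices for extending over T in X' (`ExtendsOff.excision_of_mono`). In
particular, `a` extends over a clopen T in Y_X once it extends to C_T = C ×_A T
(`ExtendsOff.of_baseChange`).

The hypothesis on F enters through coordinates. Let X be smooth over T, and let `a` extend off m
disjoint sections of X ⟶ T that lie in Y_X. Suppose that a T-morphism from X to affine space is
étale around Z_X, embeds Z_X as a closed subscheme and carries the sections to the good ones. After
shrinking X, Z_X is the full preimage of its image. Excision then transports the element to affine
space minus the sections, where it extends by hypothesis, and the extension is pulled back to X
(`ExtendsOff.of_kerSurjective`).

Coordinates of this kind are functions with prescribed values on the sections, with independent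
differentials at the closed points of Z_X, and separating its geometric points over the closed
points of T. As T is semilocal, the Chinese remainder theorem reduces their choice to a single
closed point (`exists_etale_coordinates`). If the residue field is large, finitely many proper
affine subspaces have to be avoided (`exists_generic_fin`). If it is finite, differentials can be
adjusted without changing values at the points, so one function that separates the points is enough
(`exists_finite_at`).

To cope with small residue fields, start from C_Y with its diagonal section and pass to an étale X ⟶
C_Y, finite over Z, to which the diagonal lifts as s. It is a tower of two covers with equation t +
((t^M − 1) E(t))^q = 0, where q is divisible by all positive residue characteristics: the derivative
is 1 where q = 0, and in characteristic zero it cannot vanish at a root because −1/q is not an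
algebraic integer. For suitable E and M the coordinate of the second cover separates points with
finite residue field (`exists_separating_cover`). On T = Y_X ∖ s the ring splits so that on each
piece some w has w and w^M − 1 invertible, and powers of w give many elements, integral over ℤ, with
unit differences (`hasIntegralUnits_of_tower`). They make the residue fields of T large and also
provide the ring B demanded by the hypothesis.

Then `a` extends to C_T by induction (`ExtendsOff.of_hasIntegralUnits`): over the complement of
given disjoint sections in Y_T there is one section more, and a bound on the degree of Y ends the
process. Hence `a` extends to X ∖ s, then to X by the case of one section over Y itself, and finally
to C by excision along Y (`ExtendsOff.id`). -/

namespace Extension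

/-! ### Étale morphisms: sections, base change and shrinking -/

/-- A section of a separated étale morphism is an open immersion. -/
theorem isOpenImmersion_of_etale_of_mono {X Y : Scheme.{u}} (f : X ⟶ Y) [Etale f] [Mono f] :
    IsOpenImmersion f :=
  IsOpenImmersion.of_flat_of_mono f

/-- Both étaleness and being a monomorphism cancel from `s ≫ f = 𝟙 X`. -/
theorem isOpenImmersion_section_of_etale {X Y : Scheme.{u}} (s : X ⟶ Y) (f : Y ⟶ X) [Etale f]
    (h : s ≫ f = 𝟙 X) : IsOpenImmersion s := by
  have : Etale (s ≫ f) := by rw [h]; infer_instance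
  have : Etale s := Etale.of_comp s f
  have : Mono (s ≫ f) := by rw [h]; infer_instance
  have : Mono s := mono_of_mono s f
  exact isOpenImmersion_of_etale_of_mono s

/-- A closed immersion into the source of an étale morphism `f`, which stays a closed immersion
after composition with `f` and fills the preimage of its image, is a base change along `f`. -/
theorem isPullback_of_etale {M M' T : Scheme.{u}} (f : M ⟶ M') [Etale f] (τ : T ⟶ M)
    [IsClosedImmersion (τ ≫ f)] (h : f ⁻¹' Set.range (τ ≫ f) ⊆ Set.range τ) :
    IsPullback τ (𝟙 T) f (τ ≫ f) := by
  let s : T ⟶ pullback f (τ ≫ f) := pullback.lift τ (𝟙 T) (by simp)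
  have hs : s ≫ pullback.snd f (τ ≫ f) = 𝟙 T := pullback.lift_snd _ _ _
  have hs' : s ≫ pullback.fst f (τ ≫ f) = τ := pullback.lift_fst _ _ _
  -- As a section of the étale projection, `s` is open; the hypothesis on the preimage makes it
  -- surjective, so it is an isomorphism onto the pullback.
  have : IsOpenImmersion s := isOpenImmersion_section_of_etale s _ hs
  have : Surjective s := by
    constructor
    intro w
    have hw : pullback.fst f (τ ≫ f) w ∈ Set.range τ := by
      apply h
      refine ⟨pullback.snd f (τ ≫ f) w, ?_⟩
      rw [← Scheme.Hom.comp_apply, ← Scheme.Hom.comp_apply, pullback.condition]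
    obtain ⟨t, ht⟩ := hw
    refine ⟨t, (pullback.fst f (τ ≫ f)).isClosedEmbedding.injective ?_⟩
    rw [← Scheme.Hom.comp_apply, hs', ht]
  have : IsIso s := by
    have : Epi s.base := by
      rw [TopCat.epi_iff_surjective]
      exact s.surjective
    exact IsOpenImmersion.isIso s
  exact IsPullback.of_iso_pullback ⟨by simp⟩ (asIso s) hs' hs

/-- A closed subset of an affine scheme and a disjoint closed subset are separated by a basic open. -/
theorem exists_basicOpen_of_disjoint {X : Scheme.{u}} [IsAffine X] {Z W : Set X}
    (hZ : IsClosed Z) (hW : IsClosed W) (h : Disjoint Z W) :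
    ∃ s : Γ(X, ⊤), Z ⊆ X.basicOpen s ∧ Disjoint (X.basicOpen s : Set X) W := by
  have key : ∀ {R : CommRingCat.{u}} {Z W : Set (Spec R)} (_ : IsClosed Z) (_ : IsClosed W)
      (_ : Disjoint Z W), ∃ s : R, Z ⊆ {x : Spec R | s ∉ x.asIdeal} ∧
        Disjoint {x : Spec R | s ∉ x.asIdeal} W := by
    intro R Z W hZ hW h
    obtain ⟨I, rfl⟩ := (PrimeSpectrum.isClosed_iff_zeroLocus_ideal Z).1 hZ
    obtain ⟨J, rfl⟩ := (PrimeSpectrum.isClosed_iff_zeroLocus_ideal W).1 hW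
    have hIJ : I ⊔ J = ⊤ := by
      rw [← PrimeSpectrum.zeroLocus_empty_iff_eq_top, PrimeSpectrum.zeroLocus_sup]
      exact h.inter_eq
    -- In a + b = 1 the function b vanishes on W and equals 1 on Z.
    obtain ⟨a, ha, b, hb, hab⟩ := Submodule.mem_sup.1 ((Ideal.eq_top_iff_one _).1 hIJ)
    refine ⟨b, fun x hx hbx => ?_, Set.disjoint_left.2 fun x hx hx' => hx (hx' hb)⟩
    refine x.2.ne_top ((Ideal.eq_top_iff_one _).2 ?_)
    rw [← hab]
    exact x.asIdeal.add_mem (hx ha) hbx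
  have hc : Topology.IsClosedEmbedding X.isoSpec.inv := X.isoSpec.inv.homeomorph.isClosedEmbedding
  obtain ⟨s, h1, h2⟩ := key (R := Γ(X, ⊤)) (hZ.preimage X.isoSpec.inv.continuous)
    (hW.preimage X.isoSpec.inv.continuous) (h.preimage _)
  have hb : ∀ x : X, x ∈ X.basicOpen s ↔ s ∉ (X.isoSpec.hom x).asIdeal := by
    intro x
    rw [← X.toSpecΓ_preimage_basicOpen]
    rfl
  have hinv : ∀ x : X, X.isoSpec.inv (X.isoSpec.hom x) = x := fun x => by
    rw [← Scheme.Hom.comp_apply]; simp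
  refine ⟨s, fun x hx => (hb x).2 (h1 ?_), Set.disjoint_left.2 fun x hx hx' =>
    Set.disjoint_left.1 h2 ((hb x).1 hx) ?_⟩
  · rw [Set.mem_preimage, hinv]; exact hx
  · rw [Set.mem_preimage, hinv]; exact hx'

/-- If `τ : Z ⟶ X` and `τ ≫ f` are closed immersions and `f` is étale on a basic open containing
`Z`, then after shrinking `X` around `Z` the morphism `f` is étale and `Z` is the full preimage of
its image. -/
theorem exists_shrinking {X B Z : Scheme.{u}} [IsAffine X] (f : X ⟶ B) (τ : Z ⟶ X)
    [IsClosedImmersion τ] [IsClosedImmersion (τ ≫ f)] (s : Γ(X, ⊤))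
    (hs : Etale ((X.basicOpen s).ι ≫ f)) (hZ : Set.range τ ⊆ X.basicOpen s) :
    ∃ (S : Scheme.{u}) (o : S ⟶ X) (σ : Z ⟶ S), IsAffine S ∧ IsOpenImmersion o ∧
      σ ≫ o = τ ∧ Etale (o ≫ f) ∧
      (o ≫ f) ⁻¹' Set.range (τ ≫ f) ⊆ Set.range σ := by
  let O := X.basicOpen s
  have hO : IsAffine O := (isAffineOpen_top X).basicOpen s
  let τO : Z ⟶ O := IsOpenImmersion.lift O.ι τ (by simpa using hZ)
  have hτO : τO ≫ O.ι = τ := IsOpenImmersion.lift_fac _ _ _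
  have : IsClosedImmersion (τO ≫ O.ι) := by rw [hτO]; infer_instance
  have : IsClosedImmersion τO := IsClosedImmersion.of_comp τO O.ι
  let q : Z ⟶ pullback (O.ι ≫ f) (τ ≫ f) := pullback.lift τO (𝟙 Z) (by simp [← hτO])
  have hq : q ≫ pullback.snd _ _ = 𝟙 Z := pullback.lift_snd _ _ _
  have hq' : q ≫ pullback.fst _ _ = τO := pullback.lift_fst _ _ _
  have : IsOpenImmersion q := isOpenImmersion_section_of_etale q _ hq
  -- The preimage of the image of Z is the disjoint union of Z, which is open in it as a section of
  -- an étale map, and the closed remainder W, which has to be removed.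
  let W : Set O := pullback.fst (O.ι ≫ f) (τ ≫ f) '' (Set.range q)ᶜ
  have hW : IsClosed W :=
    (pullback.fst (O.ι ≫ f) (τ ≫ f)).isClosedEmbedding.isClosedMap _
      q.isOpenEmbedding.isOpen_range.isClosed_compl
  have hdisj : Disjoint (Set.range τO) W := by
    rw [Set.disjoint_left]
    rintro _ ⟨z, rfl⟩ ⟨w, hw, hwz⟩
    apply hw
    refine ⟨z, (pullback.fst (O.ι ≫ f) (τ ≫ f)).isClosedEmbedding.injective ?_⟩
    rw [hwz, ← Scheme.Hom.comp_apply, hq']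
  obtain ⟨s', h1, h2⟩ := exists_basicOpen_of_disjoint τO.isClosedEmbedding.isClosed_range hW hdisj
  let S := (O : Scheme).basicOpen s'
  have hSaff : IsAffine S := (isAffineOpen_top (O : Scheme)).basicOpen s'
  let σ : Z ⟶ S := IsOpenImmersion.lift S.ι τO (by simpa using h1)
  have hσ : σ ≫ S.ι = τO := IsOpenImmersion.lift_fac _ _ _
  refine ⟨S, S.ι ≫ O.ι, σ, hSaff, inferInstance, by rw [← Category.assoc, hσ, hτO], ?_, ?_⟩
  · have : Etale (O.ι ≫ f) := hs
    rw [Category.assoc]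
    infer_instance
  · rintro m ⟨z, hz⟩
    obtain ⟨w, hw1, hw2⟩ := Scheme.Pullback.exists_preimage_pullback (f := O.ι ≫ f)
      (g := τ ≫ f) (S.ι m) z (by rw [hz]; simp)
    have hw : w ∈ Set.range q := by
      by_contra hw
      exact (Set.disjoint_left.1 h2) (show S.ι m ∈ (S : Set O) from m.2) ⟨w, hw, hw1⟩
    obtain ⟨z', rfl⟩ := hw
    refine ⟨z', S.ι.isOpenEmbedding.injective ?_⟩
    rw [← hw1, ← Scheme.Hom.comp_apply, ← Scheme.Hom.comp_apply, hσ, hq']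

/-- The clopen subscheme on a clopen subset. -/
theorem isClosedImmersion_of_isClosed {D : Scheme.{u}} (O : D.Opens) (hO : IsClosed (O : Set D)) :
    IsClosedImmersion O.ι :=
  IsClosedImmersion.of_isPreimmersion O.ι (by simpa using hO)

/-! ### Punctured schemes, extension of an element, and excision -/

section Basic

variable {A : Type u} [CommRing A] {d : ℕ}

/-- A morphism in `Punctured A d` from a morphism of schemes over `A`. -/
noncomputable def Punctured.homMk {M N : Punctured A d} (f : M.obj.left ⟶ N.obj.left)
    (h : f ≫ N.obj.hom = M.obj.hom := by cat_disch) : M ⟶ N :=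
  ObjectProperty.homMk (Over.homMk f h)

theorem Punctured.hom_ext {M N : Punctured A d} {f g : M ⟶ N} (h : f.hom.left = g.hom.left) :
    f = g :=
  ObjectProperty.hom_ext _ (Over.OverMorphism.ext h)

@[simp]
theorem Punctured.comp_left {M N L : Punctured A d} (f : M ⟶ N) (g : N ⟶ L) :
    (f ≫ g).hom.left = f.hom.left ≫ g.hom.left := rfl

theorem Punctured.w {M N : Punctured A d} (f : M ⟶ N) : f.hom.left ≫ N.obj.hom = M.obj.hom :=
  Over.w f.hom

theorem Punctured.exists_lift {U X N : Punctured A d} (j : U ⟶ X)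
    (hj : IsOpenImmersion j.hom.left) (n : N ⟶ X)
    (h : Set.range n.hom.left ⊆ Set.range j.hom.left) : ∃ l : N ⟶ U, l ≫ j = n := by
  refine ⟨Punctured.homMk (IsOpenImmersion.lift j.hom.left n.hom.left h) ?_,
    Punctured.hom_ext (IsOpenImmersion.lift_fac _ _ _)⟩
  rw [← Punctured.w j, IsOpenImmersion.lift_fac_assoc, Punctured.w]

theorem Punctured.cancel_open {U X N : Punctured A d} (j : U ⟶ X)
    (hj : IsOpenImmersion j.hom.left) {l l' : N ⟶ U} (h : l ≫ j = l' ≫ j) : l = l' := by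
  apply Punctured.hom_ext
  rw [← cancel_mono j.hom.left, ← Punctured.comp_left, h, Punctured.comp_left]

theorem map_comp_apply (F : (Punctured A d)ᵒᵖ ⥤ Pointed.{v}) {M N L : Punctured A d} (f : M ⟶ N)
    (g : N ⟶ L) (b : F.obj (op L)) :
    (F.map (f ≫ g).op).toFun b = (F.map f.op).toFun ((F.map g.op).toFun b) := by
  rw [op_comp, F.map_comp]
  rfl

theorem map_id_apply (F : (Punctured A d)ᵒᵖ ⥤ Pointed.{v}) {M : Punctured A d}
    (b : F.obj (op M)) : (F.map (𝟙 M).op).toFun b = b := by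
  rw [op_id, F.map_id]
  rfl

/-- The element `a` of `F(U)`, where `U ⟶ B`, extends to `F(M)`, where `M ⟶ B`: some element of
`F(M)` agrees with `a` on everything that maps to `M` and to `U` over `B`. -/
def ExtendsTo (F : (Punctured A d)ᵒᵖ ⥤ Pointed.{v}) {B U : Punctured A d} (j : U ⟶ B)
    (a : F.obj (op U)) {M : Punctured A d} (g : M ⟶ B) : Prop :=
  ∃ b : F.obj (op M), ∀ (N : Punctured A d) (n : N ⟶ M) (h : N ⟶ U), n ≫ g = h ≫ j →
    (F.map n.op).toFun b = (F.map h.op).toFun a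

theorem ExtendsTo.comp {F : (Punctured A d)ᵒᵖ ⥤ Pointed.{v}} {B U : Punctured A d} {j : U ⟶ B}
    {a : F.obj (op U)} {M M' : Punctured A d} {g : M ⟶ B} (h : ExtendsTo F j a g) (f : M' ⟶ M) :
    ExtendsTo F j a (f ≫ g) := by
  obtain ⟨b, hb⟩ := h
  refine ⟨(F.map f.op).toFun b, fun N n h hn => ?_⟩
  rw [← map_comp_apply]
  exact hb N _ h (by simpa using hn)

/-- `K` is the underlying set of a closed subscheme that is finite étale over the base. -/
def IsFiniteEtaleSubset {X S : Scheme.{u}} (x : X ⟶ S) (K : Set X) : Prop :=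
  ∃ (W : Scheme.{u}) (w : W ⟶ X), IsClosedImmersion w ∧ IsFinite (w ≫ x) ∧ Etale (w ≫ x) ∧
    Set.range w = K

theorem isFiniteEtaleSubset_empty {X S : Scheme.{u}} (x : X ⟶ S) :
    IsFiniteEtaleSubset x (∅ : Set X) := by
  refine ⟨∅, Scheme.emptyTo X, inferInstance, ?_, ?_, ?_⟩
  · infer_instance
  · infer_instance
  · exact Set.range_eq_empty _

/-- A clopen part of a closed subscheme that is finite étale over the base. -/
theorem isFiniteEtaleSubset_image {X S D : Scheme.{u}} (x : X ⟶ S) (δ : D ⟶ X)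
    [IsClosedImmersion δ] [IsFinite (δ ≫ x)] [Etale (δ ≫ x)] {O : Set D} (hO : IsClopen O) :
    IsFiniteEtaleSubset x (δ '' O) := by
  let V : D.Opens := ⟨O, hO.isOpen⟩
  have hV : IsClosedImmersion V.ι := isClosedImmersion_of_isClosed V hO.isClosed
  refine ⟨V, V.ι ≫ δ, inferInstance, ?_, ?_, ?_⟩
  · rw [Category.assoc]; infer_instance
  · rw [Category.assoc]; infer_instance
  · rw [show ⇑(V.ι ≫ δ) = δ ∘ V.ι from funext fun y => Scheme.Hom.comp_apply _ _ y,
      Set.range_comp, V.range_ι]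
    rfl

theorem exists_isComplement_of_isFiniteEtaleSubset {X : Scheme.{u}}
    (x : X ⟶ Spec (CommRingCat.of A)) (hX : IsAffine X) (hx : SmoothOfRelativeDimension d x)
    {K : Set X} (hK : IsFiniteEtaleSubset x K) :
    ∃ (M : Punctured A d) (m : M ⟶ Punctured.ofAffine x hX hx), IsComplement m K := by
  obtain ⟨W, w, hw, hf, he, rfl⟩ := hK
  exact exists_isComplement x hX hx w

theorem isPuncture_of_isComplement {X : Scheme.{u}}
    (x : X ⟶ Spec (CommRingCat.of A)) (hX : IsAffine X) (hx : SmoothOfRelativeDimension d x)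
    {K : Set X} (hK : IsFiniteEtaleSubset x K) {M : Punctured A d}
    (m : M ⟶ Punctured.ofAffine x hX hx) (hm : IsComplement m K) :
    IsPuncture A d (@IsFinite ⊓ @Etale) M.obj := by
  obtain ⟨W, w, hw, hf, he, rfl⟩ := hK
  exact ⟨Over.mk x, Over.mk (w ≫ x), m.hom, Over.homMk w rfl, hX, hx, hw, ⟨hf, he⟩,
    hm.isOpenImmersion, hm.range_eq⟩

theorem IsComplement.notMem {U X : Punctured A d} {j : U ⟶ X} {K : Set X.obj.left}
    (h : IsComplement j K) (x : U.obj.left) : j.hom.left x ∉ K := by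
  have : j.hom.left x ∈ Set.range j.hom.left := ⟨x, rfl⟩
  rwa [h.range_eq] at this

theorem IsComplement.mem_range {U X : Punctured A d} {j : U ⟶ X} {K : Set X.obj.left}
    (h : IsComplement j K) {x : X.obj.left} (hx : x ∉ K) : ∃ y, j.hom.left y = x := by
  have : x ∈ Kᶜ := hx
  rwa [← h.range_eq] at this

theorem IsComplement.injective {U X : Punctured A d} {j : U ⟶ X} {K : Set X.obj.left}
    (h : IsComplement j K) : Function.Injective j.hom.left :=
  h.isOpenImmersion.base_open.injective

theorem Punctured.comp_apply {M N L : Punctured A d} (f : M ⟶ N) (g : N ⟶ L) (x : M.obj.left) :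
    (f ≫ g).hom.left x = g.hom.left (f.hom.left x) :=
  Scheme.Hom.comp_apply f.hom.left g.hom.left x

theorem IsComplement.exists_lift {U X N : Punctured A d} {j : U ⟶ X} {K : Set X.obj.left}
    (h : IsComplement j K) (n : N ⟶ X) (hn : ∀ x, n.hom.left x ∉ K) : ∃ l : N ⟶ U, l ≫ j = n := by
  refine Punctured.exists_lift j h.isOpenImmersion n ?_
  rw [h.range_eq]
  rintro _ ⟨x, rfl⟩
  exact hn x

/-- Factoring a complement through a bigger complement. -/
theorem IsComplement.of_comp {V M X : Punctured A d} {o : V ⟶ X} {D K : Set X.obj.left}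
    (ho : IsComplement o D) {m : M ⟶ X} (hm : IsComplement m K) {l : V ⟶ M} (hl : l ≫ m = o)
    {L : Set M.obj.left} (hL : ∀ x, x ∈ L ↔ m.hom.left x ∈ D) : IsComplement l L := by
  have := hm.isOpenImmersion
  have hl' : l.hom.left ≫ m.hom.left = o.hom.left := congr_arg (·.hom.left) hl
  constructor
  · have : IsOpenImmersion (l.hom.left ≫ m.hom.left) := by rw [hl']; exact ho.isOpenImmersion
    exact IsOpenImmersion.of_comp _ m.hom.left
  · ext x
    rw [Set.mem_compl_iff, hL]
    constructor
    · rintro ⟨y, rfl⟩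
      rw [← Punctured.comp_apply, hl]
      exact ho.notMem y
    · intro hx
      obtain ⟨y, hy⟩ := ho.mem_range hx
      refine ⟨y, hm.injective ?_⟩
      rw [← Punctured.comp_apply, hl, hy]

/-- Excision: if `T` is a clopen part of the preimages of `Y` both in `X` and in `X'`, then `a`
extends over `T` in `X'` as soon as it does in `X`. -/
theorem ExtendsTo.excision {F : (Punctured A d)ᵒᵖ ⥤ Pointed.{v}} (hF : IsExcisive F)
    {B U X X' M M' V V' : Punctured A d} {j : U ⟶ B} {D : Set B.obj.left} (hj : IsComplement j D)
    {a : F.obj (op U)} {g : X ⟶ B} {g' : X' ⟶ B} (f : X ⟶ X') (hf : f ≫ g' = g)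
    (hfe : Etale f.hom.left) {m : M ⟶ X} {m' : M' ⟶ X'} {K : Set X.obj.left}
    {K' : Set X'.obj.left} (hm : IsComplement m K) (hm' : IsComplement m' K')
    (hM : IsPuncture A d (@IsFinite ⊓ @Etale) M.obj)
    (hM' : IsPuncture A d (@IsFinite ⊓ @Etale) M'.obj)
    {o : V ⟶ X} {o' : V' ⟶ X'} (ho : IsComplement o (g.hom.left ⁻¹' D))
    (ho' : IsComplement o' (g'.hom.left ⁻¹' D))
    {T : Scheme.{u}} (τ : T ⟶ X.obj.left) (hτ : IsClosedImmersion τ)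
    (hτf : IsClosedImmersion (τ ≫ f.hom.left)) (hT : LocallyQuasiFinite (τ ≫ X.obj.hom))
    (hKT : g.hom.left ⁻¹' D = K ∪ Set.range τ)
    (hKT' : g'.hom.left ⁻¹' D = K' ∪ Set.range (τ ≫ f.hom.left))
    (hdisj : Disjoint K (Set.range τ)) (hdisj' : Disjoint K' (Set.range (τ ≫ f.hom.left)))
    (h : ExtendsTo F j a (m ≫ g)) : ExtendsTo F j a (m' ≫ g') := by
  obtain ⟨b, hb⟩ := h
  have := hm.isOpenImmersion
  have := hm'.isOpenImmersion
  have hgf : ∀ x, g'.hom.left (f.hom.left x) = g.hom.left x := fun x => by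
    rw [← Punctured.comp_apply, hf]
  -- A point of X ∖ K that `f` sends into K' lies over D, hence in T; but the image of T misses K'.
  obtain ⟨fM, hfM⟩ := hm'.exists_lift (m ≫ f) (by
    intro x hx
    rw [Punctured.comp_apply] at hx
    have h1 : m.hom.left x ∈ g.hom.left ⁻¹' D := by
      rw [Set.mem_preimage, ← hgf, ← Set.mem_preimage, hKT']; exact Or.inl hx
    rw [hKT] at h1
    rcases h1 with h1 | ⟨t, ht⟩
    · exact hm.notMem x h1
    · refine Set.disjoint_left.1 hdisj' hx ⟨t, ?_⟩
      rw [Scheme.Hom.comp_apply, ht])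
  have hfM' : fM.hom.left ≫ m'.hom.left = m.hom.left ≫ f.hom.left := congr_arg (·.hom.left) hfM
  have hrT : Set.range τ ⊆ Set.range m.hom.left := by
    rw [hm.range_eq]
    exact fun x hx hx' => Set.disjoint_left.1 hdisj hx' hx
  obtain ⟨τM, hτM⟩ : ∃ τM : T ⟶ M.obj.left, τM ≫ m.hom.left = τ :=
    ⟨IsOpenImmersion.lift m.hom.left τ hrT, IsOpenImmersion.lift_fac _ _ _⟩
  have hτm : ∀ t, m.hom.left (τM t) = τ t := fun t => by rw [← Scheme.Hom.comp_apply, hτM]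
  have hfMe : Etale fM.hom.left := by
    have : Etale (fM.hom.left ≫ m'.hom.left) := by
      rw [hfM']; infer_instance
    exact Etale.of_comp _ m'.hom.left
  have hτfM : (τM ≫ fM.hom.left) ≫ m'.hom.left = τ ≫ f.hom.left := by
    rw [Category.assoc, hfM', ← Category.assoc, hτM]
  have hcl : IsClosedImmersion (τM ≫ fM.hom.left) := by
    have : IsClosedImmersion ((τM ≫ fM.hom.left) ≫ m'.hom.left) := by rwa [hτfM]
    exact IsClosedImmersion.of_comp _ m'.hom.left
  have hτcl : IsClosedImmersion τM := by
    have : IsClosedImmersion (τM ≫ m.hom.left) := by rwa [hτM]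
    exact IsClosedImmersion.of_comp τM m.hom.left
  have hmem : ∀ x, x ∈ Set.range τM ↔ m.hom.left x ∈ g.hom.left ⁻¹' D := by
    intro x
    rw [hKT]
    constructor
    · rintro ⟨t, rfl⟩
      exact Or.inr ⟨t, (hτm t).symm⟩
    · rintro (hx | ⟨t, ht⟩)
      · exact (hm.notMem x hx).elim
      · exact ⟨t, hm.injective ((hτm t).trans ht)⟩
  have hτm' : ∀ t, m'.hom.left ((τM ≫ fM.hom.left) t) = (τ ≫ f.hom.left) t := fun t => by
    rw [← Scheme.Hom.comp_apply, hτfM]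
  have hmem' : ∀ x, x ∈ Set.range (τM ≫ fM.hom.left) ↔ m'.hom.left x ∈ g'.hom.left ⁻¹' D := by
    intro x
    rw [hKT']
    constructor
    · rintro ⟨t, rfl⟩
      exact Or.inr ⟨t, (hτm' t).symm⟩
    · rintro (hx | ⟨t, ht⟩)
      · exact (hm'.notMem x hx).elim
      · exact ⟨t, hm'.injective ((hτm' t).trans ht)⟩
  obtain ⟨jM, hjM⟩ := hm.exists_lift o (fun x hx => ho.notMem x (by rw [hKT]; exact Or.inl hx))
  obtain ⟨jM', hjM'⟩ := hm'.exists_lift o' (fun x hx => ho'.notMem x (by rw [hKT']; exact Or.inl hx))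
  have hcM : IsComplement jM (Set.range τM) := ho.of_comp hm hjM hmem
  have hcM' : IsComplement jM' (Set.range (τM ≫ fM.hom.left)) := ho'.of_comp hm' hjM' hmem'
  have hmf : ∀ x, m'.hom.left (fM.hom.left x) = f.hom.left (m.hom.left x) := fun x => by
    rw [← Punctured.comp_apply, hfM, Punctured.comp_apply]
  obtain ⟨gV, hgV⟩ := hcM'.exists_lift (jM ≫ fM) (by
    intro x hx
    rw [hmem', Punctured.comp_apply, hmf, Set.mem_preimage, hgf] at hx
    refine ho.notMem x ?_
    rw [← hjM, Punctured.comp_apply]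
    exact hx)
  obtain ⟨l, hl⟩ := hj.exists_lift (o' ≫ g') (fun x hx => ho'.notMem x (by
    rwa [Punctured.comp_apply] at hx))
  have hcomp : fM ≫ m' ≫ g' = m ≫ g := by
    rw [← Category.assoc, hfM, Category.assoc, hf]
  -- Excision for X ∖ K ⟶ X' ∖ K' along T: the complement of T in the target is V', which maps to U,
  -- so the extension `b` is glued with the restriction of `a`.
  obtain ⟨c, hc1, hc2⟩ := hF M M' V V' fM jM jM' gV T T τM (τM ≫ fM.hom.left) (𝟙 T) hM hM'
    hfMe hτcl
    (by rw [← Punctured.w m, ← Category.assoc, hτM]; exact hT)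
    hcl
    (by rw [Category.assoc, Punctured.w fM, ← Punctured.w m, ← Category.assoc, hτM]; exact hT)
    inferInstance
    (isPullback_of_etale fM.hom.left τM (by
      rintro x ⟨t, ht⟩
      rw [hmem]
      have h1 := (hmem' _).1 ⟨t, ht⟩
      rwa [hmf, Set.mem_preimage, hgf] at h1))
    hcM hcM' hgV.symm b ((F.map l.op).toFun a) (by
      rw [← map_comp_apply]
      apply hb
      rw [Category.assoc, hl, ← hcomp, ← hjM', Category.assoc, ← Category.assoc gV, hgV,
        Category.assoc])
  refine ⟨c, fun N n h hn => ?_⟩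
  -- A test object that maps to U over B avoids T, so it lies in V', where `c` is the restriction of
  -- `a`.
  obtain ⟨l', hl'⟩ := hcM'.exists_lift n (by
    intro x hx
    rw [hmem', Set.mem_preimage, ← Punctured.comp_apply, ← Punctured.comp_apply, hn,
      Punctured.comp_apply] at hx
    exact hj.notMem _ hx)
  rw [← hl', map_comp_apply, hc2, ← map_comp_apply,
    Punctured.cancel_open j hj.isOpenImmersion (l := l' ≫ l) (l' := h)]
  rw [Category.assoc, hl, ← hn, ← hjM', Category.assoc, ← Category.assoc l', hl']

end Basic

/-! ### Transport of the extension problem along an étale neighbourhood of Z -/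

section Abstract

variable {A : Type u} [CommRing A] {d : ℕ}

theorem map_point (F : (Punctured A d)ᵒᵖ ⥤ Pointed.{v}) {M N : Punctured A d} (f : M ⟶ N) :
    (F.map f.op).toFun (F.obj (op N)).point = (F.obj (op M)).point :=
  (F.map f.op).map_point

/-- If `S ⟶ L` is an excisive étale neighbourhood of `Z` and elements of `F(L ∖ K')` that vanish
off `Z` extend to `L`, then an element of `F(S ∖ K)` that vanishes off `Z` extends to `S`. -/
theorem ExtendsTo.of_kerSurjective {F : (Punctured A d)ᵒᵖ ⥤ Pointed.{v}} (hF : IsExcisive F)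
    {B U V S S₁ L L₁ W W' : Punctured A d} {j : U ⟶ B} {k : V ⟶ U} {D E : Set B.obj.left}
    (hj : IsComplement j D) (hk : IsComplement (k ≫ j) E) {a : F.obj (op U)}
    (ha : (F.map k.op).toFun a = (F.obj (op V)).point)
    {g : S ⟶ B} {K : Set S.obj.left} {K' : Set L.obj.left} {m : S₁ ⟶ S} {m' : L₁ ⟶ L}
    (hm : IsComplement m K) (hm' : IsComplement m' K')
    (hS : IsPuncture A d (@IsFinite ⊓ @Etale) S₁.obj)
    (hL : IsPuncture A d (@IsFinite ⊓ @Etale) L₁.obj)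
    (f : S ⟶ L) (hfe : Etale f.hom.left)
    {Z : Scheme.{u}} (ζ : Z ⟶ S.obj.left) (hζ : IsClosedImmersion ζ)
    (hζf : IsClosedImmersion (ζ ≫ f.hom.left)) (hZ : LocallyQuasiFinite (ζ ≫ S.obj.hom))
    (hfZ : f.hom.left ⁻¹' Set.range (ζ ≫ f.hom.left) ⊆ Set.range ζ)
    (hE : g.hom.left ⁻¹' E = Set.range ζ) (hKD : K ⊆ g.hom.left ⁻¹' D) (hDE : D ⊆ E)
    (hKf : ∀ x, f.hom.left x ∈ K' ↔ x ∈ K) (hK' : K' ⊆ Set.range (ζ ≫ f.hom.left))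
    {o : W ⟶ S} {o' : W' ⟶ L} (ho : IsComplement o (Set.range ζ))
    (ho' : IsComplement o' (Set.range (ζ ≫ f.hom.left)))
    (hker : KerSurjective F L K' (Set.range (ζ ≫ f.hom.left)))
    (h : ExtendsTo F j a (m ≫ g)) : ExtendsTo F j a g := by
  obtain ⟨b, hb⟩ := h
  have := hm.isOpenImmersion
  have := hm'.isOpenImmersion
  have hKZ : K ⊆ Set.range ζ := fun x hx => by
    rw [← hE]; exact hDE (hKD hx)
  have hKD' : ∀ x, x ∈ g.hom.left ⁻¹' D → x ∈ Set.range ζ := fun x hx => by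
    rw [← hE]; exact hDE hx
  obtain ⟨f₁, hf₁⟩ := hm'.exists_lift (m ≫ f) (fun x hx => by
    rw [Punctured.comp_apply, hKf] at hx
    exact hm.notMem x hx)
  have hf₁' : f₁.hom.left ≫ m'.hom.left = m.hom.left ≫ f.hom.left := congr_arg (·.hom.left) hf₁
  have hf₁e : Etale f₁.hom.left := by
    have : Etale (f₁.hom.left ≫ m'.hom.left) := by
      rw [hf₁']; infer_instance
    exact Etale.of_comp _ m'.hom.left
  -- The part of Z off K, closed in S ∖ K and, through `f₁`, closed in L ∖ K'.
  let Z₁ := pullback ζ m.hom.left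
  let ζ₁ : Z₁ ⟶ S₁.obj.left := pullback.snd ζ m.hom.left
  let ι : Z₁ ⟶ Z := pullback.fst ζ m.hom.left
  have hζι : ζ₁ ≫ m.hom.left = ι ≫ ζ := pullback.condition.symm
  have hmem : ∀ x, x ∈ Set.range ζ₁ ↔ m.hom.left x ∈ Set.range ζ := fun x => by
    rw [Scheme.Pullback.range_snd]; rfl
  have hmf : ∀ x, m'.hom.left (f₁.hom.left x) = f.hom.left (m.hom.left x) := fun x => by
    rw [← Punctured.comp_apply, hf₁, Punctured.comp_apply]
  have hmem' : ∀ x, x ∈ Set.range (ζ₁ ≫ f₁.hom.left) ↔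
      m'.hom.left x ∈ Set.range (ζ ≫ f.hom.left) := by
    intro x
    constructor
    · rintro ⟨t, rfl⟩
      refine ⟨ι t, ?_⟩
      rw [← Scheme.Hom.comp_apply, ← Scheme.Hom.comp_apply, ← Category.assoc, ← hζι, Category.assoc,
        ← hf₁', Category.assoc]
    · rintro ⟨t, ht⟩
      have h1 : ζ t ∉ K := by
        rw [← hKf, ← Scheme.Hom.comp_apply, ht]
        exact hm'.notMem x
      obtain ⟨s, hs⟩ := hm.mem_range h1
      obtain ⟨w, hw⟩ := (hmem s).2 ⟨t, hs.symm⟩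
      refine ⟨w, hm'.injective ?_⟩
      rw [Scheme.Hom.comp_apply, hw, hmf, hs, ← ht, Scheme.Hom.comp_apply]
  have hcomp : (ζ₁ ≫ f₁.hom.left) ≫ m'.hom.left = ι ≫ ζ ≫ f.hom.left := by
    rw [Category.assoc, hf₁', ← Category.assoc, hζι, Category.assoc]
  have hcl : IsClosedImmersion (ζ₁ ≫ f₁.hom.left) := by
    have : IsPreimmersion ((ζ₁ ≫ f₁.hom.left) ≫ m'.hom.left) := by
      rw [hcomp]; infer_instance
    have : IsPreimmersion (ζ₁ ≫ f₁.hom.left) := IsPreimmersion.of_comp _ m'.hom.left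
    refine IsClosedImmersion.of_isPreimmersion _ ?_
    have : Set.range (ζ₁ ≫ f₁.hom.left) = m'.hom.left ⁻¹' Set.range (ζ ≫ f.hom.left) :=
      Set.ext hmem'
    rw [this]
    exact (ζ ≫ f.hom.left).isClosedEmbedding.isClosed_range.preimage m'.hom.left.continuous
  have hlqf : LocallyQuasiFinite (ζ₁ ≫ S₁.obj.hom) := by
    rw [← Punctured.w m, ← Category.assoc, hζι, Category.assoc]
    infer_instance
  obtain ⟨l, hl⟩ := hm.exists_lift o (fun x hx => ho.notMem x (hKZ hx))
  obtain ⟨l', hl'⟩ := hm'.exists_lift o' (fun x hx => ho'.notMem x (hK' hx))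
  have hcl1 : IsComplement l (Set.range ζ₁) := ho.of_comp hm hl hmem
  have hcl' : IsComplement l' (Set.range (ζ₁ ≫ f₁.hom.left)) := ho'.of_comp hm' hl' hmem'
  have hfZ₁ : f₁.hom.left ⁻¹' Set.range (ζ₁ ≫ f₁.hom.left) ⊆ Set.range ζ₁ := fun x hx => by
    rw [Set.mem_preimage, hmem', hmf] at hx
    exact (hmem x).2 (hfZ hx)
  obtain ⟨w, hw⟩ := hcl'.exists_lift (l ≫ f₁) (fun x hx => by
    rw [Punctured.comp_apply] at hx
    exact hcl1.notMem x (hfZ₁ hx))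
  obtain ⟨r, hr⟩ := hk.exists_lift (o ≫ g) (fun x hx => ho.notMem x (by
    rw [← hE]
    rwa [Punctured.comp_apply] at hx))
  -- On L ∖ Z the distinguished point is taken: it matches `b` on W, because there `b` is the
  -- restriction of `a` through V, where `a` is trivial.
  obtain ⟨c, hc1, hc2⟩ := hF S₁ L₁ W W' f₁ l l' w Z₁ Z₁ ζ₁ (ζ₁ ≫ f₁.hom.left) (𝟙 _) hS hL hf₁e
    inferInstance hlqf hcl (by rwa [Category.assoc, Punctured.w]) inferInstance
    (isPullback_of_etale f₁.hom.left ζ₁ hfZ₁) hcl1 hcl' hw.symm b (F.obj (op W')).point (by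
      rw [map_point, hb W l (r ≫ k) (by rw [← Category.assoc, hl, Category.assoc, hr]),
        map_comp_apply, ha, map_point])
  -- The glued element is trivial off Z, so it extends to L; its pullback to S is the required
  -- extension.
  obtain ⟨e, -, he⟩ := hker L₁ W' m' l' hm' (by rwa [hl']) c hc2
  refine ⟨(F.map f.op).toFun e, fun N n h hn => ?_⟩
  obtain ⟨n₁, hn₁⟩ := hm.exists_lift n (fun x hx => by
    have h1 := hKD hx
    rw [Set.mem_preimage, ← Punctured.comp_apply, hn, Punctured.comp_apply] at h1
    exact hj.notMem _ h1)
  rw [← hb N n₁ h (by rw [← Category.assoc, hn₁, hn]), ← hc1, ← he, ← map_comp_apply,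
    ← map_comp_apply, ← map_comp_apply]
  congr 3
  rw [Category.assoc, hf₁, ← Category.assoc, hn₁]

end Abstract

/-! ### Extension on affine schemes étale over C -/

section Etale

variable {A : Type u} [CommRing A] {d : ℕ} {C : Scheme.{u}} (p : C ⟶ Spec (CommRingCat.of A))

theorem smooth_comp_of_etale (hp : SmoothOfRelativeDimension d p) {X : Scheme.{u}} (g : X ⟶ C)
    [Etale g] : SmoothOfRelativeDimension d (g ≫ p) := by
  have := smoothOfRelativeDimension_comp (n := 0) (m := d) g p
  rwa [Nat.zero_add] at this

variable (hp : SmoothOfRelativeDimension d p)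

/-- An affine scheme that is étale over `C`, as an object of `Punctured A d`. -/
noncomputable def Punctured.ofEtale {X : Scheme.{u}} (g : X ⟶ C) [hX : IsAffine X] [Etale g] :
    Punctured A d :=
  .ofAffine (g ≫ p) hX (smooth_comp_of_etale p hp g)

/-- The structure morphism of an affine scheme that is étale over `C`. -/
noncomputable def Punctured.ofEtaleHom (hC : IsAffine C) {X : Scheme.{u}} (g : X ⟶ C)
    [hX : IsAffine X] [Etale g] : Punctured.ofEtale p hp g ⟶ Punctured.ofAffine p hC hp :=
  Punctured.homMk (M := Punctured.ofEtale p hp g) (N := Punctured.ofAffine p hC hp) g rfl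

/-- A morphism between affine schemes that are étale over `C`. -/
noncomputable def Punctured.ofEtaleMap {X X' : Scheme.{u}} (g : X ⟶ C) [IsAffine X] [Etale g]
    (g' : X' ⟶ C) [IsAffine X'] [Etale g'] (f : X ⟶ X') (hf : f ≫ g' = g) :
    Punctured.ofEtale p hp g ⟶ Punctured.ofEtale p hp g' :=
  Punctured.homMk (M := Punctured.ofEtale p hp g) (N := Punctured.ofEtale p hp g') f
    (show f ≫ g' ≫ p = g ≫ p by rw [← Category.assoc, hf])

theorem Punctured.ofEtaleMap_comp (hC : IsAffine C) {X X' : Scheme.{u}} (g : X ⟶ C) [IsAffine X]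
    [Etale g] (g' : X' ⟶ C) [IsAffine X'] [Etale g'] (f : X ⟶ X') (hf : f ≫ g' = g) :
    ofEtaleMap p hp g g' f hf ≫ ofEtaleHom p hp hC g' = ofEtaleHom p hp hC g :=
  Punctured.hom_ext hf

theorem exists_isComplement_ofEtale {X : Scheme.{u}} (g : X ⟶ C) [hX : IsAffine X] [Etale g]
    {K : Set X} (hK : IsFiniteEtaleSubset (g ≫ p) K) :
    ∃ (M : Punctured A d) (m : M ⟶ Punctured.ofEtale p hp g), IsComplement m K :=
  exists_isComplement_of_isFiniteEtaleSubset (g ≫ p) hX (smooth_comp_of_etale p hp g) hK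

theorem isPuncture_ofEtale {X : Scheme.{u}} (g : X ⟶ C) [hX : IsAffine X] [Etale g]
    {K : Set X} (hK : IsFiniteEtaleSubset (g ≫ p) K) {M : Punctured A d}
    (m : M ⟶ Punctured.ofEtale p hp g) (hm : IsComplement m K) :
    IsPuncture A d (@IsFinite ⊓ @Etale) M.obj :=
  isPuncture_of_isComplement (g ≫ p) hX (smooth_comp_of_etale p hp g) hK m hm

variable (hC : IsAffine C) (F : (Punctured A d)ᵒᵖ ⥤ Pointed.{v})
  {U : Punctured A d} (j : U ⟶ Punctured.ofAffine p hC hp) (a : F.obj (op U))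

/-- The element `a` extends to the complement of `K` in `X`, where `X` is étale over `C`. -/
def ExtendsOff {X : Scheme.{u}} (g : X ⟶ C) [IsAffine X] [Etale g] (K : Set X) : Prop :=
  ∃ (M : Punctured A d) (m : M ⟶ Punctured.ofEtale p hp g), IsComplement m K ∧
    ExtendsTo F j a (m ≫ Punctured.ofEtaleHom p hp hC g)

variable {p hp hC F j a}

/-- The complement of K' maps into that of K. The conclusion concerns an arbitrary model `m` of the
complement, because models are unique only up to isomorphism. -/
theorem ExtendsOff.extendsTo {X X' : Scheme.{u}} {g : X ⟶ C} [IsAffine X] [Etale g] {K : Set X}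
    (h : ExtendsOff p hp hC F j a g K) {g' : X' ⟶ C} [IsAffine X'] [Etale g'] (f : X' ⟶ X)
    (hf : f ≫ g = g') {K' : Set X'} (hK : f ⁻¹' K ⊆ K') {M : Punctured A d}
    (m : M ⟶ Punctured.ofEtale p hp g') (hm : IsComplement m K') :
    ExtendsTo F j a (m ≫ Punctured.ofEtaleHom p hp hC g') := by
  obtain ⟨M₀, m₀, hm₀, h⟩ := h
  obtain ⟨l, hl⟩ := hm₀.exists_lift
    (m ≫ Punctured.ofEtaleMap p hp g' g f hf) (fun x hx => hm.notMem x (hK hx))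
  have := h.comp l
  rwa [← Category.assoc, hl, Category.assoc, Punctured.ofEtaleMap_comp] at this

theorem ExtendsOff.restrict {X X' : Scheme.{u}} {g : X ⟶ C} [IsAffine X] [Etale g] {K : Set X}
    (h : ExtendsOff p hp hC F j a g K) {g' : X' ⟶ C} [IsAffine X'] [Etale g'] (f : X' ⟶ X)
    (hf : f ≫ g = g') {K' : Set X'} (hK : f ⁻¹' K ⊆ K') (hK' : IsFiniteEtaleSubset (g' ≫ p) K') :
    ExtendsOff p hp hC F j a g' K' := by
  obtain ⟨M, m, hm⟩ := exists_isComplement_ofEtale p hp g' hK'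
  exact ⟨M, m, hm, h.extendsTo f hf hK m hm⟩

theorem ExtendsOff.mono {X : Scheme.{u}} {g : X ⟶ C} [IsAffine X] [Etale g] {K K' : Set X}
    (h : ExtendsOff p hp hC F j a g K) (hK : K ⊆ K') (hK' : IsFiniteEtaleSubset (g ≫ p) K') :
    ExtendsOff p hp hC F j a g K' :=
  h.restrict (𝟙 X) (Category.id_comp g) (by simpa using hK) hK'

variable {Y : Scheme.{u}} {i : Y ⟶ C}

/-- Once all of the preimage of Y is removed, X ∖ K maps to U and the pullback of `a` is itself an
extension. -/
theorem ExtendsOff.of_preimage (hj : IsComplement j (Set.range i)) {X : Scheme.{u}} {g : X ⟶ C}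
    [IsAffine X] [Etale g] {K : Set X} (hK : g ⁻¹' Set.range i ⊆ K)
    (hK' : IsFiniteEtaleSubset (g ≫ p) K) : ExtendsOff p hp hC F j a g K := by
  obtain ⟨M, m, hm⟩ := exists_isComplement_ofEtale p hp g hK'
  obtain ⟨l, hl⟩ := hj.exists_lift
    (m ≫ Punctured.ofEtaleHom p hp hC g) (fun x hx => hm.notMem x (hK hx))
  refine ⟨M, m, hm, (F.map l.op).toFun a, fun N n h hn => ?_⟩
  rw [← map_comp_apply, Punctured.cancel_open j hj.isOpenImmersion (l := n ≫ l) (l' := h)]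
  rw [Category.assoc, hl, hn]

/-- Finite étaleness of K and K' puts their complements into the class for which F is excisive; that
of the preimages of Y yields the complements on which the elements are compared. -/
theorem ExtendsOff.excision (hF : IsExcisive F) (hj : IsComplement j (Set.range i))
    {X X' T : Scheme.{u}} {g : X ⟶ C} [IsAffine X] [Etale g] {g' : X' ⟶ C} [IsAffine X'] [Etale g']
    (f : X ⟶ X') (hf : f ≫ g' = g) (τ : T ⟶ X) [IsClosedImmersion (τ ≫ f)]
    (hT : LocallyQuasiFinite (τ ≫ g ≫ p)) {K : Set X} {K' : Set X'}
    (hK : IsFiniteEtaleSubset (g ≫ p) K) (hK' : IsFiniteEtaleSubset (g' ≫ p) K')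
    (hD : IsFiniteEtaleSubset (g ≫ p) (g ⁻¹' Set.range i))
    (hD' : IsFiniteEtaleSubset (g' ≫ p) (g' ⁻¹' Set.range i))
    (hKT : g ⁻¹' Set.range i = K ∪ Set.range τ)
    (hKT' : g' ⁻¹' Set.range i = K' ∪ Set.range (τ ≫ f))
    (hdisj : Disjoint K (Set.range τ)) (hdisj' : Disjoint K' (Set.range (τ ≫ f)))
    (h : ExtendsOff p hp hC F j a g K) : ExtendsOff p hp hC F j a g' K' := by
  obtain ⟨M, m, hm, h⟩ := h
  obtain ⟨M', m', hm'⟩ := exists_isComplement_ofEtale p hp g' hK'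
  obtain ⟨V, o, ho⟩ := exists_isComplement_ofEtale p hp g hD
  obtain ⟨V', o', ho'⟩ := exists_isComplement_ofEtale p hp g' hD'
  have hfe : Etale f := by
    have : Etale (f ≫ g') := by rwa [hf]
    exact Etale.of_comp f g'
  have hτ : IsClosedImmersion τ := IsClosedImmersion.of_comp τ f
  exact ⟨M', m', hm', ExtendsTo.excision hF hj (Punctured.ofEtaleMap p hp g g' f hf)
    (Punctured.ofEtaleMap_comp p hp hC g g' f hf) hfe hm hm' (isPuncture_ofEtale p hp g hK m hm)
    (isPuncture_ofEtale p hp g' hK' m' hm') ho ho' τ hτ ‹_› hT hKT hKT' hdisj hdisj' h⟩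

end Etale

/-! ### Excision along clopen parts of the preimage of Y -/

section Clopen

variable {A : Type u} [CommRing A] {d : ℕ} {C : Scheme.{u}} {p : C ⟶ Spec (CommRingCat.of A)}
  {hp : SmoothOfRelativeDimension d p} {hC : IsAffine C} {F : (Punctured A d)ᵒᵖ ⥤ Pointed.{v}}
  {U : Punctured A d} {j : U ⟶ Punctured.ofAffine p hC hp} {a : F.obj (op U)}
  {Y : Scheme.{u}} {i : Y ⟶ C}

theorem etale_pullback_snd [Etale (i ≫ p)] {X : Scheme.{u}} (g : X ⟶ C) [Etale g] :
    Etale (pullback.snd i g ≫ g ≫ p) := by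
  rw [← pullback.condition_assoc]
  infer_instance

theorem preimage_range_eq_union {X T : Scheme.{u}} (g : X ⟶ C) (ρ : T ⟶ pullback i g) :
    g ⁻¹' Set.range i = pullback.snd i g '' (Set.range ρ)ᶜ ∪ Set.range (ρ ≫ pullback.snd i g) := by
  rw [show Set.range (ρ ≫ pullback.snd i g) = pullback.snd i g '' Set.range ρ by
      rw [← Set.range_comp]; exact congr_arg _ (funext fun x => Scheme.Hom.comp_apply _ _ x),
    ← Set.image_union, Set.compl_union_self, Set.image_univ, Scheme.Pullback.range_snd]

variable [IsClosedImmersion i]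

theorem isFiniteEtaleSubset_pullback_image [Etale (i ≫ p)] {X : Scheme.{u}} (g : X ⟶ C) [Etale g]
    (hfin : IsFinite (pullback.snd i g ≫ g ≫ p)) {O : Set ↥(pullback i g)} (hO : IsClopen O) :
    IsFiniteEtaleSubset (g ≫ p) (pullback.snd i g '' O) := by
  have : Etale (pullback.snd i g ≫ g ≫ p) := etale_pullback_snd g
  exact isFiniteEtaleSubset_image (g ≫ p) (pullback.snd i g) hO

/-- A monomorphism between finite étale schemes is the inclusion of a clopen subscheme. -/
theorem isClosedImmersion_isOpenImmersion_of_mono {T D S : Scheme.{u}} (ρ : T ⟶ D) (δ : D ⟶ S)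
    [IsFinite δ] [Etale δ] [Mono ρ] (h : IsFinite (ρ ≫ δ)) (h' : Etale (ρ ≫ δ)) :
    IsClosedImmersion ρ ∧ IsOpenImmersion ρ := by
  have : Etale ρ := Etale.of_comp ρ δ
  have : IsFinite ρ := IsFinite.of_comp ρ δ
  exact ⟨(IsClosedImmersion.iff_isFinite_and_mono ρ).2 ⟨inferInstance, inferInstance⟩,
    isOpenImmersion_of_etale_of_mono ρ⟩

theorem isClopen_range_of_mono {T D S : Scheme.{u}} (ρ : T ⟶ D) (δ : D ⟶ S)
    [IsFinite δ] [Etale δ] [Mono ρ] (h : IsFinite (ρ ≫ δ)) (h' : Etale (ρ ≫ δ)) :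
    IsClopen (Set.range ρ) := by
  obtain ⟨h1, h2⟩ := isClosedImmersion_isOpenImmersion_of_mono ρ δ h h'
  exact ⟨ρ.isClosedEmbedding.isClosed_range, ρ.isOpenEmbedding.isOpen_range⟩

theorem disjoint_image_compl_range {X T : Scheme.{u}} (g : X ⟶ C) (ρ : T ⟶ pullback i g) :
    Disjoint (pullback.snd i g '' (Set.range ρ)ᶜ) (Set.range (ρ ≫ pullback.snd i g)) := by
  rw [show Set.range (ρ ≫ pullback.snd i g) = pullback.snd i g '' Set.range ρ by
      rw [← Set.range_comp]; exact congr_arg _ (funext fun x => Scheme.Hom.comp_apply _ _ x),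
    Set.disjoint_image_iff (pullback.snd i g).isClosedEmbedding.injective]
  exact disjoint_compl_left

variable [Etale (i ≫ p)]

/-- Excision along a finite étale scheme `T` that is clopen in the preimages of `Y` both in `X` and
in `X'`. -/
theorem ExtendsOff.excision_of_mono (hF : IsExcisive F) (hj : IsComplement j (Set.range i))
    {X X' T : Scheme.{u}} {g : X ⟶ C} [IsAffine X] [Etale g] {g' : X' ⟶ C} [IsAffine X'] [Etale g']
    (f : X ⟶ X') (hf : f ≫ g' = g) (hfin : IsFinite (pullback.snd i g ≫ g ≫ p))
    (hfin' : IsFinite (pullback.snd i g' ≫ g' ≫ p))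
    (ρ : T ⟶ pullback i g) (ρ' : T ⟶ pullback i g') [Mono ρ']
    (hρ : ρ ≫ pullback.snd i g ≫ f = ρ' ≫ pullback.snd i g')
    (hT : IsFinite (ρ' ≫ pullback.snd i g' ≫ g' ≫ p))
    (hT' : Etale (ρ' ≫ pullback.snd i g' ≫ g' ≫ p))
    (h : ExtendsOff p hp hC F j a g (pullback.snd i g '' (Set.range ρ)ᶜ)) :
    ExtendsOff p hp hC F j a g' (pullback.snd i g' '' (Set.range ρ')ᶜ) := by
  have : Etale (pullback.snd i g ≫ g ≫ p) := etale_pullback_snd g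
  have : Etale (pullback.snd i g' ≫ g' ≫ p) := etale_pullback_snd g'
  have hρ' : ρ ≫ pullback.snd i g ≫ g ≫ p = ρ' ≫ pullback.snd i g' ≫ g' ≫ p := by
    rw [← reassoc_of% hρ, show g ≫ p = f ≫ g' ≫ p by rw [← hf, Category.assoc]]
  have hm : Mono (ρ ≫ pullback.snd i g ≫ f) := by rw [hρ]; infer_instance
  have : Mono ρ := mono_of_mono ρ (pullback.snd i g ≫ f)
  have hO := isClopen_range_of_mono ρ _ (by rwa [hρ']) (by rwa [hρ'])
  have hO' := isClopen_range_of_mono ρ' _ hT hT'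
  have hcl := (isClosedImmersion_isOpenImmersion_of_mono ρ' _ hT hT').1
  have hcl' : IsClosedImmersion ((ρ ≫ pullback.snd i g) ≫ f) := by
    rw [Category.assoc, hρ]; infer_instance
  have hD : ∀ {X : Scheme.{u}} (g : X ⟶ C) [Etale g] (_ : IsFinite (pullback.snd i g ≫ g ≫ p)),
      IsFiniteEtaleSubset (g ≫ p) (g ⁻¹' Set.range i) := by
    intro X g _ hfin
    rw [← Scheme.Pullback.range_snd, ← Set.image_univ]
    exact isFiniteEtaleSubset_pullback_image g hfin isClopen_univ
  refine ExtendsOff.excision hF hj f hf (ρ ≫ pullback.snd i g) ?_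
    (isFiniteEtaleSubset_pullback_image g hfin hO.compl)
    (isFiniteEtaleSubset_pullback_image g' hfin' hO'.compl) (hD g hfin) (hD g' hfin')
    (preimage_range_eq_union g ρ) ?_ (disjoint_image_compl_range g ρ) ?_ h
  · rw [Category.assoc, hρ']; infer_instance
  · rw [Category.assoc, hρ]; exact preimage_range_eq_union g' ρ'
  · rw [Category.assoc, hρ]; exact disjoint_image_compl_range g' ρ'

theorem isFinite_pullback_snd_comp {X X' Y C S : Scheme.{u}} (i : Y ⟶ C) (p : C ⟶ S)
    (g : X ⟶ C) (f : X' ⟶ X) [IsFinite f]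
    (hfin : IsFinite (pullback.snd i g ≫ g ≫ p)) :
    IsFinite (pullback.snd i (f ≫ g) ≫ (f ≫ g) ≫ p) := by
  let r : pullback i (f ≫ g) ⟶ pullback i g := pullback.lift (pullback.fst _ _)
    (pullback.snd _ _ ≫ f) (by rw [pullback.condition, Category.assoc])
  have hr : r ≫ pullback.fst i g = pullback.fst i (f ≫ g) := pullback.lift_fst _ _ _
  have hr' : r ≫ pullback.snd i g = pullback.snd i (f ≫ g) ≫ f := pullback.lift_snd _ _ _
  have sq : IsPullback r (pullback.snd i (f ≫ g)) (pullback.snd i g) f := by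
    refine IsPullback.of_right (h₁₂ := pullback.fst i g) (h₂₂ := g) (v₁₃ := i) ?_ hr'
      (IsPullback.of_hasPullback i g)
    rw [hr]
    exact IsPullback.of_hasPullback i (f ≫ g)
  have : IsFinite r := MorphismProperty.of_isPullback (P := @IsFinite) sq.flip ‹_›
  rw [Category.assoc, ← reassoc_of% hr']
  infer_instance

/-- If `T` is clopen in the preimage of `Y` in `X` and `a` extends to `C ×_A T`, then it extends
over `T` in `X`. -/
theorem ExtendsOff.of_baseChange (hF : IsExcisive F) (hj : IsComplement j (Set.range i))
    {X T : Scheme.{u}} {g : X ⟶ C} [IsAffine X] [Etale g]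
    (hfin : IsFinite (pullback.snd i g ≫ g ≫ p)) (t : T ⟶ Spec (CommRingCat.of A)) [IsFinite t]
    [Etale t] (ρ : T ⟶ pullback i g) [Mono ρ] (hρ : ρ ≫ pullback.snd i g ≫ g ≫ p = t)
    [IsAffine (pullback p t)] (h : ExtendsOff p hp hC F j a (pullback.fst p t) ∅) :
    ExtendsOff p hp hC F j a g (pullback.snd i g '' (Set.range ρ)ᶜ) := by
  -- X ×_A T is étale over both X and C_T. The graph of T ⟶ X makes T clopen in its preimage of Y,
  -- so the extension is restricted from C_T to X ×_A T and then excised along T down to X.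
  let f := pullback.fst (g ≫ p) t
  have : IsAffine (pullback (g ≫ p) t) := isAffine_of_isAffineHom f
  have hfin' := isFinite_pullback_snd_comp i p g f hfin
  let γ : T ⟶ pullback (g ≫ p) t := pullback.lift (ρ ≫ pullback.snd i g) (𝟙 T) (by simp [hρ])
  have hγ : γ ≫ f = ρ ≫ pullback.snd i g := pullback.lift_fst _ _ _
  let ρ' : T ⟶ pullback i (f ≫ g) := pullback.lift (ρ ≫ pullback.fst i g) γ (by
    rw [reassoc_of% hγ, Category.assoc, pullback.condition])
  have hρ' : ρ' ≫ pullback.snd i (f ≫ g) ≫ f = ρ ≫ pullback.snd i g := by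
    rw [pullback.lift_snd_assoc, hγ]
  have hm : Mono (ρ' ≫ pullback.snd i (f ≫ g) ≫ f) := by rw [hρ']; infer_instance
  have : Mono ρ' := mono_of_mono ρ' (pullback.snd i (f ≫ g) ≫ f)
  have : Etale (pullback.snd i (f ≫ g) ≫ (f ≫ g) ≫ p) := etale_pullback_snd _
  have hρ'' : ρ' ≫ pullback.snd i (f ≫ g) ≫ (f ≫ g) ≫ p = t := by
    rw [Category.assoc, reassoc_of% hρ', hρ]
  have hO := isClopen_range_of_mono ρ' _ (by rwa [hρ'']) (by rwa [hρ''])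
  refine ExtendsOff.excision_of_mono hF hj f rfl hfin' hfin ρ' ρ hρ' (by rwa [hρ]) (by rwa [hρ]) ?_
  refine h.restrict (pullback.lift (f ≫ g) (pullback.snd _ _) ?_) (pullback.lift_fst _ _ _) ?_
    (isFiniteEtaleSubset_pullback_image _ hfin' hO.compl)
  · rw [Category.assoc]; exact pullback.condition
  · simp

end Clopen

/-! ### From an étale map to affine space to an extension -/

section Neighbourhood

variable {A : Type u} [CommRing A] {d : ℕ} {C : Scheme.{u}} {p : C ⟶ Spec (CommRingCat.of A)}
  {hp : SmoothOfRelativeDimension d p} {hC : IsAffine C} {F : (Punctured A d)ᵒᵖ ⥤ Pointed.{v}}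
  {U V : Punctured A d} {j : U ⟶ Punctured.ofAffine p hC hp} {k : V ⟶ U} {a : F.obj (op U)}
  {Y Z : Scheme.{u}} {i : Y ⟶ C} {z : Z ⟶ C}

theorem isComplement_id {X : Punctured A d} : IsComplement (𝟙 X) ∅ :=
  ⟨show IsOpenImmersion (𝟙 X.obj.left) by infer_instance, by
    rw [Set.compl_empty, Set.range_eq_univ]
    exact fun x => ⟨x, rfl⟩⟩

theorem ExtendsOff.of_extendsTo {X : Scheme.{u}} {g : X ⟶ C} [IsAffine X] [Etale g]
    (h : ExtendsTo F j a (Punctured.ofEtaleHom p hp hC g)) :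
    ExtendsOff p hp hC F j a g ∅ :=
  ⟨_, 𝟙 _, isComplement_id, by rwa [Category.id_comp]⟩

/-- The étale excision step: the disjoint sections `σ k` of `X ⟶ T` land in the preimage of `Y`, and
`f : X ⟶ 𝔸ᵈ_T` is étale around the preimage of `Z` and restricts to a closed immersion there. Then
elements that extend off the sections extend to `X`. -/
theorem ExtendsOff.of_kerSurjective [IsClosedImmersion i] [IsClosedImmersion z]
    [Etale (i ≫ p)] (hF : IsExcisive F)
    (hj : IsComplement j (Set.range i)) (hk : IsComplement (k ≫ j) (Set.range z))
    (ha : (F.map k.op).toFun a = (F.obj (op V)).point) {ℓ : Y ⟶ Z} (hℓ : ℓ ≫ z = i)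
    {X T : Scheme.{u}} {g : X ⟶ C} [IsAffine X] [Etale g]
    (hfin : IsFinite (pullback.snd i g ≫ g ≫ p)) (hfinZ : IsFinite (pullback.snd z g ≫ g ≫ p))
    (x : X ⟶ T) (t : T ⟶ Spec (CommRingCat.of A)) [IsFinite t] [Etale t] (hx : x ≫ t = g ≫ p)
    {m : ℕ} (ρ : Fin m → (T ⟶ pullback i g)) (hρ : ∀ k, ρ k ≫ pullback.snd i g ≫ x = 𝟙 T)
    (f : X ⟶ 𝔸(ULift.{u} (Fin d); T)) (hf : f ≫ (𝔸(ULift.{u} (Fin d); T) ↘ T) = x)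
    (b : Γ(X, ⊤)) (hb : Etale ((X.basicOpen b).ι ≫ f))
    (hbZ : Set.range (pullback.snd z g) ⊆ X.basicOpen b)
    (hcl : IsClosedImmersion (pullback.snd z g ≫ f))
    (hker : KerSurjective F (Punctured.affineSpace d t)
      (⋃ k, Set.range (ρ k ≫ pullback.snd i g ≫ f)) (Set.range (pullback.snd z g ≫ f)))
    (h : ExtendsOff p hp hC F j a g (⋃ k, Set.range (ρ k ≫ pullback.snd i g))) :
    ExtendsOff p hp hC F j a g ∅ := by
  obtain ⟨S, o, σ, hS, ho, hσ, hfe, hfσ⟩ := exists_shrinking f (pullback.snd z g) b hb hbZ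
  have hτe : Etale (pullback.snd i g ≫ g ≫ p) := etale_pullback_snd g
  -- The open part S contains Z_X, hence also Y_X, which factors through Z_X by `c`. Thus `r`, from
  -- the preimage of Y in S to that in X, is an isomorphism with inverse `r₁`.
  let r : pullback i (o ≫ g) ⟶ pullback i g := pullback.lift (pullback.fst _ _)
    (pullback.snd _ _ ≫ o) (by rw [pullback.condition, Category.assoc])
  have hr : r ≫ pullback.fst i g = pullback.fst i (o ≫ g) := pullback.lift_fst _ _ _
  have hr' : r ≫ pullback.snd i g = pullback.snd i (o ≫ g) ≫ o := pullback.lift_snd _ _ _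
  let c : pullback i g ⟶ pullback z g := pullback.lift (pullback.fst _ _ ≫ ℓ)
    (pullback.snd _ _) (by rw [Category.assoc, hℓ, pullback.condition])
  have hc : c ≫ pullback.snd z g = pullback.snd i g := pullback.lift_snd _ _ _
  let r₁ : pullback i g ⟶ pullback i (o ≫ g) := pullback.lift (pullback.fst _ _) (c ≫ σ) (by
    rw [Category.assoc, reassoc_of% hσ, reassoc_of% hc, pullback.condition])
  have hr₁ : r₁ ≫ pullback.fst i (o ≫ g) = pullback.fst i g := pullback.lift_fst _ _ _
  have hr₁' : r₁ ≫ pullback.snd i (o ≫ g) = c ≫ σ := pullback.lift_snd _ _ _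
  have e₁ : r₁ ≫ r = 𝟙 _ := by
    apply pullback.hom_ext
    · rw [Category.assoc, hr, hr₁, Category.id_comp]
    · rw [Category.assoc, hr', reassoc_of% hr₁', hσ, hc, Category.id_comp]
  have e₂ : r ≫ r₁ = 𝟙 _ := by
    apply pullback.hom_ext
    · rw [Category.assoc, hr₁, hr, Category.id_comp]
    · rw [← cancel_mono o, Category.assoc, Category.assoc, reassoc_of% hr₁', hσ, hc, hr',
        Category.id_comp]
  have hri : IsIso r := ⟨r₁, e₂, e₁⟩
  have hfinS : IsFinite (pullback.snd i (o ≫ g) ≫ (o ≫ g) ≫ p) := by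
    rw [Category.assoc, ← reassoc_of% hr']
    infer_instance
  have hclD : IsClosedImmersion (pullback.snd i g ≫ f) := by
    have : IsClosedImmersion (c ≫ pullback.snd z g) := by rw [hc]; infer_instance
    have : IsClosedImmersion c := IsClosedImmersion.of_comp c (pullback.snd z g)
    rw [← hc, Category.assoc]
    infer_instance
  have htD : pullback.snd i g ≫ g ≫ p =
      (pullback.snd i g ≫ f) ≫ (𝔸(ULift.{u} (Fin d); T) ↘ T) ≫ t := by
    rw [Category.assoc, reassoc_of% hf, hx]
  have hO : IsClopen (⋃ k, Set.range (ρ k)) := by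
    refine isClopen_iUnion_of_finite fun k => ?_
    have h1 : ρ k ≫ pullback.snd i g ≫ g ≫ p = t := by rw [← hx, reassoc_of% hρ k]
    have : Mono (ρ k ≫ pullback.snd i g ≫ x) := by rw [hρ]; infer_instance
    have : Mono (ρ k) := mono_of_mono (ρ k) (pullback.snd i g ≫ x)
    exact isClopen_range_of_mono (ρ k) _ (by rwa [h1]) (by rwa [h1])
  have himage : ∀ {W : Scheme.{u}} (w : pullback i g ⟶ W),
      w '' (⋃ k, Set.range (ρ k)) = ⋃ k, Set.range (ρ k ≫ w) := by
    intro W w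
    rw [Set.image_iUnion]
    refine Set.iUnion_congr fun k => ?_
    rw [← Set.range_comp]
    exact congr_arg _ (funext fun x => (Scheme.Hom.comp_apply _ _ x).symm)
  let K : Set S := o ⁻¹' ⋃ k, Set.range (ρ k ≫ pullback.snd i g)
  have hK : IsFiniteEtaleSubset ((o ≫ g) ≫ p) K := by
    have : K = pullback.snd i (o ≫ g) '' (r ⁻¹' ⋃ k, Set.range (ρ k)) := by
      ext s
      simp only [K, Set.mem_preimage, ← himage]
      constructor
      · rintro ⟨w, hw, hws⟩
        refine ⟨r₁ w, ?_, o.isOpenEmbedding.injective ?_⟩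
        · rw [Set.mem_preimage, ← Scheme.Hom.comp_apply, e₁]
          exact hw
        · rw [← hws, ← Scheme.Hom.comp_apply, ← Scheme.Hom.comp_apply, reassoc_of% hr₁', hσ, hc]
      · rintro ⟨w, hw, rfl⟩
        refine ⟨r w, hw, ?_⟩
        change pullback.snd i g (r w) = o (pullback.snd i (o ≫ g) w)
        rw [← Scheme.Hom.comp_apply, hr', Scheme.Hom.comp_apply]
    rw [this]
    exact isFiniteEtaleSubset_pullback_image (o ≫ g) hfinS (hO.preimage r.continuous)
  obtain ⟨S₁, m₁, hm₁⟩ := exists_isComplement_ofEtale p hp (o ≫ g) hK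
  have hL : IsAffine (𝔸(ULift.{u} (Fin d); T)) := by
    have : IsAffine T := isAffine_of_isAffineHom t
    infer_instance
  have hLs : SmoothOfRelativeDimension d ((𝔸(ULift.{u} (Fin d); T) ↘ T) ≫ t) :=
    smoothOfRelativeDimension_comp (n := d) (m := 0) _ t
  have hK' : IsFiniteEtaleSubset ((𝔸(ULift.{u} (Fin d); T) ↘ T) ≫ t)
      (⋃ k, Set.range (ρ k ≫ pullback.snd i g ≫ f)) := by
    rw [← himage]
    have : IsFinite ((pullback.snd i g ≫ f) ≫ (𝔸(ULift.{u} (Fin d); T) ↘ T) ≫ t) := by rwa [← htD]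
    have : Etale ((pullback.snd i g ≫ f) ≫ (𝔸(ULift.{u} (Fin d); T) ↘ T) ≫ t) := by rwa [← htD]
    exact isFiniteEtaleSubset_image _ _ hO
  obtain ⟨L₁, m', hm'⟩ := exists_isComplement_of_isFiniteEtaleSubset _ hL hLs hK'
  have hσcl : IsClosedImmersion σ := by
    have : IsClosedImmersion (σ ≫ o) := by rw [hσ]; infer_instance
    exact IsClosedImmersion.of_comp σ o
  have hσf : σ ≫ o ≫ f = pullback.snd z g ≫ f := by rw [reassoc_of% hσ]
  have hlq : IsFinite (σ ≫ (o ≫ g) ≫ p) := by rwa [Category.assoc, reassoc_of% hσ]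
  have hlq' : IsFinite ((pullback.snd z g ≫ f) ≫ (𝔸(ULift.{u} (Fin d); T) ↘ T) ≫ t) := by
    rwa [Category.assoc, reassoc_of% hf, hx]
  obtain ⟨W, w, hw⟩ := exists_isComplement ((o ≫ g) ≫ p) hS (smooth_comp_of_etale p hp (o ≫ g)) σ
  obtain ⟨W', w', hw'⟩ := exists_isComplement ((𝔸(ULift.{u} (Fin d); T) ↘ T) ≫ t) hL hLs
    (pullback.snd z g ≫ f)
  have hρc : ∀ k, ρ k ≫ pullback.snd i g = (ρ k ≫ c) ≫ pullback.snd z g := fun k => by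
    rw [Category.assoc, hc]
  have key : ExtendsTo F j a (Punctured.ofEtaleHom p hp hC (o ≫ g)) := by
    refine ExtendsTo.of_kerSurjective hF hj hk ha (S := Punctured.ofEtale p hp (o ≫ g))
      (L := Punctured.affineSpace d t) (K := K) hm₁ hm'
      (isPuncture_ofEtale p hp (o ≫ g) hK m₁ hm₁)
      (isPuncture_of_isComplement _ hL hLs hK' m' hm')
      (Punctured.homMk (M := Punctured.ofEtale p hp (o ≫ g)) (N := Punctured.affineSpace d t)
        (o ≫ f) (show (o ≫ f) ≫ (𝔸(ULift.{u} (Fin d); T) ↘ T) ≫ t = (o ≫ g) ≫ p by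
          rw [Category.assoc, reassoc_of% hf, hx, Category.assoc])) hfe σ hσcl
      (show IsClosedImmersion (σ ≫ o ≫ f) by rwa [hσf])
      (show LocallyQuasiFinite (σ ≫ (o ≫ g) ≫ p) by infer_instance)
      (show (o ≫ f) ⁻¹' Set.range (σ ≫ o ≫ f) ⊆ Set.range σ by rwa [hσf])
      (show (o ≫ g) ⁻¹' Set.range z = Set.range σ from ?_)
      (show K ⊆ (o ≫ g) ⁻¹' Set.range i from ?_) (show Set.range i ⊆ Set.range z from ?_)
      (show ∀ x : S, (o ≫ f) x ∈ (⋃ k, Set.range (ρ k ≫ pullback.snd i g ≫ f)) ↔ x ∈ K from ?_)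
      (show (⋃ k, Set.range (ρ k ≫ pullback.snd i g ≫ f)) ⊆ Set.range (σ ≫ o ≫ f) from ?_)
      hw (show IsComplement w' (Set.range (σ ≫ o ≫ f)) by rwa [hσf])
      (show KerSurjective F (Punctured.affineSpace d t) _ (Set.range (σ ≫ o ≫ f)) by rwa [hσf])
      (h.extendsTo o rfl subset_rfl m₁ hm₁)
    · ext s
      rw [Set.mem_preimage, Scheme.Hom.comp_apply, ← Set.mem_preimage,
        ← Scheme.Pullback.range_snd]
      constructor
      · rintro ⟨y, hy⟩
        refine ⟨y, o.isOpenEmbedding.injective ?_⟩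
        rw [← hy, ← Scheme.Hom.comp_apply, hσ]
      · rintro ⟨y, rfl⟩
        exact ⟨y, by rw [← Scheme.Hom.comp_apply, hσ]⟩
    · intro s hs
      rw [Set.mem_preimage, Scheme.Hom.comp_apply]
      simp only [K, Set.mem_preimage, Set.mem_iUnion] at hs
      obtain ⟨k, y, hy⟩ := hs
      refine ⟨(ρ k ≫ pullback.fst i g) y, ?_⟩
      rw [← hy, ← Scheme.Hom.comp_apply, ← Scheme.Hom.comp_apply, Category.assoc, Category.assoc,
        pullback.condition]
    · rw [← hℓ]
      rintro _ ⟨y, rfl⟩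
      exact ⟨ℓ y, by rw [Scheme.Hom.comp_apply]⟩
    · intro s
      simp only [K, Set.mem_preimage, Set.mem_iUnion]
      constructor
      · rintro ⟨k, y, hy⟩
        obtain ⟨s', rfl⟩ : s ∈ Set.range σ := hfσ ⟨(ρ k ≫ c) y, by
          rw [← hy, ← Scheme.Hom.comp_apply, reassoc_of% hρc, Category.assoc]⟩
        refine ⟨k, y, ?_⟩
        rw [← Scheme.Hom.comp_apply, hσf, ← Category.assoc, hρc, Category.assoc,
          Scheme.Hom.comp_apply (ρ k ≫ c)] at hy
        rw [hρc, Scheme.Hom.comp_apply (ρ k ≫ c),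
          (pullback.snd z g ≫ f).isClosedEmbedding.injective hy, ← Scheme.Hom.comp_apply, hσ]
      · rintro ⟨k, y, hy⟩
        refine ⟨k, y, ?_⟩
        rw [← Category.assoc, Scheme.Hom.comp_apply, hy, Scheme.Hom.comp_apply]
    · intro s hs
      simp only [Set.mem_iUnion] at hs
      obtain ⟨k, y, rfl⟩ := hs
      refine ⟨(ρ k ≫ c) y, ?_⟩
      rw [hσf, ← Scheme.Hom.comp_apply, ← Category.assoc, ← Category.assoc, hρc, Category.assoc]
  -- From S back to X: excision along the whole preimage of Y, which S and X share.
  have := ExtendsOff.excision_of_mono hF hj o rfl hfinS hfin (𝟙 _) r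
    (by rw [Category.id_comp, hr']) (by infer_instance) (by infer_instance)
    (by simpa [Set.range_eq_univ.2 fun x => ⟨x, rfl⟩] using ExtendsOff.of_extendsTo key)
  have hrr : Set.range r = Set.univ := Set.range_eq_univ.2 r.surjective
  simpa [hrr] using this

end Neighbourhood

/-! ### Differentials and étale coordinates at a point -/

section Frame

open TensorProduct

/-- An algebra map between formally smooth algebras that carries a basis of differentials to a basis
of differentials is formally étale. -/
theorem formallyEtale_of_basis {R Q L : Type*} [CommRing R] [CommRing Q] [CommRing L] [Algebra R Q]
    [Algebra R L] [Algebra Q L] [IsScalarTower R Q L] [Algebra.FormallySmooth R L] {ι : Type*}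
    (b : Module.Basis ι Q (Ω[Q⁄R])) (c : Module.Basis ι L (Ω[L⁄R]))
    (h : ∀ i, KaehlerDifferential.map R R Q L (b i) = c i) : Algebra.FormallyEtale Q L := by
  have hbij : Function.Bijective (KaehlerDifferential.mapBaseChange R Q L) := by
    have : KaehlerDifferential.mapBaseChange R Q L =
        ((b.baseChange L).equiv c (Equiv.refl ι)).toLinearMap := by
      refine (b.baseChange L).ext fun i => ?_
      rw [Module.Basis.baseChange_apply, KaehlerDifferential.mapBaseChange_tmul, one_smul, h,
        LinearEquiv.coe_coe, ← Module.Basis.baseChange_apply, Module.Basis.equiv_apply]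
      rfl
    rw [this]
    exact LinearEquiv.bijective _
  -- The Jacobi–Zariski sequence of R ⟶ Q ⟶ L: surjectivity of the base change map on differentials
  -- kills Ω[L⁄Q]; its injectivity, with the vanishing of H₁ of L over R, kills H₁ of L over Q.
  constructor
  · refine ⟨fun x y => ?_⟩
    have key : ∀ x : Ω[L⁄Q], x = 0 := by
      intro x
      obtain ⟨y, rfl⟩ := KaehlerDifferential.map_surjective R Q L x
      exact (KaehlerDifferential.exact_mapBaseChange_map R Q L y).2 (hbij.2 y)
    rw [key x, key y]
  · have hs : Subsingleton (Algebra.H1Cotangent R L) := Algebra.FormallySmooth.subsingleton_h1Cotangent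
    refine ⟨fun x y => ?_⟩
    have key : ∀ x : Algebra.H1Cotangent Q L, x = 0 := by
      intro x
      have h0 : Algebra.H1Cotangent.δ R Q L x = 0 := by
        apply hbij.1
        rw [map_zero]
        exact (Algebra.H1Cotangent.exact_δ_mapBaseChange R Q L _).2 ⟨x, rfl⟩
      obtain ⟨w, rfl⟩ := (Algebra.H1Cotangent.exact_map_δ R Q L x).1 h0
      rw [Subsingleton.elim w 0, map_zero]
    rw [key x, key y]

/-- At a prime of a smooth algebra of relative dimension `d`, the local ring is formally smooth and
its differentials are free of rank `d`. -/
theorem exists_basis_kaehlerDifferential {R P : Type u} [CommRing R] [CommRing P] [Algebra R P]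
    {d : ℕ} (h : RingHom.Locally (fun f => RingHom.IsStandardSmoothOfRelativeDimension d f)
      (algebraMap R P)) (z : Ideal P) [z.IsPrime] :
    Algebra.FormallySmooth R (Localization.AtPrime z) ∧
      Nonempty (Module.Basis (Fin d) (Localization.AtPrime z) (Ω[Localization.AtPrime z⁄R])) := by
  obtain ⟨s, hs, h⟩ := h
  obtain ⟨t, hts, htz⟩ : ∃ t ∈ s, t ∉ z := by
    by_contra! hcon
    exact ‹z.IsPrime›.ne_top (top_le_iff.1 (hs ▸ Ideal.span_le.2 hcon))
  have ht := h t hts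
  let S := Localization.Away t
  let L := Localization.AtPrime z
  have hS : Algebra.IsStandardSmoothOfRelativeDimension d R S := by
    have : @Algebra.IsStandardSmoothOfRelativeDimension d R S _ _
        ((algebraMap P S).comp (algebraMap R P)).toAlgebra := ht
    convert! this
    refine Algebra.algebra_ext _ _ fun r => ?_
    exact IsScalarTower.algebraMap_apply R P S r
  have hu : IsUnit (algebraMap P L t) := IsLocalization.map_units L (⟨t, htz⟩ : z.primeCompl)
  let alg : Algebra S L := (IsLocalization.Away.lift t hu).toAlgebra
  have tow : IsScalarTower P S L := IsScalarTower.of_algebraMap_eq fun x =>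
    (IsLocalization.Away.lift_eq t hu x).symm
  have tow' : IsScalarTower R S L := IsScalarTower.of_algebraMap_eq fun x => by
    rw [IsScalarTower.algebraMap_apply R P S, ← IsScalarTower.algebraMap_apply P S L,
      ← IsScalarTower.algebraMap_apply R P L]
  have hle : Submonoid.powers t ≤ z.primeCompl := Submonoid.powers_le.2 htz
  have hloc : IsLocalization (z.primeCompl.map (algebraMap P S)) L :=
    IsLocalization.isLocalization_of_submonoid_le S L (Submonoid.powers t) z.primeCompl hle
  -- The local ring is a localization of the standard smooth algebra S, so a basis of differentials
  -- of S stays a basis.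
  have : Algebra.FormallyEtale S L :=
    Algebra.FormallyEtale.of_isLocalization (z.primeCompl.map (algebraMap P S))
  have : Algebra.IsStandardSmooth R S :=
    Algebra.IsStandardSmoothOfRelativeDimension.isStandardSmooth d
  have : Nontrivial S := (algebraMap S L).domain_nontrivial
  have hr : Module.finrank S (Ω[S⁄R]) = d := by
    rw [Module.finrank, Algebra.IsStandardSmoothOfRelativeDimension.rank_kaehlerDifferential d,
      Cardinal.toNat_natCast]
  refine ⟨Algebra.FormallySmooth.comp R S L, ⟨?_⟩⟩
  exact ((Module.finBasisOfFinrankEq S (Ω[S⁄R]) hr).baseChange L).map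
    (KaehlerDifferential.tensorKaehlerEquivOfFormallyEtale R S L)

/-- Relative differentials at a prime of a smooth algebra, in coordinates: functions with linearly
independent differentials are étale coordinates. -/
theorem exists_frame_derivation {R P : Type u} [CommRing R] [CommRing P] [Algebra R P]
    {ι : Type u} [Fintype ι]
    (h : RingHom.Locally (fun f => RingHom.IsStandardSmoothOfRelativeDimension (Fintype.card ι) f)
      (algebraMap R P)) (z : Ideal P) [z.IsPrime] :
    ∃ D : Derivation R P (ι → z.ResidueField),
      Submodule.span z.ResidueField (Set.range D) = ⊤ ∧
      ∀ f : ι → P, LinearIndependent z.ResidueField (fun i => D (f i)) →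
        ((algebraMap P (Localization.AtPrime z)).comp
          (MvPolynomial.aeval (R := R) f).toRingHom).FormallyEtale := by
  classical
  obtain ⟨hsm, ⟨c₀⟩⟩ := exists_basis_kaehlerDifferential h z
  let L := Localization.AtPrime z
  let κ := z.ResidueField
  let c := c₀.reindex (Fintype.equivFin ι).symm
  -- Coordinates of a differential in the basis `c`, reduced to the residue field.
  let Ψ : Ω[L⁄R] →ₗ[P] (ι → κ) :=
    ((IsScalarTower.toAlgHom P L κ).toLinearMap.compLeft ι).comp
      (c.equivFun.toLinearMap.restrictScalars P)
  let D : Derivation R P (ι → κ) := Ψ.compDer ((KaehlerDifferential.D R L).compAlgebraMap P)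
  have hΨ : ∀ (l : L) (w : Ω[L⁄R]), Ψ (l • w) = algebraMap L κ l • Ψ w := by
    intro l w
    ext i
    change algebraMap L κ (c.equivFun (l • w) i) = _
    rw [map_smul, Pi.smul_apply, smul_eq_mul, map_mul]
    rfl
  have hD : ∀ x, D x = Ψ (KaehlerDifferential.D R L (algebraMap P L x)) := fun x => rfl
  have hΨs : Function.Surjective Ψ := by
    intro v
    choose w hw using fun i => IsLocalRing.residue_surjective (v i)
    refine ⟨c.equivFun.symm w, funext fun i => ?_⟩
    change algebraMap L κ (c.equivFun (c.equivFun.symm w) i) = _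
    rw [LinearEquiv.apply_symm_apply]
    exact hw i
  refine ⟨D, top_le_iff.1 ?_, fun f hf => ?_⟩
  · intro v _
    obtain ⟨w, rfl⟩ := hΨs v
    have hw : w ∈ Submodule.span L (Set.range
        (KaehlerDifferential.map R R P L ∘ KaehlerDifferential.D R P)) := by
      rw [KaehlerDifferential.span_range_map_derivation_of_isLocalization R P L z.primeCompl]
      trivial
    induction hw using Submodule.span_induction with
    | mem x hx =>
      obtain ⟨x, rfl⟩ := hx
      refine Submodule.subset_span ⟨x, ?_⟩
      rw [hD, Function.comp_apply, KaehlerDifferential.map_D]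
    | zero => rw [map_zero]; exact Submodule.zero_mem _
    | add x y _ _ hx hy => rw [map_add]; exact Submodule.add_mem _ (hx trivial) (hy trivial)
    | smul l x _ hx => rw [hΨ]; exact Submodule.smul_mem _ _ (hx trivial)
  · let Q := MvPolynomial ι R
    let df : ι → Ω[L⁄R] := fun i => KaehlerDifferential.D R L (algebraMap P L (f i))
    -- Independence over the residue field makes the Jacobian determinant nonzero there, hence a
    -- unit in the local ring L; so the differentials of the `f i` form a basis.
    have hdet : IsUnit (c.det df) := by
      have h1 : IsUnit (Matrix.of fun i => D (f i)) :=
        Matrix.linearIndependent_rows_iff_isUnit.1 hf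
      have h2 : (Matrix.of fun i => D (f i)) = ((c.toMatrix df).map (algebraMap L κ)).transpose := by
        ext i k
        rfl
      rw [h2, Matrix.isUnit_transpose, Matrix.isUnit_iff_isUnit_det, ← RingHom.mapMatrix_apply,
        ← RingHom.map_det] at h1
      rw [Module.Basis.det_apply]
      exact (isUnit_map_iff (IsLocalRing.residue L) _).1 h1
    have hb := c.is_basis_iff_det.2 hdet
    let c' : Module.Basis ι L (Ω[L⁄R]) := Module.Basis.mk hb.1 hb.2.ge
    let alg : Algebra Q L :=
      ((algebraMap P L).comp (MvPolynomial.aeval (R := R) f).toRingHom).toAlgebra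
    have hQL : ∀ x : Q, algebraMap Q L x = algebraMap P L (MvPolynomial.aeval f x) := fun x => rfl
    have tow : IsScalarTower R Q L := IsScalarTower.of_algebraMap_eq fun r => by
      rw [hQL, MvPolynomial.algebraMap_eq, MvPolynomial.aeval_C, ← IsScalarTower.algebraMap_apply]
    exact formallyEtale_of_basis (KaehlerDifferential.mvPolynomialBasis R ι) c' fun i => by
      rw [KaehlerDifferential.mvPolynomialBasis_apply, KaehlerDifferential.map_D, hQL,
        MvPolynomial.aeval_X, Module.Basis.mk_apply]

end Frame

/-! ### From étale coordinates that separate points to closed embeddings -/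

section Coordinates

open TensorProduct

/-- Isolates the embedding of an algebraic extension, which turns closed points into geometric
points. -/
theorem nonempty_algHom_of_isAlgClosed (k F K : Type*) [Field k] [Field F] [Field K] [Algebra k F]
    [Algebra k K] [IsAlgClosed K] [Algebra.IsAlgebraic k F] : Nonempty (F →ₐ[k] K) :=
  ⟨IsAlgClosed.lift⟩

/-- A maximal ideal of an integral algebra is the kernel of a geometric point. -/
theorem exists_algHom_ker_eq {R W : Type*} [CommRing R] [CommRing W] [Algebra R W]
    [Algebra.IsIntegral R W] (y : Ideal R) [y.IsMaximal] (w : Ideal W) [w.IsMaximal]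
    (h : y = w.comap (algebraMap R W)) :
    ∃ χ : W →ₐ[R] AlgebraicClosure y.ResidueField, RingHom.ker χ = w := by
  let alg : Algebra y.ResidueField w.ResidueField :=
    (Ideal.ResidueField.map y w (algebraMap R W) h).toAlgebra
  have tow : IsScalarTower R y.ResidueField w.ResidueField :=
    IsScalarTower.of_algebraMap_eq fun x => by
      rw [IsScalarTower.algebraMap_apply R W w.ResidueField]
      exact (Ideal.ResidueField.map_algebraMap y w (algebraMap R W) h x).symm
  have hint : Algebra.IsIntegral y.ResidueField w.ResidueField := by
    refine ⟨fun x => ?_⟩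
    obtain ⟨x, rfl⟩ := w.algebraMap_residueField_surjective x
    have h1 : IsIntegral R (algebraMap W w.ResidueField x) :=
      (Algebra.IsIntegral.isIntegral (R := R) x).algebraMap
    exact h1.tower_top
  have : Algebra.IsAlgebraic y.ResidueField w.ResidueField := hint.isAlgebraic
  obtain ⟨l⟩ := nonempty_algHom_of_isAlgClosed y.ResidueField w.ResidueField
    (AlgebraicClosure y.ResidueField)
  refine ⟨(l.restrictScalars R).comp (IsScalarTower.toAlgHom R W w.ResidueField), ?_⟩
  ext x
  change l (algebraMap W w.ResidueField x) = 0 ↔ x ∈ w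
  rw [map_eq_zero, Ideal.algebraMap_residueField_eq_zero]

/-- If `E` is finite over `R` and unramified over a polynomial ring `Q` over `R`, and if the
geometric points of `E` over closed points of `Spec R` are separated by `Q`, then `Q ⟶ E` is
surjective. -/
theorem surjective_algebraMap_of_separates {R Q E : Type*} [CommRing R] [CommRing Q] [CommRing E]
    [Algebra R Q] [Algebra R E] [Algebra Q E] [IsScalarTower R Q E] [Module.Finite R E]
    [Algebra.FormallyUnramified Q E]
    (hsep : ∀ (y : Ideal R) [y.IsMaximal] (φ ψ : E →ₐ[R] AlgebraicClosure y.ResidueField),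
      (∀ x : Q, φ (algebraMap Q E x) = ψ (algebraMap Q E x)) → φ = ψ) :
    Function.Surjective (algebraMap Q E) := by
  have : Module.Finite Q E := Module.Finite.of_restrictScalars_finite R Q E
  rw [← Algebra.isEpi_iff_surjective_algebraMap_of_finite, Algebra.isEpi_iff_forall_one_tmul_eq]
  have hidem : IsIdempotentElem (KaehlerDifferential.ideal Q E) :=
    (KaehlerDifferential.ideal Q E).cotangent_subsingleton_iff.1
      (inferInstanceAs (Subsingleton (Ω[E⁄Q])))
  -- As Q ⟶ E is unramified, the diagonal ideal is idempotent; being finitely generated, it is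
  -- generated by an idempotent.
  obtain ⟨ε, hε, hI⟩ := (Ideal.isIdempotentElem_iff_of_fg _ (KaehlerDifferential.ideal_fg Q E)).1
    hidem
  suffices ε = 0 by
    intro a
    have h1 := KaehlerDifferential.one_smul_sub_smul_one_mem_ideal Q a
    rw [hI, this] at h1
    simpa [sub_eq_zero] using h1
  -- Otherwise some geometric point of E ⊗[Q] E has ε = 1. Its two components are points of E that
  -- agree on Q, hence are equal, so the diagonal ideal vanishes there: a contradiction.
  by_contra hne
  have hnu : ¬ IsUnit (1 - ε) := fun h => hne (by
    refine h.mul_right_eq_zero.1 ?_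
    rw [sub_mul, one_mul, hε.eq, sub_self])
  obtain ⟨w, hw, hwε⟩ := exists_max_ideal_of_mem_nonunits hnu
  have hεw : ε ∉ w := fun h => hw.ne_top ((Ideal.eq_top_iff_one _).2 (by
    simpa using w.add_mem hwε h))
  have hint : Algebra.IsIntegral R (E ⊗[Q] E) := by
    have : Algebra.IsIntegral E (E ⊗[Q] E) := inferInstance
    exact Algebra.IsIntegral.trans (R := R) E
  have : (w.comap (algebraMap R (E ⊗[Q] E))).IsMaximal :=
    Ideal.isMaximal_comap_of_isIntegral_of_isMaximal w
  obtain ⟨χ, hχ⟩ := exists_algHom_ker_eq (w.comap (algebraMap R (E ⊗[Q] E))) w rfl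
  have heq := hsep _ (χ.comp (Algebra.TensorProduct.includeLeft (R := Q) (S := R) (A := E) (B := E)))
    (χ.comp ((Algebra.TensorProduct.includeRight (R := Q) (A := E) (B := E)).restrictScalars R))
    (fun x => by
      change χ (algebraMap Q E x ⊗ₜ 1) = χ (1 ⊗ₜ algebraMap Q E x)
      rw [Algebra.algebraMap_eq_smul_one, TensorProduct.smul_tmul])
  have hle : KaehlerDifferential.ideal Q E ≤ w := by
    rw [← KaehlerDifferential.span_range_eq_ideal, Ideal.span_le]
    rintro _ ⟨x, rfl⟩
    rw [SetLike.mem_coe, ← hχ, RingHom.mem_ker, map_sub, sub_eq_zero]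
    exact (DFunLike.congr_fun heq x).symm
  exact hεw (hle (by rw [hI]; exact Ideal.mem_span_singleton_self ε))

/-- Functions on a finitely presented algebra that are étale coordinates at the closed points of
`V(J)` are étale coordinates on a principal open containing `V(J)`. -/
theorem exists_etale_away {R P ι : Type*} [CommRing R] [CommRing P] [Algebra R P] [Finite ι]
    [Algebra.FinitePresentation R P] (J : Ideal P) (f : ι → P)
    (h : ∀ (z : Ideal P) [z.IsMaximal], J ≤ z → ((algebraMap P (Localization.AtPrime z)).comp
      (MvPolynomial.aeval (R := R) f).toRingHom).FormallyEtale) :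
    ∃ h : P, h - 1 ∈ J ∧ ((algebraMap P (Localization.Away h)).comp
      (MvPolynomial.aeval (R := R) f).toRingHom).Etale := by
  let Q := MvPolynomial ι R
  let alg : Algebra Q P := (MvPolynomial.aeval (R := R) f).toRingHom.toAlgebra
  have tow : IsScalarTower R Q P := IsScalarTower.of_algebraMap_eq fun r =>
    ((MvPolynomial.aeval (R := R) f).commutes r).symm
  have : Algebra.FinitePresentation Q P :=
    Algebra.FinitePresentation.of_restrict_scalars_finitePresentation R Q P
  have hat : ∀ (z : Ideal P) [z.IsMaximal], J ≤ z → Algebra.IsEtaleAt Q z := by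
    intro z _ hz
    have h1 : @Algebra.FormallyEtale Q (Localization.AtPrime z) _ _
      ((algebraMap P (Localization.AtPrime z)).comp
      (MvPolynomial.aeval (R := R) f).toRingHom).toAlgebra := h z hz
    rw [Algebra.IsEtaleAt]
    convert! h1
    refine Algebra.algebra_ext _ _ fun r => ?_
    exact IsScalarTower.algebraMap_apply Q P (Localization.AtPrime z) r
  obtain ⟨𝔞, h𝔞⟩ := (PrimeSpectrum.isClosed_iff_zeroLocus_ideal _).1
    (Algebra.isOpen_etaleLocus (R := Q) (A := P)).isClosed_compl
  -- The complement V(𝔞) of the étale locus has no closed point on V(J), hence misses V(J).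
  have htop : 𝔞 ⊔ J = ⊤ := by
    by_contra hne
    obtain ⟨z, hz, hle⟩ := Ideal.exists_le_maximal _ hne
    have h1 : (⟨z, hz.isPrime⟩ : PrimeSpectrum P) ∈ PrimeSpectrum.zeroLocus (𝔞 : Set P) :=
      fun x hx => hle (Ideal.mem_sup_left hx)
    rw [← h𝔞] at h1
    exact h1 (hat z (le_sup_right.trans hle))
  obtain ⟨a, ha, b, hb, hab⟩ := Submodule.mem_sup.1 ((Ideal.eq_top_iff_one _).1 htop)
  refine ⟨a, by rw [← hab, sub_add_cancel_left]; exact J.neg_mem hb, ?_⟩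
  have hsub : (PrimeSpectrum.basicOpen a : Set (PrimeSpectrum P)) ⊆ Algebra.etaleLocus Q P := by
    intro x hx
    by_contra hcon
    have : x ∈ (Algebra.etaleLocus Q P)ᶜ := hcon
    rw [h𝔞] at this
    exact hx (this ha)
  have het : Algebra.Etale Q (Localization.Away a) :=
    Algebra.basicOpen_subset_etaleLocus_iff_etale.1 hsub
  change @Algebra.Etale Q (Localization.Away a) _ _ ((algebraMap P (Localization.Away a)).comp
      (MvPolynomial.aeval (R := R) f).toRingHom).toAlgebra
  convert! het
  refine Algebra.algebra_ext _ _ fun r => ?_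
  exact (IsScalarTower.algebraMap_apply Q P (Localization.Away a) r).symm

/-- Functions that are étale coordinates around `V(J)` and separate its geometric points generate
`P ⧸ J`, if the latter is finite. -/
theorem surjective_mk_comp_aeval {R P ι : Type*} [CommRing R] [CommRing P] [Algebra R P]
    (J : Ideal P) [Module.Finite R (P ⧸ J)] (f : ι → P) (h : P) (hJ : h - 1 ∈ J)
    (hh : ((algebraMap P (Localization.Away h)).comp
      (MvPolynomial.aeval (R := R) f).toRingHom).Etale)
    (hsep : ∀ (y : Ideal R) [y.IsMaximal] (φ ψ : P →ₐ[R] AlgebraicClosure y.ResidueField),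
      J ≤ RingHom.ker φ → J ≤ RingHom.ker ψ → (∀ k, φ (f k) = ψ (f k)) → φ = ψ) :
    Function.Surjective ((Ideal.Quotient.mk J).comp (MvPolynomial.aeval (R := R) f).toRingHom) := by
  let Q := MvPolynomial ι R
  let alg : Algebra Q (P ⧸ J) :=
    ((Ideal.Quotient.mk J).comp (MvPolynomial.aeval (R := R) f).toRingHom).toAlgebra
  let algL : Algebra Q (Localization.Away h) :=
    ((algebraMap P (Localization.Away h)).comp
      (MvPolynomial.aeval (R := R) f).toRingHom).toAlgebra
  have hE : ∀ x : Q, algebraMap Q (P ⧸ J) x = Ideal.Quotient.mk J (MvPolynomial.aeval f x) :=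
    fun x => rfl
  have tow : IsScalarTower R Q (P ⧸ J) := IsScalarTower.of_algebraMap_eq fun r => by
    rw [hE, MvPolynomial.algebraMap_eq, MvPolynomial.aeval_C]; rfl
  have het : Algebra.Etale Q (Localization.Away h) := hh
  have hu : Ideal.Quotient.mk J h = 1 := by
    rw [← map_one (Ideal.Quotient.mk J), Ideal.Quotient.eq]; exact hJ
  -- As h ≡ 1 modulo J, P ⧸ J is a quotient of the localization at h, which is étale over Q; so P ⧸
  -- J is unramified over Q.
  let l : Localization.Away h →+* P ⧸ J :=
    IsLocalization.Away.lift h (g := Ideal.Quotient.mk J) (by rw [hu]; exact isUnit_one)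
  have hl : ∀ x, l (algebraMap P _ x) = Ideal.Quotient.mk J x :=
    IsLocalization.Away.lift_eq h _
  have : Algebra.FormallyUnramified Q (P ⧸ J) :=
    Algebra.FormallyUnramified.of_surjective (A := Localization.Away h)
      { l with commutes' := fun x => hl _ } (fun x => by
        obtain ⟨x, rfl⟩ := Ideal.Quotient.mk_surjective x
        exact ⟨_, hl x⟩)
  refine surjective_algebraMap_of_separates (R := R) (Q := Q) (E := P ⧸ J) fun y _ φ ψ hφψ => ?_
  have hk : ∀ χ : (P ⧸ J) →ₐ[R] AlgebraicClosure y.ResidueField,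
      J ≤ RingHom.ker (χ.comp (Ideal.Quotient.mkₐ R J)) := fun χ x hx => by
    rw [RingHom.mem_ker, AlgHom.comp_apply, Ideal.Quotient.mkₐ_eq_mk,
      Ideal.Quotient.eq_zero_iff_mem.2 hx, map_zero]
  have := hsep y (φ.comp (Ideal.Quotient.mkₐ R J)) (ψ.comp (Ideal.Quotient.mkₐ R J)) (hk φ) (hk ψ)
    (fun k => by
      have := hφψ (MvPolynomial.X k)
      rwa [hE, MvPolynomial.aeval_X] at this)
  ext x
  obtain ⟨x, rfl⟩ := Ideal.Quotient.mk_surjective x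
  exact DFunLike.congr_fun this x

end Coordinates

/-! ### Generic choices over large residue fields -/

section Generic

/-- Elements `b i` whose differences act injectively modulo proper saturated submodules `H k` allow
to avoid translates `B k` of the `H k`. -/
theorem exists_notMem_of_card_lt {R M κ : Type*} [CommRing R] [AddCommGroup M] [Module R M]
    [Fintype κ] {n : ℕ} (hn : Fintype.card κ < n) (b : Fin n → R) (H : κ → Submodule R M)
    (B : κ → Set M) (hH : ∀ k, ∃ m, m ∉ H k)
    (hsat : ∀ k i l m, i ≠ l → (b i - b l) • m ∈ H k → m ∈ H k)
    (hsub : ∀ k m m', m ∈ B k → m' ∈ B k → m - m' ∈ H k)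
    (hadd : ∀ k m m', m ∈ B k → m' ∈ H k → m - m' ∈ B k) : ∃ m, ∀ k, m ∉ B k := by
  classical
  suffices ∀ s : Finset κ, ∃ m, ∀ k ∈ s, m ∉ B k by
    obtain ⟨m, hm⟩ := this Finset.univ
    exact ⟨m, fun k => hm k (Finset.mem_univ k)⟩
  intro s
  induction s using Finset.induction_on with
  | empty => exact ⟨0, fun k hk => absurd hk (Finset.notMem_empty k)⟩
  | insert a s _ ih =>
    obtain ⟨m, hm⟩ := ih
    by_cases ha : m ∈ B a
    -- Move along the line m + b i • m' with m' ∉ H a. If every such point lay in some forbidden B k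
    -- with k in the enlarged set, two would share a k by the pigeonhole principle; then m' ∈ H k
    -- and m ∈ B k, impossible both for k = a and for the earlier k.
    · obtain ⟨m', hm'⟩ := hH a
      by_contra! hcon
      choose k hk hkB using fun i => hcon (m + b i • m')
      obtain ⟨i, l, hil, hkil⟩ := Fintype.exists_ne_map_eq_of_card_lt k (by simpa using hn)
      have h1 : (b i - b l) • m' ∈ H (k i) := by
        have := hsub (k i) _ _ (hkB i) (hkil ▸ hkB l)
        rwa [add_sub_add_left_eq_sub, ← sub_smul] at this
      have h2 := hsat _ _ _ _ hil h1
      have h3 : m ∈ B (k i) := by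
        have := hadd _ _ _ (hkB i) (Submodule.smul_mem _ (b i) h2)
        rwa [add_sub_cancel_right] at this
      rcases Finset.mem_insert.1 (hk i) with h | h
      · rw [h] at h2
        exact hm' h2
      · exact hm _ h h3
    · refine ⟨m, fun k hk => ?_⟩
      rcases Finset.mem_insert.1 hk with rfl | h
      · exact ha
      · exact hm k h

/-- A generic choice of functions congruent to given ones modulo an ideal `I`, with linearly
independent differentials and distinct values at finitely many points. -/
theorem exists_generic_fin {R P K ι Zs Ps : Type*} [CommRing R] [CommRing P] [Algebra R P] [Field K]
    [Algebra R K] [Fintype ι] [Fintype Zs] [Fintype Ps] (κ : Zs → Type*) [∀ z, Field (κ z)]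
    [∀ z, Algebra R (κ z)] (D : ∀ z, P →ₗ[R] (ι → κ z)) (φ ψ : Ps → P →ₐ[R] K) (I : Ideal P)
    (hD : ∀ z, Submodule.span (κ z) (D z '' I) = ⊤) (hφψ : ∀ p, ∃ x ∈ I, φ p x ≠ ψ p x)
    {n : ℕ} (hn : Fintype.card Zs + Fintype.card Ps < n) (b : Fin n → R)
    (hb : ∀ i l, i ≠ l → ∀ z, algebraMap R (κ z) (b i - b l) ≠ 0)
    (hbK : ∀ i l, i ≠ l → algebraMap R K (b i - b l) ≠ 0)
    (r : ℕ) (hr : r ≤ Fintype.card ι) (f₀ : Fin r → P) :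
    ∃ f : Fin r → P, (∀ i, f i - f₀ i ∈ I) ∧ (∀ z, LinearIndependent (κ z) (D z ∘ f)) ∧
      ∀ i p, φ p (f i) ≠ ψ p (f i) := by
  induction r with
  | zero =>
    exact ⟨f₀, fun i => i.elim0, fun z => linearIndependent_empty_type, fun i => i.elim0⟩
  | succ r ih =>
    obtain ⟨f, hfI, hfD, hfp⟩ := ih (Nat.le_of_succ_le hr) (fun i => f₀ i.castSucc)
    -- The span at z of the differentials chosen so far; it is proper because r is still smaller
    -- than the cardinality of ι.
    let S : ∀ z, Submodule (κ z) (ι → κ z) := fun z => Submodule.span (κ z) (Set.range (D z ∘ f))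
    have hS : ∀ z, S z ≠ ⊤ := by
      intro z htop
      have h1 := finrank_span_eq_card (hfD z)
      rw [show Submodule.span (κ z) (Set.range (D z ∘ f)) = ⊤ from htop, finrank_top,
        Module.finrank_fintype_fun_eq_card, Fintype.card_fin] at h1
      omega
    let c := f₀ (Fin.last r)
    -- The next function is c + m with m ∈ I. The sets B are the bad choices of m, for which the new
    -- differential is dependent at a point or the values at a pair coincide; the H are their
    -- directions.
    let H : Zs ⊕ Ps → Submodule R I := Sum.elim
      (fun z => ((S z).restrictScalars R).comap ((D z).comp (I.subtype.restrictScalars R)))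
      (fun p => LinearMap.ker (((φ p).toLinearMap - (ψ p).toLinearMap).comp
        (I.subtype.restrictScalars R)))
    let B : Zs ⊕ Ps → Set I := Sum.elim (fun z => {m | D z (c + m) ∈ S z})
      (fun p => {m | φ p (c + m) = ψ p (c + m)})
    have hHz : ∀ z m, m ∈ H (Sum.inl z) ↔ D z m ∈ S z := fun z m => Iff.rfl
    have hHp : ∀ p m, m ∈ H (Sum.inr p) ↔ φ p m = ψ p m := fun p m => by
      change φ p m - ψ p m = 0 ↔ _
      exact sub_eq_zero
    have hBz : ∀ z m, m ∈ B (Sum.inl z) ↔ D z c + D z m ∈ S z := fun z m => by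
      rw [← map_add]; rfl
    have hBp : ∀ p m, m ∈ B (Sum.inr p) ↔ φ p c + φ p m = ψ p c + ψ p m := fun p m => by
      rw [← map_add, ← map_add]; rfl
    obtain ⟨m, hm⟩ := exists_notMem_of_card_lt (by simpa using hn) b H B
      (by
        rintro (z | p)
        · by_contra! hcon
          refine hS z (top_le_iff.1 ?_)
          rw [← hD z, Submodule.span_le]
          rintro _ ⟨x, hx, rfl⟩
          exact (hHz z ⟨x, hx⟩).1 (hcon _)
        · obtain ⟨x, hx, hne⟩ := hφψ p
          exact ⟨⟨x, hx⟩, fun h => hne ((hHp p _).1 h)⟩)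
      (by
        rintro (z | p) i l m hil h
        · rw [hHz] at h ⊢
          have h1 : D z ((b i - b l) • (m : P)) ∈ S z := h
          rw [map_smul, ← algebraMap_smul (κ z)] at h1
          exact ((S z).smul_mem_iff (hb i l hil z)).1 h1
        · rw [hHp] at h ⊢
          have h1 : φ p ((b i - b l) • (m : P)) = ψ p ((b i - b l) • (m : P)) := h
          rw [map_smul, map_smul, ← algebraMap_smul K, ← algebraMap_smul K (b i - b l) (ψ p m)] at h1
          exact smul_right_injective K (hbK i l hil) h1)
      (by
        rintro (z | p) m m' h h'
        · rw [hBz] at h h'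
          rw [hHz, Submodule.coe_sub, map_sub]
          simpa using (S z).sub_mem h h'
        · rw [hBp] at h h'
          rw [hHp, Submodule.coe_sub, map_sub, map_sub]
          linear_combination h - h')
      (by
        rintro (z | p) m m' h h'
        · rw [hHz] at h'
          rw [hBz] at h ⊢
          rw [Submodule.coe_sub, map_sub, ← add_sub_assoc]
          exact (S z).sub_mem h h'
        · rw [hHp] at h'
          rw [hBp] at h ⊢
          rw [Submodule.coe_sub, map_sub, map_sub]
          linear_combination h - h')
    refine ⟨Fin.snoc f (c + m), ?_, fun z => ?_, ?_⟩
    · intro i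
      refine Fin.lastCases ?_ (fun i => ?_) i
      · simp [c]
      · simpa using hfI i
    · have : D z ∘ (Fin.snoc f (c + m) : Fin (r + 1) → P) = Fin.snoc (D z ∘ f) (D z (c + m)) :=
        Fin.comp_snoc _ _ _
      rw [this, linearIndependent_finSnoc]
      exact ⟨hfD z, hm (Sum.inl z)⟩
    · intro i p
      refine Fin.lastCases ?_ (fun i => ?_) i
      · simpa using mt (hBp p m).2 (hm (Sum.inr p))
      · simpa using hfp i p

/-- An algebra generated by `N` elements as a module has at most `N` homomorphisms to a field. -/
theorem card_algHom_le {R E K : Type*} [CommRing R] [CommRing E] [Algebra R E] [Field K]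
    [Algebra R K] {N : ℕ} (e : Fin N → E) (he : Submodule.span R (Set.range e) = ⊤) :
    Finite (E →ₐ[R] K) ∧ Nat.card (E →ₐ[R] K) ≤ N := by
  -- Dedekind: distinct homomorphisms to a field are linearly independent, and they remain so when
  -- evaluated only on module generators.
  have hli : LinearIndependent K (fun (φ : E →ₐ[R] K) (i : Fin N) => φ (e i)) := by
    have h0 : LinearIndependent K (fun φ : E →ₐ[R] K => (φ.toLinearMap : E →ₗ[R] K)) :=
      linearIndependent_algHom_toLinearMap R E K
    rw [linearIndependent_iff'] at h0 ⊢
    intro s g hg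
    refine h0 s g ?_
    refine LinearMap.ext_on_range he fun i => ?_
    have := congr_fun hg i
    simpa using this
  have := hli.finite
  refine ⟨this, ?_⟩
  have : Fintype (E →ₐ[R] K) := Fintype.ofFinite _
  rw [Nat.card_eq_fintype_card]
  simpa using hli.fintype_card_le_finrank

end Generic

/-! ### Generic coordinates over one closed point of the base -/

section Choice

variable {R P ι : Type*} [CommRing R] [CommRing P] [Algebra R P]

/-- The functions `f` separate the geometric points of `V(J)` over the closed point `y`. -/
def SeparatesAt (J : Ideal P) (y : Ideal R) [y.IsMaximal] (f : ι → P) : Prop :=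
  ∀ φ ψ : P →ₐ[R] AlgebraicClosure y.ResidueField, J ≤ RingHom.ker φ → J ≤ RingHom.ker ψ →
    (∀ k, φ (f k) = ψ (f k)) → φ = ψ

theorem algebraMap_algebraicClosure_eq_zero (y : Ideal R) [y.IsMaximal] {r : R} :
    algebraMap R (AlgebraicClosure y.ResidueField) r = 0 ↔ r ∈ y := by
  rw [IsScalarTower.algebraMap_apply R y.ResidueField, map_eq_zero,
    Ideal.algebraMap_residueField_eq_zero]

theorem algebraMap_residueField_eq_zero_iff {y : Ideal R} {z : Ideal P} [z.IsPrime]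
    (h : y = z.comap (algebraMap R P)) {r : R} :
    algebraMap R z.ResidueField r = 0 ↔ r ∈ y := by
  rw [IsScalarTower.algebraMap_apply R P, Ideal.algebraMap_residueField_eq_zero, h, Ideal.mem_comap]

/-- V(J) is integral over the base, so the residue field at `z` embeds over that of `y` into its
algebraic closure. -/
theorem exists_algHom_of_isMaximal {J : Ideal P} [Module.Finite R (P ⧸ J)] {y : Ideal R}
    [y.IsMaximal] (z : Ideal P) [z.IsMaximal] (hJ : J ≤ z) (h : y = z.comap (algebraMap R P)) :
    ∃ χ : P →ₐ[R] AlgebraicClosure y.ResidueField, J ≤ RingHom.ker χ ∧ RingHom.ker χ = z := by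
  have hcm : (z.map (Ideal.Quotient.mk J)).comap (Ideal.Quotient.mk J) = z := by
    rw [Ideal.comap_map_of_surjective _ Ideal.Quotient.mk_surjective, ← RingHom.ker_eq_comap_bot,
      Ideal.mk_ker, sup_eq_left.2 hJ]
  have : (z.map (Ideal.Quotient.mk J)).IsMaximal := by
    refine (Ideal.map_eq_top_or_isMaximal_of_surjective _ Ideal.Quotient.mk_surjective
      ‹_›).resolve_left fun htop => ?_
    rw [htop, Ideal.comap_top] at hcm
    exact ‹z.IsMaximal›.ne_top hcm.symm
  obtain ⟨χ, hχ⟩ := exists_algHom_ker_eq y (z.map (Ideal.Quotient.mk J)) (by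
    rw [IsScalarTower.algebraMap_eq R P (P ⧸ J), ← Ideal.comap_comap, Ideal.Quotient.algebraMap_eq,
      hcm, h])
  have hk : RingHom.ker (χ.comp (Ideal.Quotient.mkₐ R J)) = z := by
    conv_rhs => rw [← hcm, ← hχ]
    rfl
  exact ⟨χ.comp (Ideal.Quotient.mkₐ R J), by rw [hk]; exact hJ, hk⟩

/-- Finiteness of the set of geometric points of `V(J)` over a closed point. -/
theorem card_geometric_point_le {J : Ideal P} {N : ℕ} (e : Fin N → P ⧸ J)
    (he : Submodule.span R (Set.range e) = ⊤) (y : Ideal R) [y.IsMaximal] :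
    Finite {φ : P →ₐ[R] AlgebraicClosure y.ResidueField // J ≤ RingHom.ker φ} ∧
      Nat.card {φ : P →ₐ[R] AlgebraicClosure y.ResidueField // J ≤ RingHom.ker φ} ≤ N := by
  obtain ⟨h1, h2⟩ := card_algHom_le (K := AlgebraicClosure y.ResidueField) e he
  let l : {φ : P →ₐ[R] AlgebraicClosure y.ResidueField // J ≤ RingHom.ker φ} →
      ((P ⧸ J) →ₐ[R] AlgebraicClosure y.ResidueField) := fun φ =>
    Ideal.Quotient.liftₐ J φ.1 fun x hx => φ.2 hx
  have hl : Function.Injective l := by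
    intro φ ψ h
    ext x
    exact DFunLike.congr_fun h (Ideal.Quotient.mk J x)
  exact ⟨Finite.of_injective l hl, (Nat.card_le_card_of_injective l hl).trans h2⟩

/-- Each closed point is the kernel of a geometric point, so closed points are no more numerous than
geometric ones. -/
theorem card_closed_point_le {J : Ideal P} [Module.Finite R (P ⧸ J)] {N : ℕ} (e : Fin N → P ⧸ J)
    (he : Submodule.span R (Set.range e) = ⊤) (y : Ideal R) [y.IsMaximal] :
    Finite {z : MaximalSpectrum P // J ≤ z.asIdeal ∧ y = z.asIdeal.comap (algebraMap R P)} ∧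
      Nat.card {z : MaximalSpectrum P // J ≤ z.asIdeal ∧ y = z.asIdeal.comap (algebraMap R P)}
        ≤ N := by
  obtain ⟨h1, h2⟩ := card_geometric_point_le e he y
  choose χ hχ hχz using fun z : {z : MaximalSpectrum P //
      J ≤ z.asIdeal ∧ y = z.asIdeal.comap (algebraMap R P)} =>
    exists_algHom_of_isMaximal z.1.asIdeal z.2.1 z.2.2
  let l : {z : MaximalSpectrum P // J ≤ z.asIdeal ∧ y = z.asIdeal.comap (algebraMap R P)} →
    {φ : P →ₐ[R] AlgebraicClosure y.ResidueField // J ≤ RingHom.ker φ} := fun z => ⟨χ z, hχ z⟩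
  have hl : Function.Injective l := by
    intro z z' h
    refine Subtype.ext (MaximalSpectrum.ext ?_)
    rw [← hχz, ← hχz, show χ z = χ z' from congr_arg Subtype.val h]
  exact ⟨Finite.of_injective l hl, (Nat.card_le_card_of_injective l hl).trans h2⟩

variable [Fintype ι]

/-- Over a closed point with sufficiently many elements in its residue field, generic functions
separate geometric points and have linearly independent differentials. -/
theorem exists_generic_at [Nonempty ι] {J I : Ideal P} [Module.Finite R (P ⧸ J)] {N n : ℕ}
    (e : Fin N → P ⧸ J) (he : Submodule.span R (Set.range e) = ⊤) (hn : N + N * N < n)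
    (y : Ideal R) [y.IsMaximal] (b : Fin n → R) (hb : ∀ i l, i ≠ l → b i - b l ∉ y) (f₀ : ι → P)
    (D : ∀ z : MaximalSpectrum P, Derivation R P (ι → z.asIdeal.ResidueField))
    (hD : ∀ z : MaximalSpectrum P, J ≤ z.asIdeal →
      Submodule.span z.asIdeal.ResidueField (D z '' I) = ⊤)
    (hsep : ∀ φ ψ : P →ₐ[R] AlgebraicClosure y.ResidueField, I ≤ RingHom.ker φ →
      I ≤ RingHom.ker ψ → (∀ k, φ (f₀ k) = ψ (f₀ k)) → φ = ψ) :
    ∃ f : ι → P, (∀ k, f k - f₀ k ∈ I) ∧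
      (∀ z : MaximalSpectrum P, J ≤ z.asIdeal → y = z.asIdeal.comap (algebraMap R P) →
        LinearIndependent z.asIdeal.ResidueField (D z ∘ f)) ∧ SeparatesAt J y f := by
  obtain ⟨hΦ, hΦN⟩ := card_geometric_point_le e he y
  obtain ⟨hZ, hZN⟩ := card_closed_point_le e he y
  let Φ := {φ : P →ₐ[R] AlgebraicClosure y.ResidueField // J ≤ RingHom.ker φ}
  let Zs := {z : MaximalSpectrum P // J ≤ z.asIdeal ∧ y = z.asIdeal.comap (algebraMap R P)}
  -- Only pairs distinguished by some element of I can be separated by modifying functions by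
  -- elements of I; the other pairs are treated at the end.
  let Ps := {p : Φ × Φ // ∃ x ∈ I, p.1.1 x ≠ p.2.1 x}
  have : Fintype Zs := Fintype.ofFinite _
  have : Fintype Ps := Fintype.ofFinite _
  -- The origin of the bound: at most N closed points, and at most N * N pairs of geometric points.
  have hcard : Fintype.card Zs + Fintype.card Ps < n := by
    rw [← Nat.card_eq_fintype_card, ← Nat.card_eq_fintype_card]
    refine lt_of_le_of_lt (Nat.add_le_add hZN ?_) hn
    refine (Nat.card_le_card_of_injective _ Subtype.val_injective).trans ?_
    rw [Nat.card_prod]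
    exact Nat.mul_le_mul hΦN hΦN
  let D' : ∀ z : Zs, P →ₗ[R] (ι → z.1.asIdeal.ResidueField) := fun z => (D z.1).toLinearMap
  have hD' : ∀ z : Zs, Submodule.span z.1.asIdeal.ResidueField (D' z '' I) = ⊤ :=
    fun z => hD z.1 z.2.1
  have hb' : ∀ i l, i ≠ l → ∀ z : Zs, algebraMap R z.1.asIdeal.ResidueField (b i - b l) ≠ 0 :=
    fun i l hil z h => hb i l hil ((algebraMap_residueField_eq_zero_iff z.2.2).1 h)
  have hbK : ∀ i l, i ≠ l → algebraMap R (AlgebraicClosure y.ResidueField) (b i - b l) ≠ 0 :=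
    fun i l hil h => hb i l hil ((algebraMap_algebraicClosure_eq_zero y).1 h)
  obtain ⟨f, hfI, hfD, hfp⟩ := exists_generic_fin (fun z : Zs => z.1.asIdeal.ResidueField) D'
    (fun p : Ps => p.1.1.1) (fun p => p.1.2.1) I hD' (fun p => p.2) hcard b hb' hbK
    (Fintype.card ι) le_rfl (f₀ ∘ (Fintype.equivFin ι).symm)
  let ε := Fintype.equivFin ι
  refine ⟨f ∘ ε, fun k => by simpa [ε] using hfI (ε k), fun z hz hy => ?_, ?_⟩
  · exact (hfD ⟨z, hz, hy⟩).comp ε ε.injective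
  · intro φ ψ hφ hψ hf
    by_cases hx : ∃ x ∈ I, φ x ≠ ψ x
    · exact absurd (hf (Classical.arbitrary ι)) (hfp _ ⟨(⟨φ, hφ⟩, ⟨ψ, hψ⟩), hx⟩)
    -- A pair that agrees on I: if φ kills I then both points lie on V(I), where f = f₀ separates;
    -- otherwise some w ∈ I has φ w ≠ 0, and φ (w * x) = ψ (w * x) gives φ x = ψ x.
    · push Not at hx
      by_cases hI : I ≤ RingHom.ker φ
      · refine hsep φ ψ hI (fun x hxI => ?_) fun k => ?_
        · rw [RingHom.mem_ker, ← hx x hxI]; exact hI hxI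
        · have h1 := hx _ (by simpa [ε] using hfI (ε k) : (f ∘ ε) k - f₀ k ∈ I)
          rw [map_sub, map_sub, hf k] at h1
          exact sub_right_injective h1
      · obtain ⟨w, hw, hw0⟩ := Set.not_subset.1 hI
        ext x
        have h1 := hx _ (I.mul_mem_right x hw)
        rw [map_mul, map_mul, ← hx w hw] at h1
        exact mul_left_cancel₀ hw0 h1

end Choice

/-! ### Coordinates over a closed point with finite residue field -/

section FiniteField

/-- A choice of functions congruent to given ones modulo `I'` with linearly independent
differentials at finitely many points, if the differentials of `I'` span at each point
independently of the others. -/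
theorem exists_local_fin {P ι Zs : Type*} [CommRing P] [Fintype ι] [Fintype Zs]
    (κ : Zs → Type*) [∀ z, Field (κ z)] (D : ∀ z, P →+ (ι → κ z)) (I' : Ideal P)
    (hloc : ∀ z (S : Submodule (κ z) (ι → κ z)), S ≠ ⊤ →
      ∃ x ∈ I', D z x ∉ S ∧ ∀ z', z' ≠ z → D z' x = 0)
    (r : ℕ) (hr : r ≤ Fintype.card ι) (f₀ : Fin r → P) :
    ∃ f : Fin r → P, (∀ i, f i - f₀ i ∈ I') ∧ ∀ z, LinearIndependent (κ z) (D z ∘ f) := by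
  classical
  induction r with
  | zero =>
    exact ⟨f₀, fun i => i.elim0, fun z => linearIndependent_empty_type⟩
  | succ r ih =>
    obtain ⟨f, hfI, hfD⟩ := ih (Nat.le_of_succ_le hr) (fun i => f₀ i.castSucc)
    let S : ∀ z, Submodule (κ z) (ι → κ z) := fun z => Submodule.span (κ z) (Set.range (D z ∘ f))
    have hS : ∀ z, S z ≠ ⊤ := by
      intro z htop
      have h1 := finrank_span_eq_card (hfD z)
      rw [show Submodule.span (κ z) (Set.range (D z ∘ f)) = ⊤ from htop, finrank_top,
        Module.finrank_fintype_fun_eq_card, Fintype.card_fin] at h1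
      omega
    let c := f₀ (Fin.last r)
    choose x hxI hxS hx0 using fun z => hloc z (S z) (hS z)
    -- At each point where the differential of c is dependent on the earlier ones, add an element
    -- whose differential is not, and which has zero differential at all other points.
    let m : P := ∑ z, if D z c ∈ S z then x z else 0
    have hm : m ∈ I' := I'.sum_mem fun z _ => by split_ifs <;> simp [hxI]
    have hDm : ∀ z, D z m = if D z c ∈ S z then D z (x z) else 0 := by
      intro z
      rw [map_sum, Finset.sum_eq_single z]
      · split_ifs <;> simp
      · intro z' _ hz'
        split_ifs
        · exact hx0 z' z hz'.symm
        · exact map_zero _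
      · simp
    have hcm : ∀ z, D z (c + m) ∉ S z := by
      intro z h
      rw [map_add, hDm] at h
      split_ifs at h with hc
      · exact hxS z (((S z).add_mem_iff_right hc).1 h)
      · exact hc (by simpa using h)
    refine ⟨Fin.snoc f (c + m), ?_, fun z => ?_⟩
    · intro i
      refine Fin.lastCases ?_ (fun i => ?_) i
      · simpa [c] using hm
      · simpa using hfI i
    · have : D z ∘ (Fin.snoc f (c + m) : Fin (r + 1) → P) = Fin.snoc (D z ∘ f) (D z (c + m)) :=
        Fin.comp_snoc _ _ _
      rw [this, linearIndependent_finSnoc]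
      exact ⟨hfD z, hcm z⟩

variable {R P ι : Type*} [CommRing R] [CommRing P] [Algebra R P]

/-- The kernel is a prime of the integral R-algebra P ⧸ J lying over the maximal ideal `y`, so it is
maximal. -/
theorem comap_ker_geometric_point {J : Ideal P} [Module.Finite R (P ⧸ J)] {y : Ideal R}
    [y.IsMaximal] (φ : P →ₐ[R] AlgebraicClosure y.ResidueField) (hφ : J ≤ RingHom.ker φ) :
    (RingHom.ker φ).IsMaximal ∧ y = (RingHom.ker φ).comap (algebraMap R P) := by
  have hy : y = (RingHom.ker φ).comap (algebraMap R P) := by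
    ext r
    rw [Ideal.mem_comap, RingHom.mem_ker, AlgHom.commutes, algebraMap_algebraicClosure_eq_zero]
  refine ⟨?_, hy⟩
  let φ' : P ⧸ J →ₐ[R] AlgebraicClosure y.ResidueField := Ideal.Quotient.liftₐ J φ fun x hx => hφ hx
  have hcomap : (RingHom.ker φ').comap (Ideal.Quotient.mk J) = RingHom.ker φ := rfl
  have hy' : y = (RingHom.ker φ').comap (algebraMap R (P ⧸ J)) := by
    refine hy.trans ?_
    rw [← hcomap, Ideal.comap_comap]; rfl
  have hp : (RingHom.ker φ').IsPrime := RingHom.ker_isPrime φ'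
  have : (RingHom.ker φ').IsMaximal := by
    have : ((RingHom.ker φ').comap (algebraMap R (P ⧸ J))).IsMaximal := by rwa [← hy']
    exact Ideal.isMaximal_of_isIntegral_of_isMaximal_comap _ this
  rw [← hcomap]
  exact Ideal.comap_isMaximal_of_surjective _ Ideal.Quotient.mk_surjective

/-- At a point with finite residue field, an ideal has elements vanishing at finitely many points
with prescribed differentials. -/
theorem exists_mem_derivation {Zs : Type*} [Finite Zs] (Z : Zs → Ideal P)
    (hZ : ∀ z, (Z z).IsMaximal) (hinj : Function.Injective Z) (I : Ideal P) {W : Zs → Type*}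
    [∀ z, AddCommGroup (W z)] [∀ z, Module P (W z)] [∀ z, Module R (W z)]
    (D : ∀ z, Derivation R P (W z)) (hD : ∀ z, ∀ r ∈ Z z, ∀ w : W z, r • w = 0)
    (z : Zs) (hfin : Finite (P ⧸ Z z)) (x : P) (hx : x ∈ I) :
    ∃ x' ∈ I ⊓ ⨅ z, Z z, D z x' = D z x ∧ ∀ z', z' ≠ z → D z' x' = 0 := by
  classical
  have hcop : Pairwise (Function.onFun IsCoprime fun z => Z z ^ 2) := by
    intro a b hab
    have : IsCoprime (Z a) (Z b) := by
      rw [Ideal.isCoprime_iff_sup_eq]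
      exact (hZ a).coprime_of_ne (hZ b) fun h => hab (hinj h)
    exact this.pow
  -- Modulo squares of maximal ideals, so that multiplying by e does not disturb differentials at z
  -- and kills both value and differential elsewhere.
  obtain ⟨e, he⟩ := Ideal.exists_forall_sub_mem_ideal hcop fun z' => if z' = z then 1 else 0
  have he1 : e - 1 ∈ Z z ^ 2 := by simpa using he z
  have he0 : ∀ z', z' ≠ z → e ∈ Z z' ^ 2 := fun z' hz' => by simpa [hz'] using he z'
  -- By Fermat, x − x ^ q vanishes at z; since q = 0 in the residue field, it has the same
  -- differential there as x.
  let q := Nat.card (P ⧸ Z z)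
  have : Fintype (P ⧸ Z z) := Fintype.ofFinite _
  have hq : ((q : ℕ) : P) ∈ Z z := by
    rw [← Ideal.Quotient.eq_zero_iff_mem, map_natCast]
    simp [q]
  have hq0 : q ≠ 0 := Nat.card_pos.ne'
  have hxq : x - x ^ q ∈ Z z := by
    let _ : Field (P ⧸ Z z) := Ideal.Quotient.field (Z z)
    rw [← Ideal.Quotient.eq_zero_iff_mem, map_sub, map_pow, sub_eq_zero]
    simp only [q, Nat.card_eq_fintype_card]
    exact (FiniteField.pow_card _).symm
  have hxI : x - x ^ q ∈ I := I.sub_mem hx (I.pow_mem_of_mem hx q (Nat.pos_of_ne_zero hq0))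
  have hDx : D z (x - x ^ q) = D z x := by
    rw [map_sub, Derivation.leibniz_pow, ← Nat.cast_smul_eq_nsmul P, hD z _ hq, sub_zero]
  have hDsq : ∀ z' (r : P), r ∈ Z z' ^ 2 → D z' r = 0 := by
    intro z' r hr
    rw [pow_two] at hr
    induction hr using Submodule.mul_induction_on' with
    | mem_mul_mem a ha b hb =>
      rw [Derivation.leibniz, hD _ _ ha, hD _ _ hb, add_zero]
    | add a _ b _ ha hb => rw [map_add, ha, hb, add_zero]
  refine ⟨e * (x - x ^ q), ⟨I.mul_mem_left _ hxI, ?_⟩, ?_, fun z' hz' => ?_⟩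
  · rw [SetLike.mem_coe, Ideal.mem_iInf]
    intro z'
    by_cases h : z' = z
    · subst h
      exact Ideal.mul_mem_left _ _ hxq
    · exact Ideal.mul_mem_right _ _ (Ideal.pow_le_self two_ne_zero (he0 z' h))
  · rw [Derivation.leibniz, hD z _ hxq, add_zero, hDx]
    have h1 : e • D z x = (e - 1) • D z x + D z x := by rw [sub_smul, one_smul, sub_add_cancel]
    rw [h1, hD z _ (Ideal.pow_le_self two_ne_zero he1), zero_add]
  · rw [Derivation.leibniz, hDsq z' e (he0 z' hz'), smul_zero, add_zero,
      hD z' _ (Ideal.pow_le_self two_ne_zero (he0 z' hz'))]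

theorem finite_quotient_of_comap_eq {J : Ideal P} [Module.Finite R (P ⧸ J)] {y : Ideal R}
    (hy : Finite (R ⧸ y)) {z : Ideal P} (hJ : J ≤ z) (h : y = z.comap (algebraMap R P)) :
    Finite (P ⧸ z) := by
  have h1 : Module.Finite R (P ⧸ z) :=
    Module.Finite.of_surjective (Ideal.Quotient.factorₐ R hJ).toLinearMap
      (Ideal.Quotient.factor_surjective hJ)
  let alg : Algebra (R ⧸ y) (P ⧸ z) := (Ideal.quotientMap z (algebraMap R P) h.le).toAlgebra
  have : IsScalarTower R (R ⧸ y) (P ⧸ z) := IsScalarTower.of_algebraMap_eq fun r => rfl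
  have : Module.Finite (R ⧸ y) (P ⧸ z) := Module.Finite.of_restrictScalars_finite R _ _
  exact Module.finite_of_finite (R ⧸ y)

variable [Fintype ι]

/-- Over a closed point with finite residue field, functions that separate geometric points and have
linearly independent differentials can be found as soon as some function separates them. -/
theorem exists_finite_at {J I : Ideal P} [Module.Finite R (P ⧸ J)] (y : Ideal R) [y.IsMaximal]
    (hy : Finite (R ⧸ y)) (s : ι → R) (k₀ : ι)
    (D : ∀ z : MaximalSpectrum P, Derivation R P (ι → z.asIdeal.ResidueField))
    (hD : ∀ z : MaximalSpectrum P, J ≤ z.asIdeal →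
      Submodule.span z.asIdeal.ResidueField (D z '' I) = ⊤)
    (t : P) (ht : t ∈ I)
    (hsep : ∀ φ ψ : P →ₐ[R] AlgebraicClosure y.ResidueField, J ≤ RingHom.ker φ →
      J ≤ RingHom.ker ψ → φ t = ψ t → φ = ψ) :
    ∃ f : ι → P, (∀ k, f k - algebraMap R P (s k) ∈ I) ∧
      (∀ z : MaximalSpectrum P, J ≤ z.asIdeal → y = z.asIdeal.comap (algebraMap R P) →
        LinearIndependent z.asIdeal.ResidueField (D z ∘ f)) ∧ SeparatesAt J y f := by
  classical
  obtain ⟨N, e, he⟩ := Module.Finite.exists_fin (R := R) (M := P ⧸ J)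
  obtain ⟨hZ, -⟩ := card_closed_point_le e he y
  let Zs := {z : MaximalSpectrum P // J ≤ z.asIdeal ∧ y = z.asIdeal.comap (algebraMap R P)}
  have : Fintype Zs := Fintype.ofFinite _
  let D' : ∀ z : Zs, P →+ (ι → z.1.asIdeal.ResidueField) := fun z => (D z.1).toLinearMap.toAddMonoidHom
  let Z : Zs → Ideal P := fun z => z.1.asIdeal
  have hinj : Function.Injective Z := fun a b h => Subtype.ext (MaximalSpectrum.ext h)
  -- The corrections are taken in I and in all the maximal ideals at hand, so they alter
  -- differentials but no values at geometric points. Thus the function of index k₀ keeps the values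
  -- of s k₀ + t, which separate them.
  obtain ⟨f, hf, hfD⟩ := exists_local_fin (fun z : Zs => z.1.asIdeal.ResidueField) D' (I ⊓ ⨅ z, Z z)
    (by
      intro z S hS
      obtain ⟨x, hxI, hxS⟩ : ∃ x ∈ I, D z.1 x ∉ S := by
        by_contra! hcon
        refine hS (top_le_iff.1 ?_)
        rw [← hD z.1 z.2.1, Submodule.span_le]
        rintro _ ⟨x, hx, rfl⟩
        exact hcon x hx
      obtain ⟨x', hx', hxz, hxz'⟩ := exists_mem_derivation Z (fun z => z.1.isMaximal) hinj I
        (fun z : Zs => D z.1) (fun z r hr w => by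
          ext k
          rw [Pi.smul_apply, Algebra.smul_def, Ideal.algebraMap_residueField_eq_zero.2 hr, zero_mul]
          rfl) z (finite_quotient_of_comap_eq hy z.2.1 z.2.2) x hxI
      exact ⟨x', hx', by rwa [show D' z x' = D z.1 x from hxz], hxz'⟩)
    (Fintype.card ι) le_rfl
    (fun k => algebraMap R P (s ((Fintype.equivFin ι).symm k)) +
      if (Fintype.equivFin ι).symm k = k₀ then t else 0)
  let ε := Fintype.equivFin ι
  have hf' : ∀ k, f (ε k) - (algebraMap R P (s k) + if k = k₀ then t else 0) ∈ I ⊓ ⨅ z, Z z :=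
    fun k => by simpa [ε] using hf (ε k)
  refine ⟨f ∘ ε, fun k => ?_, fun z hz hzy => (hfD ⟨z, hz, hzy⟩).comp ε ε.injective, ?_⟩
  · have h1 := (hf' k).1
    have h2 : (if k = k₀ then t else 0) ∈ I := by split_ifs <;> simp [ht]
    have := I.add_mem h1 h2
    rwa [sub_add_eq_sub_sub, sub_add_cancel] at this
  · have hval : ∀ φ : P →ₐ[R] AlgebraicClosure y.ResidueField, J ≤ RingHom.ker φ →
        φ (f (ε k₀)) = algebraMap R _ (s k₀) + φ t := by
      intro φ hφ
      obtain ⟨hm, hm'⟩ := comap_ker_geometric_point φ hφ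
      have h1 : f (ε k₀) - (algebraMap R P (s k₀) + t) ∈ RingHom.ker φ := by
        have := (Ideal.mem_iInf.1 (hf' k₀).2) ⟨⟨_, hm⟩, hφ, hm'⟩
        rwa [if_pos rfl] at this
      rw [RingHom.mem_ker, map_sub, sub_eq_zero] at h1
      rw [h1, map_add, AlgHom.commutes]
    intro φ ψ hφ hψ h
    refine hsep φ ψ hφ hψ ?_
    have := h k₀
    rw [Function.comp_apply, hval φ hφ, hval ψ hψ] at this
    exact add_left_cancel this

end FiniteField

/-! ### Gluing coordinates over a semilocal base -/

section Glue

variable {R P ι : Type u} [CommRing R] [CommRing P] [Algebra R P] [Fintype ι]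

/-- Coordinates embedding `V(J)`, étale around `V(J)` and with prescribed values on `V(I)`, exist
if suitable functions exist over each closed point of the semilocal base. -/
theorem exists_etale_coordinates [Finite (MaximalSpectrum R)] [Algebra.FinitePresentation R P]
    (hsm : RingHom.Locally
      (fun f => RingHom.IsStandardSmoothOfRelativeDimension (Fintype.card ι) f) (algebraMap R P))
    (J I : Ideal P) [Module.Finite R (P ⧸ J)] (f₀ : ι → P)
    (H : ∀ (y : Ideal R) [y.IsMaximal]
      (D : ∀ z : MaximalSpectrum P, Derivation R P (ι → z.asIdeal.ResidueField)),
      (∀ z, Submodule.span z.asIdeal.ResidueField (Set.range (D z)) = ⊤) →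
      ∃ f : ι → P, (∀ k, f k - f₀ k ∈ I) ∧
        (∀ z : MaximalSpectrum P, J ≤ z.asIdeal → y = z.asIdeal.comap (algebraMap R P) →
          LinearIndependent z.asIdeal.ResidueField (D z ∘ f)) ∧ SeparatesAt J y f) :
    ∃ f : ι → P, (∀ k, f k - f₀ k ∈ I) ∧
      (∃ h : P, h - 1 ∈ J ∧ ((algebraMap P (Localization.Away h)).comp
        (MvPolynomial.aeval (R := R) f).toRingHom).Etale) ∧
      Function.Surjective
        ((Ideal.Quotient.mk J).comp (MvPolynomial.aeval (R := R) f).toRingHom) := by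
  classical
  have : Fintype (MaximalSpectrum R) := Fintype.ofFinite _
  choose D hDs hDe using fun z : MaximalSpectrum P => exists_frame_derivation hsm z.asIdeal
  choose g hgI hgD hgs using fun y : MaximalSpectrum R => H y.asIdeal D hDs
  have hcop : Pairwise (Function.onFun IsCoprime fun y : MaximalSpectrum R => y.asIdeal) := by
    intro a b hab
    rw [Function.onFun, Ideal.isCoprime_iff_sup_eq]
    exact a.isMaximal.coprime_of_ne b.isMaximal fun h => hab (MaximalSpectrum.ext h)
  -- Elements of R that are 1 at one closed point and 0 at the others: f then agrees with g y modulo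
  -- y, and still with f₀ modulo I.
  choose ε hε using fun y : MaximalSpectrum R =>
    Ideal.exists_forall_sub_mem_ideal hcop fun y' => if y' = y then 1 else 0
  have hε1 : ∀ y : MaximalSpectrum R, ε y - 1 ∈ y.asIdeal := fun y => by simpa using hε y y
  have hε0 : ∀ y y' : MaximalSpectrum R, y' ≠ y → ε y' ∈ y.asIdeal := fun y y' h => by
    simpa [h.symm] using hε y' y
  let f : ι → P := fun k => f₀ k + ∑ y, ε y • (g y k - f₀ k)
  -- The form in which f ≡ g y is used: any R-linear map to a module killed by y, such as a
  -- differential or a geometric point over y, cannot tell f from g y.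
  have key : ∀ (y : MaximalSpectrum R) {V : Type u} [AddCommGroup V] [Module R V] (ℓ : P →ₗ[R] V),
      (∀ r ∈ y.asIdeal, ∀ v : V, r • v = 0) → ∀ k, ℓ (f k) = ℓ (g y k) := by
    intro y V _ _ ℓ hV k
    have h1 : ε y • (ℓ (g y k) - ℓ (f₀ k)) = ℓ (g y k) - ℓ (f₀ k) := by
      have := hV _ (hε1 y) (ℓ (g y k) - ℓ (f₀ k))
      rwa [sub_smul, one_smul, sub_eq_zero] at this
    simp only [f, map_add, map_sum, map_smul, map_sub]
    rw [Finset.sum_eq_single y, h1, add_sub_cancel]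
    · intro y' _ hy'
      exact hV _ (hε0 y y' hy') _
    · simp
  have hfI : ∀ k, f k - f₀ k ∈ I := fun k => by
    simp only [f, add_sub_cancel_left]
    refine I.sum_mem fun y _ => ?_
    rw [Algebra.smul_def]
    exact I.mul_mem_left _ (hgI y k)
  have hint : Algebra.IsIntegral R (P ⧸ J) := inferInstance
  have het : ∀ (z : Ideal P) [z.IsMaximal], J ≤ z →
      ((algebraMap P (Localization.AtPrime z)).comp
        (MvPolynomial.aeval (R := R) f).toRingHom).FormallyEtale := by
    intro z hz hJ
    have hmax : (z.comap (algebraMap R P)).IsMaximal := by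
      have hcm : (z.map (Ideal.Quotient.mk J)).comap (Ideal.Quotient.mk J) = z := by
        rw [Ideal.comap_map_of_surjective _ Ideal.Quotient.mk_surjective,
          ← RingHom.ker_eq_comap_bot, Ideal.mk_ker, sup_eq_left.2 hJ]
      have : (z.map (Ideal.Quotient.mk J)).IsMaximal := by
        refine (Ideal.map_eq_top_or_isMaximal_of_surjective _ Ideal.Quotient.mk_surjective
          ‹_›).resolve_left fun htop => ?_
        rw [htop, Ideal.comap_top] at hcm
        exact hz.ne_top hcm.symm
      rw [← hcm, Ideal.comap_comap]
      exact Ideal.isMaximal_comap_of_isIntegral_of_isMaximal (R := R)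
        (z.map (Ideal.Quotient.mk J))
    refine hDe ⟨z, hz⟩ f ?_
    have h1 := hgD ⟨_, hmax⟩ ⟨z, hz⟩ hJ rfl
    have h2 : (fun i => D ⟨z, hz⟩ (f i)) = D ⟨z, hz⟩ ∘ g ⟨_, hmax⟩ := by
      funext i
      refine key ⟨_, hmax⟩ (D ⟨z, hz⟩).toLinearMap (fun r hr v => ?_) i
      ext k
      rw [Pi.smul_apply, Algebra.smul_def, (algebraMap_residueField_eq_zero_iff rfl).2 hr, zero_mul]
      rfl
    rw [h2]
    exact h1
  obtain ⟨h, hhJ, hh⟩ := exists_etale_away J f het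
  refine ⟨f, hfI, ⟨h, hhJ, hh⟩, surjective_mk_comp_aeval J f h hhJ hh ?_⟩
  intro y hy φ ψ hφ hψ hφψ
  refine hgs ⟨y, hy⟩ φ ψ hφ hψ fun k => ?_
  have hK : ∀ r ∈ y, ∀ v : AlgebraicClosure y.ResidueField, r • v = 0 := fun r hr v => by
    rw [Algebra.smul_def, (algebraMap_algebraicClosure_eq_zero y).2 hr, zero_mul]
  have h1 := key ⟨y, hy⟩ φ.toLinearMap hK k
  have h2 := key ⟨y, hy⟩ ψ.toLinearMap hK k
  exact h1.symm.trans ((hφψ k).trans h2)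

end Glue

/-! ### The ideal of a disjoint union of sections -/

section Sections

variable {R P ι : Type*} [CommRing R] [CommRing P] [Algebra R P]

/-- The differentials at a closed point of the ideal of a disjoint union of sections span. -/
theorem span_derivation_iInf_ker {m : ℕ} (σ : Fin m → P →ₐ[R] R)
    (hσ : Pairwise fun k l => IsCoprime (RingHom.ker (σ k)) (RingHom.ker (σ l))) (z : Ideal P)
    [z.IsMaximal] (D : Derivation R P (ι → z.ResidueField))
    (hD : Submodule.span z.ResidueField (Set.range D) = ⊤) :
    Submodule.span z.ResidueField (D '' (⨅ k, RingHom.ker (σ k) : Ideal P)) = ⊤ := by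
  classical
  let I : Ideal P := ⨅ k, RingHom.ker (σ k)
  have hz : ∀ r ∈ z, ∀ w : ι → z.ResidueField, r • w = 0 := fun r hr w => by
    ext k
    rw [Pi.smul_apply, Algebra.smul_def, Ideal.algebraMap_residueField_eq_zero.2 hr, zero_mul]
    rfl
  have hone : ∀ r, r - 1 ∈ z → ∀ w : ι → z.ResidueField, r • w = w := fun r hr w => by
    have := hz _ hr w
    rwa [sub_smul, one_smul, sub_eq_zero] at this
  have hunit : ∀ K : Ideal P, ¬ K ≤ z → ∃ w ∈ K, w - 1 ∈ z := by
    intro K hK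
    obtain ⟨u, huK, huz⟩ := Set.not_subset.1 hK
    obtain ⟨v, hv⟩ := Ideal.IsMaximal.exists_inv ‹z.IsMaximal› huz
    obtain ⟨c, hc, hvc⟩ := hv
    exact ⟨v * u, K.mul_mem_left _ huK, by rw [← hvc, sub_add_cancel_left]; exact z.neg_mem hc⟩
  rw [← top_le_iff, ← hD, Submodule.span_le]
  rintro _ ⟨x, rfl⟩
  by_cases hI : I ≤ z
  -- At a point of V(I) exactly one section passes. With w ≡ 1 at z vanishing on the other sections,
  -- w * (x − σ k x) lies in I and has the differential of x, because constants from R have none.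
  · obtain ⟨k, -, hk⟩ := (Ideal.IsPrime.inf_le' (s := Finset.univ) (f := fun k => RingHom.ker (σ k))
      (Ideal.IsMaximal.isPrime ‹z.IsMaximal›)).1 (by rwa [Finset.inf_univ_eq_iInf])
    have hnot : ¬ ((Finset.univ.erase k).inf fun l => RingHom.ker (σ l)) ≤ z := by
      intro hle
      obtain ⟨l, hl, hlz⟩ := (Ideal.IsPrime.inf_le' (Ideal.IsMaximal.isPrime ‹z.IsMaximal›)).1 hle
      have h1 : IsCoprime (RingHom.ker (σ l)) (RingHom.ker (σ k)) := hσ (Finset.ne_of_mem_erase hl)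
      rw [Ideal.isCoprime_iff_sup_eq] at h1
      exact Ideal.IsMaximal.ne_top ‹_› (top_le_iff.1 (h1 ▸ sup_le hlz hk))
    obtain ⟨w, hw, hwz⟩ := hunit _ hnot
    let x₀ := x - algebraMap R P (σ k x)
    have hx₀ : x₀ ∈ RingHom.ker (σ k) := by
      rw [RingHom.mem_ker, map_sub, AlgHom.commutes]
      exact sub_self _
    have hmem : w * x₀ ∈ I := by
      refine Ideal.mem_iInf.2 fun l => ?_
      by_cases hlk : l = k
      · rw [hlk]
        exact Ideal.mul_mem_left _ _ hx₀
      · refine Ideal.mul_mem_right _ _ ?_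
        have := Finset.inf_le (f := fun l => RingHom.ker (σ l))
          (Finset.mem_erase.2 ⟨hlk, Finset.mem_univ l⟩)
        exact this hw
    refine Submodule.subset_span ⟨w * x₀, hmem, ?_⟩
    rw [Derivation.leibniz, hone w hwz, hz x₀ (hk hx₀), add_zero, map_sub, Derivation.map_algebraMap,
      sub_zero]
  -- Off V(I), some w ∈ I is 1 at z, and the Leibniz rule writes D x through D (w * x) and D w, both
  -- differentials of elements of I.
  · obtain ⟨w, hw, hwz⟩ := hunit _ hI
    have h1 : D x = D (w * x) - algebraMap P z.ResidueField x • D w := by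
      rw [Derivation.leibniz, hone w hwz, algebraMap_smul, add_sub_cancel_right]
    rw [SetLike.mem_coe, h1]
    exact Submodule.sub_mem _ (Submodule.subset_span ⟨_, I.mul_mem_right _ hw, rfl⟩)
      (Submodule.smul_mem _ _ (Submodule.subset_span ⟨_, hw, rfl⟩))

/-- The values on a disjoint union of sections separate its points if they are disjoint sections of
affine space. -/
theorem eq_of_iInf_ker_le {K : Type*} [Field K] [Algebra R K] {m : ℕ} (σ : Fin m → P →ₐ[R] R)
    (f₀ : ι → P) (hv : ∀ k l, k ≠ l → Ideal.span (Set.range fun i => σ k (f₀ i) - σ l (f₀ i)) = ⊤)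
    (φ ψ : P →ₐ[R] K) (hφ : (⨅ k, RingHom.ker (σ k) : Ideal P) ≤ RingHom.ker φ)
    (hψ : (⨅ k, RingHom.ker (σ k) : Ideal P) ≤ RingHom.ker ψ) (h : ∀ i, φ (f₀ i) = ψ (f₀ i)) :
    φ = ψ := by
  -- A field-valued point of a finite union of sections lies on one of them, hence is evaluation
  -- along it.
  have key : ∀ χ : P →ₐ[R] K, (⨅ k, RingHom.ker (σ k) : Ideal P) ≤ RingHom.ker χ →
      ∃ k, ∀ x, χ x = algebraMap R K (σ k x) := by
    intro χ hχ
    have : (RingHom.ker χ).IsPrime := RingHom.ker_isPrime χ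
    obtain ⟨k, -, hk⟩ := (Ideal.IsPrime.inf_le' (s := Finset.univ) (f := fun k => RingHom.ker (σ k))
      this).1 (by rwa [Finset.inf_univ_eq_iInf])
    refine ⟨k, fun x => ?_⟩
    have h1 : x - algebraMap R P (σ k x) ∈ RingHom.ker (σ k) := by
      rw [RingHom.mem_ker, map_sub, AlgHom.commutes]
      exact sub_self _
    have h2 := hk h1
    rwa [RingHom.mem_ker, map_sub, AlgHom.commutes, sub_eq_zero] at h2
  obtain ⟨k, hk⟩ := key φ hφ
  obtain ⟨l, hl⟩ := key ψ hψ
  have hkl : k = l := by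
    by_contra hne
    -- On two different sections all coordinate differences would vanish in K, although they
    -- generate the unit ideal.
    have h1 : Ideal.span (Set.range fun i => σ k (f₀ i) - σ l (f₀ i)) ≤
        RingHom.ker (algebraMap R K) := by
      rw [Ideal.span_le]
      rintro _ ⟨i, rfl⟩
      rw [SetLike.mem_coe, RingHom.mem_ker, map_sub, ← hk, ← hl, h, sub_self]
    rw [hv k l hne, top_le_iff] at h1
    exact RingHom.ker_ne_top _ h1
  ext x
  rw [hk, hl, hkl]

end Sections

/-! ### Existence of coordinates in the two cases -/

section Existence

variable {R P ι : Type u} [CommRing R] [CommRing P] [Algebra R P] [Fintype ι] [Nonempty ι]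
  [Finite (MaximalSpectrum R)] [Algebra.FinitePresentation R P]
  (J : Ideal P) [Module.Finite R (P ⧸ J)]

/-- Étale coordinates with prescribed values on disjoint sections, over a base with large residue
fields. -/
theorem exists_etale_coordinates_of_large
    (hsm : RingHom.Locally
      (fun f => RingHom.IsStandardSmoothOfRelativeDimension (Fintype.card ι) f) (algebraMap R P))
    {N n : ℕ} (e : Fin N → P ⧸ J) (he : Submodule.span R (Set.range e) = ⊤) (hn : N + N * N < n)
    (b : Fin n → R) (hb : ∀ i l, i ≠ l → IsUnit (b i - b l)) {m : ℕ} (σ : Fin m → P →ₐ[R] R)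
    (hσ : Pairwise fun k l => IsCoprime (RingHom.ker (σ k)) (RingHom.ker (σ l)))
    (v : Fin m → ι → R) (hv : ∀ k l, k ≠ l → Ideal.span (Set.range (v k - v l)) = ⊤) :
    ∃ f : ι → P, (∀ k i, σ k (f i) = v k i) ∧
      (∃ h : P, h - 1 ∈ J ∧ ((algebraMap P (Localization.Away h)).comp
        (MvPolynomial.aeval (R := R) f).toRingHom).Etale) ∧
      Function.Surjective
        ((Ideal.Quotient.mk J).comp (MvPolynomial.aeval (R := R) f).toRingHom) := by
  -- Disjoint sections have coprime kernels, so initial functions with the prescribed values exist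
  -- by the Chinese remainder theorem.
  choose f₀ hf₀ using fun i => Ideal.exists_forall_sub_mem_ideal hσ fun k => algebraMap R P (v k i)
  have hf₀' : ∀ k i, σ k (f₀ i) = v k i := fun k i => by
    have := hf₀ i k
    rw [RingHom.mem_ker, map_sub, AlgHom.commutes, sub_eq_zero] at this
    exact this
  obtain ⟨f, hf, hfe, hfs⟩ := exists_etale_coordinates hsm J (⨅ k, RingHom.ker (σ k)) f₀
    fun y _ D hD => exists_generic_at e he hn y b
      (fun i l hil hmem => Ideal.IsMaximal.ne_top ‹_› (Ideal.eq_top_of_isUnit_mem _ hmem (hb i l hil)))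
      f₀ D (fun z _ => span_derivation_iInf_ker σ hσ z.asIdeal (D z) (hD z))
      (fun φ ψ hφ hψ h => eq_of_iInf_ker_le σ f₀ (fun k l hkl => by
        simp only [hf₀']; exact hv k l hkl) φ ψ hφ hψ h)
  refine ⟨f, fun k i => ?_, hfe, hfs⟩
  have := Ideal.mem_iInf.1 (hf i) k
  rw [RingHom.mem_ker, map_sub, sub_eq_zero] at this
  rw [this, hf₀']

/-- Étale coordinates with prescribed values on a section, if the geometric points of `V(J)` over
closed points with finite residue field are separated by a function that vanishes on the section. -/
theorem exists_etale_coordinates_of_separating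
    (hsm : RingHom.Locally
      (fun f => RingHom.IsStandardSmoothOfRelativeDimension (Fintype.card ι) f) (algebraMap R P))
    (σ : P →ₐ[R] R) (v : ι → R)
    (hsep : ∀ (y : Ideal R) [y.IsMaximal], Finite (R ⧸ y) → ∃ t ∈ RingHom.ker σ,
      ∀ φ ψ : P →ₐ[R] AlgebraicClosure y.ResidueField, J ≤ RingHom.ker φ →
        J ≤ RingHom.ker ψ → φ t = ψ t → φ = ψ) :
    ∃ f : ι → P, (∀ i, σ (f i) = v i) ∧
      (∃ h : P, h - 1 ∈ J ∧ ((algebraMap P (Localization.Away h)).comp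
        (MvPolynomial.aeval (R := R) f).toRingHom).Etale) ∧
      Function.Surjective
        ((Ideal.Quotient.mk J).comp (MvPolynomial.aeval (R := R) f).toRingHom) := by
  let σ' : Fin 1 → P →ₐ[R] R := fun _ => σ
  have hσ' : Pairwise fun k l => IsCoprime (RingHom.ker (σ' k)) (RingHom.ker (σ' l)) :=
    fun k l hkl => absurd (Subsingleton.elim k l) hkl
  have hI : (⨅ k, RingHom.ker (σ' k) : Ideal P) = RingHom.ker σ :=
    le_antisymm (iInf_le _ 0) (le_iInf fun _ => le_rfl)
  have hspan : ∀ (z : MaximalSpectrum P) (D : Derivation R P (ι → z.asIdeal.ResidueField)),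
      Submodule.span z.asIdeal.ResidueField (Set.range D) = ⊤ →
      Submodule.span z.asIdeal.ResidueField (D '' (RingHom.ker σ : Ideal P)) = ⊤ := by
    intro z D hD
    rw [← hI]
    exact span_derivation_iInf_ker σ' hσ' z.asIdeal D hD
  obtain ⟨N, e, he⟩ := Module.Finite.exists_fin (R := R) (M := P ⧸ J)
  have key : ∀ (y : Ideal R) [y.IsMaximal]
      (D : ∀ z : MaximalSpectrum P, Derivation R P (ι → z.asIdeal.ResidueField)),
      (∀ z, Submodule.span z.asIdeal.ResidueField (Set.range (D z)) = ⊤) →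
      ∃ f : ι → P, (∀ k, f k - algebraMap R P (v k) ∈ RingHom.ker σ) ∧
        (∀ z : MaximalSpectrum P, J ≤ z.asIdeal → y = z.asIdeal.comap (algebraMap R P) →
          LinearIndependent z.asIdeal.ResidueField (D z ∘ f)) ∧ SeparatesAt J y f := by
    intro y hy D hD
    have hD' : ∀ z : MaximalSpectrum P, J ≤ z.asIdeal →
        Submodule.span z.asIdeal.ResidueField (D z '' (RingHom.ker σ : Ideal P)) = ⊤ :=
      fun z _ => hspan z (D z) (hD z)
    -- A finite residue field requires the given separating function; an infinite one contains N + N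
    -- * N + 1 distinct elements, so the generic choice applies. On a single section separation is
    -- automatic.
    by_cases hfin : Finite (R ⧸ y)
    · obtain ⟨t, ht, hts⟩ := hsep y hfin
      exact exists_finite_at y hfin v (Classical.arbitrary ι) D hD' t ht hts
    · rw [not_finite_iff_infinite] at hfin
      let g := (Infinite.natEmbedding (R ⧸ y))
      choose b hb using fun i : Fin (N + N * N + 1) =>
        Ideal.Quotient.mk_surjective (I := y) (g i)
      have hb' : ∀ i l, i ≠ l → b i - b l ∉ y := fun i l hil hmem => hil (by
        have h1 := (Ideal.Quotient.eq).2 hmem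
        rw [hb, hb] at h1
        exact Fin.ext (g.injective h1))
      refine exists_generic_at e he (Nat.lt_succ_self _) y b hb' _ D hD' (fun φ ψ hφ hψ _ => ?_)
      rw [← hI] at hφ hψ
      exact eq_of_iInf_ker_le σ' (fun i => algebraMap R P (v i))
        (fun k l hkl => absurd (Subsingleton.elim k l) hkl) φ ψ hφ hψ
        fun i => by rw [AlgHom.commutes, AlgHom.commutes]
  obtain ⟨f, hf, hfe, hfs⟩ := exists_etale_coordinates hsm J (RingHom.ker σ)
    (fun i => algebraMap R P (v i)) key
  refine ⟨f, fun i => ?_, hfe, hfs⟩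
  have := hf i
  rw [RingHom.mem_ker, map_sub, sub_eq_zero, AlgHom.commutes] at this
  exact this

end Existence

/-! ### Translation between affine schemes and rings -/

section Bridge

variable {X T Z : Scheme.{u}} {ι : Type u}

/-- Factors the morphism through the map of polynomial rings, so that étaleness and closedness can
be checked algebraically. -/
theorem homOfVector_eq [IsAffine X] [IsAffine T] (x : X ⟶ T) (f : ι → Γ(X, ⊤)) :
    AffineSpace.homOfVector x f = X.isoSpec.hom ≫
      Spec.map (CommRingCat.ofHom (MvPolynomial.eval₂Hom x.appTop.hom f)) ≫
      (AffineSpace.isoOfIsAffine ι T).inv := by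
  apply AffineSpace.hom_ext
  · have h1 : CommRingCat.ofHom (MvPolynomial.C (σ := ι)) ≫
        CommRingCat.ofHom (MvPolynomial.eval₂Hom x.appTop.hom f) = x.appTop := by
      ext r
      simp
    rw [AffineSpace.homOfVector_over, Category.assoc, Category.assoc,
      AffineSpace.isoOfIsAffine_inv_over, ← Spec.map_comp_assoc, h1,
      Scheme.isoSpec_hom_naturality_assoc, Iso.hom_inv_id, Category.comp_id]
  · intro k
    rw [AffineSpace.homOfVector_appTop_coord, Scheme.Hom.comp_appTop, Scheme.Hom.comp_appTop,
      CommRingCat.comp_apply, CommRingCat.comp_apply, AffineSpace.isoOfIsAffine_inv_appTop_coord,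
      ← CommRingCat.comp_apply (Scheme.ΓSpecIso _).inv, ← Scheme.ΓSpecIso_inv_naturality]
    have hX : CommRingCat.ofHom (MvPolynomial.eval₂Hom x.appTop.hom f) (MvPolynomial.X k) = f k :=
      MvPolynomial.eval₂Hom_X' _ _ _
    rw [CommRingCat.comp_apply, hX, Scheme.isoSpec_hom, Scheme.toSpecΓ_appTop]
    exact (Iso.inv_hom_id_apply (Scheme.ΓSpecIso Γ(X, ⊤)) (f k)).symm

theorem etale_basicOpen_comp [IsAffine X] [IsAffine T] (x : X ⟶ T) (f : ι → Γ(X, ⊤)) (h : Γ(X, ⊤))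
    (hh : ((algebraMap Γ(X, ⊤) (Localization.Away h)).comp
      (MvPolynomial.eval₂Hom x.appTop.hom f)).Etale) :
    Etale ((X.basicOpen h).ι ≫ AffineSpace.homOfVector x f) := by
  let o : Spec (CommRingCat.of (Localization.Away h)) ⟶ X :=
    Spec.map (CommRingCat.ofHom (algebraMap Γ(X, ⊤) (Localization.Away h))) ≫ X.isoSpec.inv
  have ho : IsOpenImmersion (Spec.map (CommRingCat.ofHom
      (algebraMap Γ(X, ⊤) (Localization.Away h)))) :=
    inferInstance
  have hr : Set.range (X.basicOpen h).ι = Set.range o := by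
    rw [Scheme.Opens.range_ι, ← X.toSpecΓ_preimage_basicOpen]
    have h1 : Set.range o = X.isoSpec.hom ⁻¹' Set.range (Spec.map (CommRingCat.ofHom
        (algebraMap Γ(X, ⊤) (Localization.Away h)))) := by
      ext w
      constructor
      · rintro ⟨y, rfl⟩
        refine ⟨y, ?_⟩
        rw [← Scheme.Hom.comp_apply, Category.assoc, Iso.inv_hom_id, Category.comp_id]
      · rintro ⟨y, hy⟩
        refine ⟨y, ?_⟩
        rw [Scheme.Hom.comp_apply, hy, ← Scheme.Hom.comp_apply, Iso.hom_inv_id]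
        rfl
    rw [h1, show Set.range (Spec.map (CommRingCat.ofHom
        (algebraMap Γ(X, ⊤) (Localization.Away h)))) =
        (PrimeSpectrum.basicOpen h : Set (PrimeSpectrum Γ(X, ⊤))) from
      PrimeSpectrum.localization_away_comap_range _ h]
    rfl
  let w := IsOpenImmersion.isoOfRangeEq (X.basicOpen h).ι o hr
  have hw : (X.basicOpen h).ι = w.hom ≫ o := (IsOpenImmersion.isoOfRangeEq_hom_fac _ _ hr).symm
  have key : Etale (Spec.map (CommRingCat.ofHom ((algebraMap Γ(X, ⊤) (Localization.Away h)).comp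
      (MvPolynomial.eval₂Hom x.appTop.hom f)))) :=
    (HasRingHomProperty.Spec_iff (P := @Etale)).2 hh
  rw [CommRingCat.ofHom_comp, Spec.map_comp] at key
  rw [hw, homOfVector_eq, Category.assoc, Category.assoc, Iso.inv_hom_id_assoc,
    ← Category.assoc (Spec.map _)]
  infer_instance

theorem isClosedImmersion_comp_homOfVector [IsAffine X] [IsAffine T] [IsAffine Z] (x : X ⟶ T)
    (f : ι → Γ(X, ⊤)) (ζ : Z ⟶ X)
    (hs : Function.Surjective (ζ.appTop.hom.comp (MvPolynomial.eval₂Hom x.appTop.hom f))) :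
    IsClosedImmersion (ζ ≫ AffineSpace.homOfVector x f) := by
  have key : IsClosedImmersion (Spec.map (CommRingCat.ofHom
      (ζ.appTop.hom.comp (MvPolynomial.eval₂Hom x.appTop.hom f)))) :=
    IsClosedImmersion.spec_of_surjective _ hs
  rw [CommRingCat.ofHom_comp, Spec.map_comp, CommRingCat.ofHom_hom] at key
  rw [homOfVector_eq, ← Scheme.isoSpec_hom_naturality_assoc, ← Category.assoc (Spec.map _)]
  infer_instance

theorem range_subset_basicOpen (ζ : Z ⟶ X) (h : Γ(X, ⊤)) (hh : ζ.appTop h = 1) :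
    Set.range ζ ⊆ X.basicOpen h := by
  rintro _ ⟨w, rfl⟩
  have h1 : ζ ⁻¹ᵁ X.basicOpen h = ⊤ := by
    rw [Scheme.preimage_basicOpen_top, hh, Scheme.basicOpen_of_isUnit _ isUnit_one]
  have h2 : w ∈ ζ ⁻¹ᵁ X.basicOpen h := h1 ▸ trivial
  exact h2

theorem isoSpec_hom_apply [IsAffine X] [IsAffine T] (f : X ⟶ T) (x : X) :
    T.isoSpec.hom (f x) = Spec.map f.appTop (X.isoSpec.hom x) := by
  rw [← Scheme.Hom.comp_apply, ← Scheme.Hom.comp_apply, Scheme.isoSpec_hom_naturality]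

/-- A prime containing the kernel of a surjective map on global sections is in the image. -/
theorem exists_apply_of_ker_le [IsAffine X] [IsAffine T] (s : T ⟶ X)
    (hs : Function.Surjective s.appTop.hom) (z : Spec Γ(X, ⊤))
    (hz : RingHom.ker s.appTop.hom ≤ z.asIdeal) : ∃ t : T, X.isoSpec.hom (s t) = z := by
  obtain ⟨q, hq⟩ : ∃ q : Spec Γ(T, ⊤), Spec.map s.appTop q = z := by
    have h1 : z ∈ Set.range (PrimeSpectrum.comap s.appTop.hom) := by
      rw [range_comap_of_surjective _ _ hs]
      exact hz
    exact h1
  refine ⟨T.isoSpec.inv q, ?_⟩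
  rw [isoSpec_hom_apply, ← Scheme.Hom.comp_apply T.isoSpec.inv, Iso.inv_hom_id]
  exact hq

/-- Surjectivity on functions identifies the range with the zero locus of the kernel; a maximal
ideal containing both kernels would be a common point. -/
theorem isCoprime_ker_of_disjoint_range {T' : Scheme.{u}} [IsAffine X] [IsAffine T] [IsAffine T']
    (s : T ⟶ X) (s' : T' ⟶ X) (hs : Function.Surjective s.appTop.hom)
    (hs' : Function.Surjective s'.appTop.hom) (h : Disjoint (Set.range s) (Set.range s')) :
    IsCoprime (RingHom.ker s.appTop.hom) (RingHom.ker s'.appTop.hom) := by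
  rw [Ideal.isCoprime_iff_sup_eq]
  by_contra hne
  obtain ⟨z, hz, hle⟩ := Ideal.exists_le_maximal _ hne
  obtain ⟨t, ht⟩ := exists_apply_of_ker_le s hs ⟨z, hz.isPrime⟩ (le_sup_left.trans hle)
  obtain ⟨t', ht'⟩ := exists_apply_of_ker_le s' hs' ⟨z, hz.isPrime⟩ (le_sup_right.trans hle)
  have h1 : s t = s' t' := X.isoSpec.hom.homeomorph.injective (ht.trans ht'.symm)
  exact Set.disjoint_left.1 h ⟨t, rfl⟩ ⟨t', h1.symm⟩

/-- The coordinates of disjoint sections of affine space over an affine scheme. -/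
theorem span_coord_sub_eq_top [IsAffine T] (s s' : T ⟶ 𝔸(ι; T))
    (hs : s ≫ (𝔸(ι; T) ↘ T) = 𝟙 T) (hs' : s' ≫ (𝔸(ι; T) ↘ T) = 𝟙 T)
    (h : Disjoint (Set.range s) (Set.range s')) :
    Ideal.span (Set.range ((fun i => s.appTop (AffineSpace.coord T i)) -
      fun i => s'.appTop (AffineSpace.coord T i))) = ⊤ := by
  by_contra hne
  obtain ⟨z, hz, hle⟩ := Ideal.exists_le_maximal _ hne
  obtain ⟨k, hk⟩ : ∃ k : Spec (CommRingCat.of (Γ(T, ⊤) ⧸ z)) ⟶ T,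
      k.appTop = CommRingCat.ofHom (Ideal.Quotient.mk z) ≫ (Scheme.ΓSpecIso _).inv := by
    refine ⟨Spec.map (CommRingCat.ofHom (Ideal.Quotient.mk z)) ≫ T.isoSpec.inv, ?_⟩
    rw [Scheme.Hom.comp_appTop, Scheme.ΓSpecIso_inv_naturality]
    congr 1
    have h1 : T.isoSpec.inv.appTop ≫ T.isoSpec.hom.appTop = 𝟙 _ := by
      rw [← Scheme.Hom.comp_appTop, Iso.hom_inv_id, Scheme.Hom.id_appTop]
    rw [Scheme.isoSpec_hom, Scheme.toSpecΓ_appTop] at h1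
    rw [← cancel_mono (Scheme.ΓSpecIso Γ(T, ⊤)).hom, h1]
    exact (Iso.inv_hom_id _).symm
  -- At a maximal ideal containing every coordinate difference the two sections agree, against
  -- disjointness.
  have heq : k ≫ s = k ≫ s' := by
    apply AffineSpace.hom_ext
    · rw [Category.assoc, Category.assoc, hs, hs']
    · intro i
      rw [Scheme.Hom.comp_appTop, Scheme.Hom.comp_appTop, CommRingCat.comp_apply,
        CommRingCat.comp_apply, hk, CommRingCat.comp_apply, CommRingCat.comp_apply]
      congr 1
      exact Ideal.Quotient.eq.2 (hle (Ideal.subset_span ⟨i, rfl⟩))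
  have hn : Nontrivial (Γ(T, ⊤) ⧸ z) := Ideal.Quotient.nontrivial_iff.2 hz.ne_top
  obtain ⟨w⟩ : Nonempty (Spec (CommRingCat.of (Γ(T, ⊤) ⧸ z))) :=
    inferInstanceAs (Nonempty (PrimeSpectrum (Γ(T, ⊤) ⧸ z)))
  refine Set.disjoint_left.1 h ⟨k w, rfl⟩ ⟨k w, ?_⟩
  rw [← Scheme.Hom.comp_apply, ← heq, Scheme.Hom.comp_apply]

theorem locally_isStandardSmooth_appTop [IsAffine X] [IsAffine T] {d : ℕ} (x : X ⟶ T)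
    [h : SmoothOfRelativeDimension d x] :
    RingHom.Locally (fun f => RingHom.IsStandardSmoothOfRelativeDimension d f) x.appTop.hom :=
  (HasRingHomProperty.iff_of_isAffine (P := @SmoothOfRelativeDimension d)).1 h

theorem finitePresentation_appTop [IsAffine X] [IsAffine T] (x : X ⟶ T)
    [h : Smooth x] : x.appTop.hom.FinitePresentation :=
  (HasRingHomProperty.iff_of_isAffine (P := @LocallyOfFinitePresentation)).1 inferInstance

end Bridge

/-! ### The extension step in terms of coordinate functions -/

section Embedding

variable {A : Type u} [CommRing A] {d : ℕ} {C : Scheme.{u}} {p : C ⟶ Spec (CommRingCat.of A)}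
  {hp : SmoothOfRelativeDimension d p} {hC : IsAffine C} {F : (Punctured A d)ᵒᵖ ⥤ Pointed.{v}}
  {U V : Punctured A d} {j : U ⟶ Punctured.ofAffine p hC hp} {k : V ⟶ U} {a : F.obj (op U)}
  {Y Z : Scheme.{u}} {i : Y ⟶ C} {z : Z ⟶ C}

/-- The sections `s k` of affine space over `T` are as in the extension hypothesis on `F`. -/
def IsGoodSections (F : (Punctured A d)ᵒᵖ ⥤ Pointed.{v}) {T : Scheme.{u}}
    (t : T ⟶ Spec (CommRingCat.of A)) [IsFinite t] [Etale t] {m : ℕ}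
    (s : Fin m → (T ⟶ 𝔸(ULift.{u} (Fin d); T))) : Prop :=
  IsDisjointCopies s ∧
    ∀ (Z : Scheme.{u}) (z : Z ⟶ 𝔸(ULift.{u} (Fin d); T)),
      IsClosedImmersion z → IsFinite (z ≫ (𝔸(ULift.{u} (Fin d); T) ↘ T)) →
      (∀ k, ∃ l : T ⟶ Z, l ≫ z = s k) →
      KerSurjective F (Punctured.affineSpace d t) (⋃ k, Set.range (s k)) (Set.range z)

theorem isFinite_of_comp_eq {X T S W : Scheme.{u}} (ζ : W ⟶ X) (x : X ⟶ T) (t : T ⟶ S) [IsFinite t]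
    (h : IsFinite (ζ ≫ x ≫ t)) : IsFinite (ζ ≫ x) := by
  rw [← Category.assoc] at h
  exact IsFinite.of_comp (ζ ≫ x) t

/-- The étale excision step, for coordinate functions on `X` relative to `T`. -/
theorem ExtendsOff.of_coordinates [IsClosedImmersion i] [IsClosedImmersion z]
    [Etale (i ≫ p)] (hF : IsExcisive F)
    (hj : IsComplement j (Set.range i)) (hk : IsComplement (k ≫ j) (Set.range z))
    (ha : (F.map k.op).toFun a = (F.obj (op V)).point) {ℓ : Y ⟶ Z} (hℓ : ℓ ≫ z = i)
    {X T : Scheme.{u}} {g : X ⟶ C} [IsAffine X] [IsAffine T] [Etale g]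
    (hfin : IsFinite (pullback.snd i g ≫ g ≫ p)) (hfinZ : IsFinite (pullback.snd z g ≫ g ≫ p))
    (x : X ⟶ T) (t : T ⟶ Spec (CommRingCat.of A)) [IsFinite t] [Etale t] (hx : x ≫ t = g ≫ p)
    {m : ℕ} (ρ : Fin m → (T ⟶ pullback i g)) (hρ : ∀ k, ρ k ≫ pullback.snd i g ≫ x = 𝟙 T)
    {s : Fin m → (T ⟶ 𝔸(ULift.{u} (Fin d); T))} (hs : IsGoodSections F t s)
    (f : ULift.{u} (Fin d) → Γ(X, ⊤))
    (hfs : ∀ k l, (ρ k ≫ pullback.snd i g).appTop (f l) = (s k).appTop (AffineSpace.coord T l))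
    (h : Γ(X, ⊤)) (hh : (pullback.snd z g).appTop h = 1)
    (het : ((algebraMap Γ(X, ⊤) (Localization.Away h)).comp
      (MvPolynomial.eval₂Hom x.appTop.hom f)).Etale)
    (hsurj : Function.Surjective
      ((pullback.snd z g).appTop.hom.comp (MvPolynomial.eval₂Hom x.appTop.hom f)))
    (hoff : ExtendsOff p hp hC F j a g (⋃ k, Set.range (ρ k ≫ pullback.snd i g))) :
    ExtendsOff p hp hC F j a g ∅ := by
  have hZx : IsFinite (pullback.snd z g ≫ x) := isFinite_of_comp_eq _ x t (by rwa [hx])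
  have hZaff : IsAffine (pullback z g) := isAffine_of_isAffineHom (pullback.snd z g)
  let fs := AffineSpace.homOfVector x f
  have hfx : fs ≫ (𝔸(ULift.{u} (Fin d); T) ↘ T) = x := AffineSpace.homOfVector_over _ _
  have hcl : IsClosedImmersion (pullback.snd z g ≫ fs) :=
    isClosedImmersion_comp_homOfVector x f _ hsurj
  let c : pullback i g ⟶ pullback z g := pullback.lift (pullback.fst _ _ ≫ ℓ)
    (pullback.snd _ _) (by rw [Category.assoc, hℓ, pullback.condition])
  have hc : c ≫ pullback.snd z g = pullback.snd i g := pullback.lift_snd _ _ _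
  -- The prescribed values on the sections say exactly that the coordinate morphism carries them to
  -- the good sections.
  have hsk : ∀ k, ρ k ≫ pullback.snd i g ≫ fs = s k := by
    intro k
    apply AffineSpace.hom_ext
    · rw [Category.assoc, Category.assoc, hfx, hρ, hs.1.1]
    · intro l
      rw [← hfs, ← Category.assoc, Scheme.Hom.comp_appTop _ fs, CommRingCat.comp_apply,
        AffineSpace.homOfVector_appTop_coord]
  refine ExtendsOff.of_kerSurjective hF hj hk ha hℓ hfin hfinZ x t hx ρ hρ fs hfx h
    (etale_basicOpen_comp x f h het) (range_subset_basicOpen _ h hh) hcl ?_ hoff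
  simp only [hsk]
  refine hs.2 _ (pullback.snd z g ≫ fs) hcl ?_ fun k => ⟨ρ k ≫ c, ?_⟩
  · rwa [Category.assoc, hfx]
  · rw [Category.assoc, reassoc_of% hc, hsk]

theorem surjective_appTop_of_section {X T : Scheme.{u}} (s : T ⟶ X) (x : X ⟶ T)
    (h : s ≫ x = 𝟙 T) : Function.Surjective s.appTop.hom := by
  intro r
  refine ⟨x.appTop r, ?_⟩
  have h1 : x.appTop ≫ s.appTop = 𝟙 _ := by
    rw [← Scheme.Hom.comp_appTop, h, Scheme.Hom.id_appTop]
  exact ConcreteCategory.congr_hom h1 r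

/-- The algebra map to functions on the base given by a section. -/
noncomputable def sectionAlgHom {X T : Scheme.{u}} (s : T ⟶ X) (x : X ⟶ T) (h : s ≫ x = 𝟙 T) :
    letI := x.appTop.hom.toAlgebra
    Γ(X, ⊤) →ₐ[Γ(T, ⊤)] Γ(T, ⊤) :=
  letI := x.appTop.hom.toAlgebra
  { s.appTop.hom with
    commutes' := fun r => by
      have h1 : x.appTop ≫ s.appTop = 𝟙 _ := by
        rw [← Scheme.Hom.comp_appTop, h, Scheme.Hom.id_appTop]
      exact ConcreteCategory.congr_hom h1 r }

/-- Functions on a closed subscheme are a quotient of functions on an affine scheme. -/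
theorem finite_quotient_ker {X T W : Scheme.{u}} [IsAffine X] [IsAffine T] (ζ : W ⟶ X)
    [IsClosedImmersion ζ] (x : X ⟶ T) {N : ℕ} (e : Fin N → Γ(W, ⊤))
    (he : letI := (ζ ≫ x).appTop.hom.toAlgebra
      Submodule.span Γ(T, ⊤) (Set.range e) = ⊤) :
    letI := x.appTop.hom.toAlgebra
    ∃ e' : Fin N → Γ(X, ⊤) ⧸ RingHom.ker ζ.appTop.hom,
      Submodule.span Γ(T, ⊤) (Set.range e') = ⊤ := by
  let _ := x.appTop.hom.toAlgebra
  let _ := (ζ ≫ x).appTop.hom.toAlgebra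
  let l : Γ(X, ⊤) →ₐ[Γ(T, ⊤)] Γ(W, ⊤) :=
    { ζ.appTop.hom with
      commutes' := fun r => by
        change ζ.appTop (x.appTop r) = (ζ ≫ x).appTop r
        rw [Scheme.Hom.comp_appTop]; rfl }
  have hl : Function.Surjective l := (IsClosedImmersion.isAffine_surjective_of_isAffine ζ).2
  let E : (Γ(X, ⊤) ⧸ RingHom.ker l) ≃ₐ[Γ(T, ⊤)] Γ(W, ⊤) := Ideal.quotientKerAlgEquivOfSurjective hl
  have key : ∃ e' : Fin N → Γ(X, ⊤) ⧸ RingHom.ker l,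
      Submodule.span Γ(T, ⊤) (Set.range e') = ⊤ := by
    refine ⟨fun k => E.symm (e k), ?_⟩
    have := congr_arg (Submodule.map E.symm.toLinearMap) he
    rw [Submodule.map_span, ← Set.range_comp, Submodule.map_top, LinearMap.range_eq_top.2
      E.symm.surjective] at this
    exact this
  exact key

theorem exists_span_appTop_of_isFinite {W T : Scheme.{u}} [IsAffine T] (w : W ⟶ T) [IsFinite w] :
    ∃ (N : ℕ) (e : Fin N → Γ(W, ⊤)), letI := w.appTop.hom.toAlgebra
      Submodule.span Γ(T, ⊤) (Set.range e) = ⊤ := by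
  let _ := w.appTop.hom.toAlgebra
  have h1 : w.appTop.hom.Finite := ((isFinite_iff w).1 inferInstance).2 ⊤ (isAffineOpen_top T)
  have : Module.Finite Γ(T, ⊤) Γ(W, ⊤) := h1
  obtain ⟨N, e, he⟩ := Module.Finite.exists_fin (R := Γ(T, ⊤)) (M := Γ(W, ⊤))
  exact ⟨N, e, he⟩

end Embedding

/-- Maximal ideals contract to maximal ideals, and only finitely many primes lie over each. -/
theorem finite_maximalSpectrum_of_finite (R S : Type*) [CommRing R] [CommRing S] [Algebra R S]
    [Finite (MaximalSpectrum R)] [Module.Finite R S] : Finite (MaximalSpectrum S) := by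
  let φ : MaximalSpectrum S → Σ y : MaximalSpectrum R, y.asIdeal.primesOver S := fun w =>
    ⟨⟨w.asIdeal.comap (algebraMap R S), have := w.isMaximal; Ideal.isMaximal_comap_of_isIntegral_of_isMaximal
        (R := R) w.asIdeal⟩, ⟨w.asIdeal, w.isMaximal.isPrime, ⟨rfl⟩⟩⟩
  have hf : ∀ y : MaximalSpectrum R, Finite (y.asIdeal.primesOver S) := fun y =>
    (Algebra.QuasiFinite.finite_primesOver y.asIdeal).to_subtype
  refine Finite.of_injective φ fun w w' h => ?_
  have h1 := congr_arg (fun s : Σ y : MaximalSpectrum R, y.asIdeal.primesOver S => s.2.1) h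
  exact MaximalSpectrum.ext h1

/-! ### The extension step over large residue fields, and with a separating function -/

section LargeResidueFields

variable {A : Type u} [CommRing A] {d : ℕ} {C : Scheme.{u}} {p : C ⟶ Spec (CommRingCat.of A)}
  {hp : SmoothOfRelativeDimension d p} {hC : IsAffine C} {F : (Punctured A d)ᵒᵖ ⥤ Pointed.{v}}
  {U V : Punctured A d} {j : U ⟶ Punctured.ofAffine p hC hp} {k : V ⟶ U} {a : F.obj (op U)}
  {Y Z : Scheme.{u}} {i : Y ⟶ C} {z : Z ⟶ C}

theorem finite_maximalSpectrum_appTop [Finite (MaximalSpectrum A)] {T : Scheme.{u}}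
    (t : T ⟶ Spec (CommRingCat.of A)) [IsFinite t] : Finite (MaximalSpectrum Γ(T, ⊤)) := by
  let _ : Algebra A Γ(T, ⊤) :=
    ((Scheme.ΓSpecIso (CommRingCat.of A)).inv ≫ t.appTop).hom.toAlgebra
  have h1 : t.appTop.hom.Finite := ((isFinite_iff t).1 inferInstance).2 ⊤ (isAffineOpen_top _)
  have h2 : ((Scheme.ΓSpecIso (CommRingCat.of A)).inv ≫ t.appTop).hom.Finite := by
    rw [CommRingCat.hom_comp]
    refine h1.comp (RingHom.Finite.of_surjective _ ?_)
    exact (ConcreteCategory.bijective_of_isIso (Scheme.ΓSpecIso (CommRingCat.of A)).inv).2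
  have : Module.Finite A Γ(T, ⊤) := h2
  exact finite_maximalSpectrum_of_finite A Γ(T, ⊤)

theorem surjective_comp_aeval_of_ker {R P W : Type*} [CommRing R] [CommRing P] [CommRing W]
    [Algebra R P] (q : P →+* W) (hq : Function.Surjective q) {α : Type*} (f : α → P)
    (h : Function.Surjective ((Ideal.Quotient.mk (RingHom.ker q)).comp
      (MvPolynomial.aeval (R := R) f).toRingHom)) :
    Function.Surjective (q.comp (MvPolynomial.aeval (R := R) f).toRingHom) := by
  have h1 : Function.Surjective (RingHom.kerLift q) := by
    intro r
    obtain ⟨y, rfl⟩ := hq r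
    exact ⟨Ideal.Quotient.mk _ y, rfl⟩
  exact h1.comp h

/-- Off disjoint sections, an extension on a scheme over a base with large residue fields extends
across the sections. -/
theorem ExtendsOff.of_large [IsClosedImmersion i] [IsClosedImmersion z]
    [Etale (i ≫ p)] (hd : 0 < d) (hF : IsExcisive F)
    (hj : IsComplement j (Set.range i)) (hk : IsComplement (k ≫ j) (Set.range z))
    (ha : (F.map k.op).toFun a = (F.obj (op V)).point) {ℓ : Y ⟶ Z} (hℓ : ℓ ≫ z = i)
    {X T : Scheme.{u}} {g : X ⟶ C} [IsAffine X] [IsAffine T] [Etale g]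
    (hfin : IsFinite (pullback.snd i g ≫ g ≫ p)) (hfinZ : IsFinite (pullback.snd z g ≫ g ≫ p))
    (x : X ⟶ T) [SmoothOfRelativeDimension d x]
    (t : T ⟶ Spec (CommRingCat.of A)) [IsFinite t] [Etale t] (hx : x ≫ t = g ≫ p)
    [Finite (MaximalSpectrum Γ(T, ⊤))] {N n : ℕ} (e : Fin N → Γ(pullback z g, ⊤))
    (he : letI := (pullback.snd z g ≫ x).appTop.hom.toAlgebra
      Submodule.span Γ(T, ⊤) (Set.range e) = ⊤) (hn : N + N * N < n)
    (b : Fin n → Γ(T, ⊤)) (hb : ∀ k l, k ≠ l → IsUnit (b k - b l))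
    {m : ℕ} (ρ : Fin m → (T ⟶ pullback i g)) (hρ : ∀ k, ρ k ≫ pullback.snd i g ≫ x = 𝟙 T)
    (hdisj : Pairwise fun k l => Disjoint (Set.range (ρ k ≫ pullback.snd i g))
      (Set.range (ρ l ≫ pullback.snd i g)))
    {s : Fin m → (T ⟶ 𝔸(ULift.{u} (Fin d); T))} (hs : IsGoodSections F t s)
    (hoff : ExtendsOff p hp hC F j a g (⋃ k, Set.range (ρ k ≫ pullback.snd i g))) :
    ExtendsOff p hp hC F j a g ∅ := by
  let _ : Algebra Γ(T, ⊤) Γ(X, ⊤) := x.appTop.hom.toAlgebra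
  have hne : Nonempty (ULift.{u} (Fin d)) := ⟨⟨0, hd⟩⟩
  have hsmooth : Smooth x := SmoothOfRelativeDimension.smooth d x
  have hfp : Algebra.FinitePresentation Γ(T, ⊤) Γ(X, ⊤) := finitePresentation_appTop x
  have hρ' : ∀ k, (ρ k ≫ pullback.snd i g) ≫ x = 𝟙 T := fun k => by rw [Category.assoc, hρ]
  have hsurj : ∀ k, Function.Surjective (ρ k ≫ pullback.snd i g).appTop.hom := fun k =>
    surjective_appTop_of_section _ x (hρ' k)
  let σ : Fin m → Γ(X, ⊤) →ₐ[Γ(T, ⊤)] Γ(T, ⊤) := fun k => sectionAlgHom _ x (hρ' k)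
  have hσ : Pairwise fun k l => IsCoprime (RingHom.ker (σ k)) (RingHom.ker (σ l)) :=
    fun k l hkl => isCoprime_ker_of_disjoint_range _ _ (hsurj k) (hsurj l) (hdisj hkl)
  obtain ⟨e', he'⟩ := finite_quotient_ker (pullback.snd z g) x e he
  have hmf : Module.Finite Γ(T, ⊤) (Γ(X, ⊤) ⧸ RingHom.ker (pullback.snd z g).appTop.hom) :=
    ⟨(Submodule.fg_def).2 ⟨_, Set.finite_range e', he'⟩⟩
  have hsm : RingHom.Locally (fun f => RingHom.IsStandardSmoothOfRelativeDimension
      (Fintype.card (ULift.{u} (Fin d))) f) (algebraMap Γ(T, ⊤) Γ(X, ⊤)) := by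
    rw [Fintype.card_ulift, Fintype.card_fin]
    exact locally_isStandardSmooth_appTop x
  obtain ⟨f, hf, ⟨h, hh, het⟩, hsur⟩ := exists_etale_coordinates_of_large
    (RingHom.ker (pullback.snd z g).appTop.hom) hsm e' he' hn b hb σ hσ
    (fun k l => (s k).appTop (AffineSpace.coord T l))
    (fun k l hkl => span_coord_sub_eq_top _ _ (hs.1.1 k) (hs.1.1 l) (hs.1.2 hkl))
  have hh1 : (pullback.snd z g).appTop h = 1 := by
    have : (pullback.snd z g).appTop.hom (h - 1) = 0 := hh
    rw [map_sub, map_one, sub_eq_zero] at this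
    exact this
  exact ExtendsOff.of_coordinates hF hj hk ha hℓ hfin hfinZ x t hx ρ hρ hs f hf h hh1 het
    (surjective_comp_aeval_of_ker _
      (IsClosedImmersion.isAffine_surjective_of_isAffine (pullback.snd z g)).2 f hsur) hoff

/-- Off a section, an extension on a scheme extends across the section if, over the points of the
base with finite residue fields, a function vanishing on the section separates the points over `Z`.
-/
theorem ExtendsOff.of_separating [IsClosedImmersion i] [IsClosedImmersion z]
    [Etale (i ≫ p)] (hd : 0 < d) (hF : IsExcisive F)
    (hj : IsComplement j (Set.range i)) (hk : IsComplement (k ≫ j) (Set.range z))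
    (ha : (F.map k.op).toFun a = (F.obj (op V)).point) {ℓ : Y ⟶ Z} (hℓ : ℓ ≫ z = i)
    {X T : Scheme.{u}} {g : X ⟶ C} [IsAffine X] [IsAffine T] [Etale g]
    (hfin : IsFinite (pullback.snd i g ≫ g ≫ p)) (hfinZ : IsFinite (pullback.snd z g ≫ g ≫ p))
    (x : X ⟶ T) [SmoothOfRelativeDimension d x]
    (t : T ⟶ Spec (CommRingCat.of A)) [IsFinite t] [Etale t] (hx : x ≫ t = g ≫ p)
    [Finite (MaximalSpectrum Γ(T, ⊤))]
    (ρ : T ⟶ pullback i g) (hρ : ρ ≫ pullback.snd i g ≫ x = 𝟙 T)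
    (hsep : letI := x.appTop.hom.toAlgebra
      ∀ (y : Ideal Γ(T, ⊤)) [y.IsMaximal], Finite (Γ(T, ⊤) ⧸ y) →
        ∃ f ∈ RingHom.ker (ρ ≫ pullback.snd i g).appTop.hom,
          ∀ φ ψ : Γ(X, ⊤) →ₐ[Γ(T, ⊤)] AlgebraicClosure y.ResidueField,
            RingHom.ker (pullback.snd z g).appTop.hom ≤ RingHom.ker φ →
            RingHom.ker (pullback.snd z g).appTop.hom ≤ RingHom.ker ψ → φ f = ψ f → φ = ψ)
    {s : Fin 1 → (T ⟶ 𝔸(ULift.{u} (Fin d); T))} (hs : IsGoodSections F t s)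
    (hoff : ExtendsOff p hp hC F j a g (Set.range (ρ ≫ pullback.snd i g))) :
    ExtendsOff p hp hC F j a g ∅ := by
  let _ : Algebra Γ(T, ⊤) Γ(X, ⊤) := x.appTop.hom.toAlgebra
  have hne : Nonempty (ULift.{u} (Fin d)) := ⟨⟨0, hd⟩⟩
  have hsmooth : Smooth x := SmoothOfRelativeDimension.smooth d x
  have hfp : Algebra.FinitePresentation Γ(T, ⊤) Γ(X, ⊤) := finitePresentation_appTop x
  have hρ' : (ρ ≫ pullback.snd i g) ≫ x = 𝟙 T := by rw [Category.assoc, hρ]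
  let σ : Γ(X, ⊤) →ₐ[Γ(T, ⊤)] Γ(T, ⊤) := sectionAlgHom _ x hρ'
  have hZx : IsFinite (pullback.snd z g ≫ x) := isFinite_of_comp_eq _ x t (by rwa [hx])
  obtain ⟨N, e, he⟩ := exists_span_appTop_of_isFinite (pullback.snd z g ≫ x)
  obtain ⟨e', he'⟩ := finite_quotient_ker (pullback.snd z g) x e he
  have hmf : Module.Finite Γ(T, ⊤) (Γ(X, ⊤) ⧸ RingHom.ker (pullback.snd z g).appTop.hom) :=
    ⟨(Submodule.fg_def).2 ⟨_, Set.finite_range e', he'⟩⟩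
  have hsm : RingHom.Locally (fun f => RingHom.IsStandardSmoothOfRelativeDimension
      (Fintype.card (ULift.{u} (Fin d))) f) (algebraMap Γ(T, ⊤) Γ(X, ⊤)) := by
    rw [Fintype.card_ulift, Fintype.card_fin]
    exact locally_isStandardSmooth_appTop x
  obtain ⟨f, hf, ⟨h, hh, het⟩, hsur⟩ := exists_etale_coordinates_of_separating
    (RingHom.ker (pullback.snd z g).appTop.hom) hsm σ
    (fun l => (s 0).appTop (AffineSpace.coord T l)) hsep
  have hh1 : (pullback.snd z g).appTop h = 1 := by
    have : (pullback.snd z g).appTop.hom (h - 1) = 0 := hh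
    rw [map_sub, map_one, sub_eq_zero] at this
    exact this
  have hun : (⋃ _ : Fin 1, Set.range (ρ ≫ pullback.snd i g)) = Set.range (ρ ≫ pullback.snd i g) :=
    Set.iUnion_const _
  refine ExtendsOff.of_coordinates hF hj hk ha hℓ hfin hfinZ x t hx (fun _ => ρ) (fun _ => hρ) hs f
    ?_ h hh1 het (surjective_comp_aeval_of_ker _
      (IsClosedImmersion.isAffine_surjective_of_isAffine (pullback.snd z g)).2 f hsur)
      (by rw [hun]; exact hoff)
  intro k l
  rw [Subsingleton.elim k 0]
  exact hf l

end LargeResidueFields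

/-! ### Counting disjoint sections by the degree -/

section Degree

variable {W S T : Scheme.{u}} {K : Type u} [Field K] {m : ℕ}

/-- A finite affine scheme with `N` generators of its functions has at most `N` points over a
field-valued point of the base. -/
theorem card_le_of_span [IsAffine W] (f : W ⟶ S) {N : ℕ} (e : Fin N → Γ(W, ⊤))
    (he : letI := f.appTop.hom.toAlgebra
      Submodule.span Γ(S, ⊤) (Set.range e) = ⊤)
    (τ : Spec (CommRingCat.of K) ⟶ S) (w : Fin m → (Spec (CommRingCat.of K) ⟶ W))
    (hw : ∀ k, w k ≫ f = τ) (hinj : Function.Injective w) : m ≤ N := by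
  let _ : Algebra Γ(S, ⊤) Γ(W, ⊤) := f.appTop.hom.toAlgebra
  let ε := (Scheme.ΓSpecIso (CommRingCat.of K)).hom
  let _ : Algebra Γ(S, ⊤) K := (τ.appTop ≫ ε).hom.toAlgebra
  let φ : Fin m → Γ(W, ⊤) →ₐ[Γ(S, ⊤)] K := fun k =>
    { ((w k).appTop ≫ ε).hom with
      commutes' := fun r => by
        have h1 : f.appTop ≫ (w k).appTop ≫ ε = τ.appTop ≫ ε := by
          rw [← hw k, Scheme.Hom.comp_appTop, Category.assoc]
        exact ConcreteCategory.congr_hom h1 r }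
  have hφ : Function.Injective φ := by
    intro k l hkl
    apply hinj
    apply ext_of_isAffine
    rw [← cancel_mono ε]
    ext r
    exact DFunLike.congr_fun hkl r
  obtain ⟨hfin, hcard⟩ := card_algHom_le (K := K) e he
  exact (by simpa using Nat.card_le_card_of_injective φ hφ : m ≤ _).trans hcard

/-- Over a field the degree is the dimension of the algebra of functions, which by Dedekind bounds
the number of its rational points. -/
theorem card_le_finrank_of_field {D : Scheme.{u}} (q : D ⟶ Spec (CommRingCat.of K)) [Flat q]
    [IsFinite q] (w : Fin m → (Spec (CommRingCat.of K) ⟶ D)) (hw : ∀ k, w k ≫ q = 𝟙 _)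
    (hinj : Function.Injective w) (o : Spec (CommRingCat.of K)) : m ≤ q.finrank o := by
  have hD : IsAffine D := isAffine_of_isAffineHom q
  obtain ⟨φ, hφ⟩ := Spec.map_surjective (D.isoSpec.inv ≫ q)
  have hfin : IsFinite (Spec.map φ) := by rw [hφ]; infer_instance
  have hfin' : φ.hom.Finite := (IsFinite.SpecMap_iff _).1 hfin
  let _ : Algebra K Γ(D, ⊤) := φ.hom.toAlgebra
  have hmf : Module.Finite K Γ(D, ⊤) := hfin'
  have h1 : q.finrank o = Module.finrank K Γ(D, ⊤) := by
    rw [← Scheme.Hom.finrank_comp_left_of_isIso D.isoSpec.inv q, ← hφ]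
    refine (Scheme.Hom.finrank_SpecMap_algebraMap K Γ(D, ⊤) o).trans ?_
    rw [Module.rankAtStalk_eq_finrank_of_free]
    rfl
  choose ψ hψ using fun k => Spec.map_surjective (w k ≫ D.isoSpec.hom)
  have hcomm : ∀ k, φ ≫ ψ k = 𝟙 _ := by
    intro k
    apply Spec.map_injective
    rw [Spec.map_comp, hφ, hψ, Category.assoc, Iso.hom_inv_id_assoc, hw, Spec.map_id]
  let θ : Fin m → Γ(D, ⊤) →ₐ[K] K := fun k =>
    { (ψ k).hom with commutes' := fun r => ConcreteCategory.congr_hom (hcomm k) r }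
  have hθ : Function.Injective θ := by
    intro k l hkl
    apply hinj
    rw [← cancel_mono D.isoSpec.hom, ← hψ, ← hψ]
    congr 1
    ext r
    exact DFunLike.congr_fun hkl r
  let b := Module.finBasis K Γ(D, ⊤)
  obtain ⟨hfin, hcard⟩ := card_algHom_le (K := K) b b.span_eq
  rw [h1]
  exact (by simpa using Nat.card_le_card_of_injective θ hθ : m ≤ _).trans hcard

/-- Degree is invariant under base change, which reduces to a base that is a field. -/
theorem card_le_finrank (f : W ⟶ S) [Flat f] [IsFinite f]
    (τ : Spec (CommRingCat.of K) ⟶ S) (w : Fin m → (Spec (CommRingCat.of K) ⟶ W))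
    (hw : ∀ k, w k ≫ f = τ) (hinj : Function.Injective w) (o : Spec (CommRingCat.of K)) :
    m ≤ f.finrank (τ o) := by
  rw [← Scheme.Hom.finrank_pullback_snd f τ]
  refine card_le_finrank_of_field _ (fun k =>
    pullback.lift (w k) (𝟙 _) (by rw [hw, Category.id_comp])) (fun k => pullback.lift_snd _ _ _)
    (fun k l hkl => hinj ?_) o
  have := congr_arg (· ≫ pullback.fst f τ) hkl
  simpa only [pullback.lift_fst] using this

/-- Morphisms to a scheme `W` over `S` whose graphs are disjoint are different at each point. -/
theorem injective_comp_of_disjoint {C : Scheme.{u}} (i : W ⟶ C) [Mono i] (c : C ⟶ S) (t : T ⟶ S)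
    (w : Fin m → (T ⟶ W)) (σ : Fin m → (T ⟶ pullback c t))
    (hσ : ∀ k, σ k ≫ pullback.fst c t = w k ≫ i) (hσ' : ∀ k, σ k ≫ pullback.snd c t = 𝟙 T)
    (hdisj : Pairwise fun k l => Disjoint (Set.range (σ k)) (Set.range (σ l)))
    (o : Spec (CommRingCat.of K) ⟶ T) : Function.Injective fun k => o ≫ w k := by
  intro k l hkl
  by_contra hne
  have h1 : o ≫ σ k = o ≫ σ l := by
    apply pullback.hom_ext
    · rw [Category.assoc, Category.assoc, hσ, hσ, reassoc_of% hkl]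
    · rw [Category.assoc, Category.assoc, hσ', hσ']
  obtain ⟨x⟩ : Nonempty (Spec (CommRingCat.of K)) := inferInstanceAs (Nonempty (PrimeSpectrum K))
  refine Set.disjoint_left.1 (hdisj hne) ⟨o x, rfl⟩ ⟨o x, ?_⟩
  rw [← Scheme.Hom.comp_apply, ← h1, Scheme.Hom.comp_apply]

end Degree

/-! ### Elements integral over ℤ with unit differences -/

section IntegralUnits

/-- A ring with `n` elements integral over `ℤ` whose differences are units with inverses that are
integral over `ℤ`. -/
def HasIntegralUnits (n : ℕ) (S : Type*) [CommRing S] : Prop :=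
  ∃ b : Fin n → S, (∀ k, IsIntegral ℤ (b k)) ∧
    ∀ k l, k ≠ l → ∃ c, IsIntegral ℤ c ∧ (b k - b l) * c = 1

variable {S : Type*} [CommRing S] {n : ℕ}

theorem hasIntegralUnits_one : HasIntegralUnits 1 S :=
  ⟨0, fun _ => isIntegral_zero, fun k l h => absurd (Subsingleton.elim k l) h⟩

theorem hasIntegralUnits_of_subsingleton [Subsingleton S] : HasIntegralUnits n S :=
  ⟨0, fun _ => isIntegral_zero, fun _ _ _ => ⟨0, isIntegral_zero, Subsingleton.elim _ _⟩⟩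

theorem HasIntegralUnits.mono (h : HasIntegralUnits n S) {m : ℕ} (hm : m ≤ n) :
    HasIntegralUnits m S := by
  obtain ⟨b, hb, hc⟩ := h
  exact ⟨fun k => b (k.castLE hm), fun k => hb _, fun k l hkl =>
    hc _ _ fun h => hkl (Fin.castLE_injective hm h)⟩

theorem HasIntegralUnits.map (h : HasIntegralUnits n S) {S' : Type*} [CommRing S'] (f : S →+* S') :
    HasIntegralUnits n S' := by
  obtain ⟨b, hb, hc⟩ := h
  refine ⟨fun k => f (b k), fun k => (hb k).map f.toIntAlgHom, fun k l hkl => ?_⟩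
  obtain ⟨c, hci, hc⟩ := hc k l hkl
  exact ⟨f c, hci.map f.toIntAlgHom, by rw [← map_sub, ← map_mul, hc, map_one]⟩

/-- The product of the two monic equations takes a value in I ⊓ J. -/
theorem isIntegral_of_quotient {I J : Ideal S} (hIJ : I ⊓ J = ⊥) {x : S}
    (hI : IsIntegral ℤ (Ideal.Quotient.mk I x)) (hJ : IsIntegral ℤ (Ideal.Quotient.mk J x)) :
    IsIntegral ℤ x := by
  obtain ⟨f, hf, hfx⟩ := hI
  obtain ⟨g, hg, hgx⟩ := hJ
  have key : ∀ (L : Ideal S) (f : Polynomial ℤ), f.eval₂ (algebraMap ℤ (S ⧸ L))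
      (Ideal.Quotient.mk L x) = 0 → f.eval₂ (algebraMap ℤ S) x ∈ L := by
    intro L f h
    rw [← Ideal.Quotient.eq_zero_iff_mem, Polynomial.hom_eval₂, ← h]
    congr 1
  refine ⟨f * g, hf.mul hg, ?_⟩
  have : (f * g).eval₂ (algebraMap ℤ S) x ∈ I ⊓ J := by
    rw [Polynomial.eval₂_mul]
    exact ⟨I.mul_mem_right _ (key I f hfx), J.mul_mem_left _ (key J g hgx)⟩
  rwa [hIJ] at this

/-- The Chinese remainder theorem lifts elements and inverses from both factors at once, and
integrality can be tested on the factors. -/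
theorem HasIntegralUnits.of_coprime {I J : Ideal S} (hIJ : I ⊓ J = ⊥) (hIJ' : IsCoprime I J)
    (hI : HasIntegralUnits n (S ⧸ I)) (hJ : HasIntegralUnits n (S ⧸ J)) : HasIntegralUnits n S := by
  have crt : ∀ (x : S ⧸ I) (y : S ⧸ J), ∃ z : S, Ideal.Quotient.mk I z = x ∧
      Ideal.Quotient.mk J z = y := by
    intro x y
    obtain ⟨z, hz⟩ := (Ideal.quotientInfEquivQuotientProd I J hIJ').surjective (x, y)
    obtain ⟨z, rfl⟩ := Ideal.Quotient.mk_surjective z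
    exact ⟨z, congr_arg Prod.fst hz, congr_arg Prod.snd hz⟩
  obtain ⟨b, hb, hc⟩ := hI
  obtain ⟨b', hb', hc'⟩ := hJ
  choose β hβ hβ' using fun k => crt (b k) (b' k)
  refine ⟨β, fun k => isIntegral_of_quotient hIJ (by rw [hβ]; exact hb k)
    (by rw [hβ']; exact hb' k), fun k l hkl => ?_⟩
  obtain ⟨c, hci, hc⟩ := hc k l hkl
  obtain ⟨c', hci', hc'⟩ := hc' k l hkl
  obtain ⟨γ, rfl, rfl⟩ := crt c c'
  refine ⟨γ, isIntegral_of_quotient hIJ hci hci', ?_⟩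
  rw [← sub_eq_zero, ← Ideal.mem_bot, ← hIJ]
  constructor
  · exact Ideal.Quotient.eq.1 (by rw [map_mul, map_sub, hβ, hβ, hc, map_one])
  · exact Ideal.Quotient.eq.1 (by rw [map_mul, map_sub, hβ', hβ', hc', map_one])

theorem HasIntegralUnits.of_mul_eq_zero {x y : S} (hxy : x * y = 0) (hc : IsCoprime x y)
    (hx : HasIntegralUnits n (S ⧸ Ideal.span {x})) (hy : HasIntegralUnits n (S ⧸ Ideal.span {y})) :
    HasIntegralUnits n S := by
  have h1 : IsCoprime (Ideal.span {x}) (Ideal.span {y}) := (Ideal.isCoprime_span_singleton_iff _ _).2 hc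
  refine HasIntegralUnits.of_coprime ?_ h1 hx hy
  rw [← Ideal.mul_eq_inf_of_isCoprime h1, Ideal.span_singleton_mul_span_singleton, hxy,
    Ideal.span_singleton_eq_bot.2 rfl]

/-- The powers of a unit `w` such that `w ^ M - 1` is a unit, all inverses being integral. -/
theorem hasIntegralUnits_of_unit {w c d : S} (hw : IsIntegral ℤ w) (hc : IsIntegral ℤ c)
    (hd : IsIntegral ℤ d) (hwc : w * c = 1) {M : ℕ} (hM : n.factorial ∣ M)
    (hwd : (w ^ M - 1) * d = 1) : HasIntegralUnits n S := by
  -- Write l = k + e + 1. Then w ^ l − w ^ k is w ^ k times w ^ (e + 1) − 1, which divides w ^ M − 1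
  -- because e + 1 ≤ n divides n!, hence M.
  have key : ∀ k l : ℕ, k < l → l < n → ∃ x, IsIntegral ℤ x ∧ (w ^ l - w ^ k) * x = 1 := by
    intro k l hkl hl
    obtain ⟨e, rfl⟩ := Nat.exists_eq_add_of_lt hkl
    obtain ⟨r, rfl⟩ : e + 1 ∣ M := (Nat.dvd_factorial (by omega) (by omega)).trans hM
    refine ⟨c ^ k * ((∑ a ∈ Finset.range r, (w ^ (e + 1)) ^ a) * d), (hc.pow k).mul
      ((IsIntegral.sum _ fun a _ => (hw.pow _).pow _).mul hd), ?_⟩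
    calc _ = (w * c) ^ k * (((∑ a ∈ Finset.range r, (w ^ (e + 1)) ^ a) * (w ^ (e + 1) - 1)) * d) := by
            ring
      _ = 1 := by rw [geom_sum_mul, ← pow_mul, hwd, hwc, one_pow, one_mul]
  refine ⟨fun k => w ^ (k : ℕ), fun k => hw.pow _, fun k l hkl => ?_⟩
  rcases lt_or_gt_of_ne (fun h => hkl (Fin.ext h) : (k : ℕ) ≠ l) with h | h
  · obtain ⟨x, hx, hx'⟩ := key k l h l.2
    exact ⟨-x, hx.neg, by rw [← hx']; ring⟩
  · exact key l k h k.2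

theorem isIntegral_of_polynomial {f : Polynomial ℤ} (hf : f.Monic) {w : S}
    (h : Polynomial.aeval w f = 0) : IsIntegral ℤ w :=
  ⟨f, hf, h⟩

/-- The unit of the cover away from its section. -/
theorem hasIntegralUnits_of_one_add {w : S} {M r q : ℕ} (hM : n.factorial ∣ M) (hr : 1 ≤ r)
    (hq : 2 ≤ q) (hw : 1 + w ^ (r * q - 1) * (w ^ M - 1) ^ q = 0) : HasIntegralUnits n S := by
  rcases Nat.eq_zero_or_pos M with rfl | hM0
  · have : Subsingleton S := by
      rw [pow_zero, sub_self, zero_pow (by omega), mul_zero, add_zero] at hw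
      exact subsingleton_of_zero_eq_one hw.symm
    exact hasIntegralUnits_of_subsingleton
  have h2 : 2 ≤ r * q := hq.trans (Nat.le_mul_of_pos_left _ hr)
  have hwi : IsIntegral ℤ w := by
    refine isIntegral_of_polynomial (f := Polynomial.X ^ (r * q - 1) *
      (Polynomial.X ^ M - Polynomial.C 1) ^ q + Polynomial.C 1) ?_ ?_
    · refine Polynomial.Monic.add_of_left (((Polynomial.monic_X_pow _).mul
        ((Polynomial.monic_X_pow_sub_C _ hM0.ne').pow _))) ?_
      refine lt_of_le_of_lt Polynomial.degree_C_le ?_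
      rw [Polynomial.Monic.degree_mul ((Polynomial.monic_X_pow_sub_C _ hM0.ne').pow _),
        Polynomial.degree_X_pow, Polynomial.degree_eq_natDegree
          ((Polynomial.monic_X_pow_sub_C _ hM0.ne').pow _).ne_zero]
      norm_cast
      omega
    · simp only [map_add, map_mul, map_pow, map_sub, Polynomial.aeval_X, map_one]
      rw [← hw]; ring
  have h1 : IsIntegral ℤ (w ^ M - 1) := (hwi.pow _).sub isIntegral_one
  -- The equation says that w ^ (r q − 1) (w ^ M − 1) ^ q = −1; splitting off one factor w, or one
  -- factor w ^ M − 1, displays the two inverses.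
  refine hasIntegralUnits_of_unit (w := w) (c := -(w ^ (r * q - 2) * (w ^ M - 1) ^ q))
    (d := -(w ^ (r * q - 1) * (w ^ M - 1) ^ (q - 1))) hwi ((hwi.pow _).mul (h1.pow _)).neg
    ((hwi.pow _).mul (h1.pow _)).neg ?_ hM ?_
  · obtain ⟨s, hs⟩ := Nat.exists_eq_add_of_le h2
    rw [hs] at hw ⊢
    rw [show 2 + s - 1 = s + 1 by omega] at hw
    rw [show 2 + s - 2 = s by omega]
    linear_combination -hw
  · obtain ⟨s, hs⟩ := Nat.exists_eq_add_of_le hq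
    rw [show q - 1 = s + 1 by omega]
    nth_rw 2 [show q = s + 1 + 1 by omega] at hw
    rw [pow_succ (w ^ M - 1) (s + 1)] at hw
    linear_combination -hw

/-- The unit of the cover on the part where the equation has constant term `1`. -/
theorem hasIntegralUnits_of_sub_one {w : S} {M q : ℕ} (hM : n.factorial ∣ M) (hM0 : M ≠ 0)
    (hq : 2 ≤ q) (hq' : Even q) (hw : w + ((w ^ M - 1) * (w - 1)) ^ q = 0) :
    HasIntegralUnits n S := by
  have hwi : IsIntegral ℤ w := by
    refine isIntegral_of_polynomial (f := ((Polynomial.X ^ M - Polynomial.C 1) *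
      (Polynomial.X - Polynomial.C 1)) ^ q + Polynomial.X) ?_ ?_
    · have hmon := ((Polynomial.monic_X_pow_sub_C (1 : ℤ) hM0).mul
        (Polynomial.monic_X_sub_C (1 : ℤ)))
      refine Polynomial.Monic.add_of_left (hmon.pow q) ?_
      rw [Polynomial.degree_X, Polynomial.degree_eq_natDegree (hmon.pow q).ne_zero,
        hmon.natDegree_pow, Polynomial.Monic.natDegree_mul
          (Polynomial.monic_X_pow_sub_C (1 : ℤ) hM0) (Polynomial.monic_X_sub_C (1 : ℤ)),
        Polynomial.natDegree_X_pow_sub_C, Polynomial.natDegree_X_sub_C]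
      norm_cast
      nlinarith [Nat.pos_of_ne_zero hM0]
    · simp only [map_add, map_mul, map_pow, map_sub, Polynomial.aeval_X, map_one]
      rw [← hw]; ring
  obtain ⟨c, hci, hc⟩ : ∃ c, IsIntegral ℤ c ∧ w * c = 1 := by
    -- The q-th power has constant term 1, so it is 1 + w f(w) and the equation makes −1 − f(w) an
    -- inverse of w.
    have hdvd : (Polynomial.X : Polynomial ℤ) ∣ ((Polynomial.X ^ M - 1) * (Polynomial.X - 1)) ^ q - 1 := by
      rw [Polynomial.X_dvd_iff, Polynomial.coeff_zero_eq_eval_zero]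
      simp [hM0]
    obtain ⟨f, hf⟩ := hdvd
    have hf' := congr_arg (Polynomial.aeval w) hf
    simp only [map_mul, map_pow, map_sub, Polynomial.aeval_X, map_one] at hf'
    refine ⟨-1 - Polynomial.aeval w f, (isIntegral_one.neg).sub ?_, by linear_combination hf' - hw⟩
    exact IsIntegral.of_mem_of_fg _ hwi.fg_adjoin_singleton _ (Polynomial.aeval_mem_adjoin_singleton ℤ w)
  have h1 : IsIntegral ℤ (w ^ M - 1) := (hwi.pow _).sub isIntegral_one
  refine hasIntegralUnits_of_unit (w := w) (c := c)
    (d := -((w ^ M - 1) ^ (q - 1) * (w - 1) ^ q * c)) hwi hci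
    (((h1.pow _).mul ((hwi.sub isIntegral_one).pow _)).mul hci).neg hc hM ?_
  obtain ⟨s, rfl⟩ := Nat.exists_eq_add_of_le hq
  rw [show 2 + s - 1 = s + 1 by omega]
  rw [mul_pow, show 2 + s = s + 1 + 1 by omega, pow_succ (w ^ M - 1) (s + 1)] at hw
  rw [show 2 + s = s + 1 + 1 by omega]
  linear_combination -c * hw + hc

/-- The equation factors as t times a factor congruent to 1 modulo t. The ring thus splits into the
locus t = 0, covered by hypothesis, and a locus where t is a suitable unit. -/
theorem hasIntegralUnits_of_equation {t : S} {M r q : ℕ} (hM : n.factorial ∣ M) (hr : 1 ≤ r)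
    (hq : 2 ≤ q) (ht : t + ((t ^ M - 1) * t ^ r) ^ q = 0)
    (h : HasIntegralUnits n (S ⧸ Ideal.span {t})) : HasIntegralUnits n S := by
  have h2 : 2 ≤ r * q := hq.trans (Nat.le_mul_of_pos_left _ hr)
  have ht' : t * (1 + t ^ (r * q - 1) * (t ^ M - 1) ^ q) = 0 := by
    rw [mul_pow, ← pow_mul, show r * q = r * q - 1 + 1 by omega] at ht
    linear_combination ht
  refine HasIntegralUnits.of_mul_eq_zero ht' ⟨-(t ^ (r * q - 2) * (t ^ M - 1) ^ q), 1, ?_⟩ h ?_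
  · obtain ⟨s, hs⟩ := Nat.exists_eq_add_of_le h2
    rw [hs, show 2 + s - 1 = s + 1 by omega, show 2 + s - 2 = s by omega]
    ring
  · have h0 := Ideal.Quotient.eq_zero_iff_mem.2
      (Ideal.mem_span_singleton_self (1 + t ^ (r * q - 1) * (t ^ M - 1) ^ q))
    simp only [map_add, map_mul, map_pow, map_sub, map_one] at h0
    exact hasIntegralUnits_of_one_add hM hr hq h0

/-- The complement of the section in the composite of the two covers. -/
theorem hasIntegralUnits_of_tower {e t₁ t₂ x : S} {M M' r q : ℕ} (hM : n.factorial ∣ M)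
    (hM0 : M ≠ 0) (hM' : n.factorial ∣ M') (hr : 1 ≤ r) (hq : 2 ≤ q) (hq' : Even q)
    (he : e * (1 - e) = 0) (h₁ : t₁ + ((t₁ ^ M - 1) * (t₁ - e)) ^ q = 0)
    (h₂ : t₂ + ((t₂ ^ M' - 1) * (t₂ ^ r + x)) ^ q = 0) (hx : x ∈ Ideal.span {e, t₁})
    (htop : Ideal.span {e, t₁, t₂} = ⊤) : HasIntegralUnits n S := by
  -- Split by the idempotent. Where e = 0, the first equation has the form above with r = 1. Where
  -- also t₁ = 0, x vanishes and the second equation takes that form; where t₂ = 0 too, nothing is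
  -- left. Where e = 1, the first equation alone makes t₁ a suitable unit.
  refine HasIntegralUnits.of_mul_eq_zero he ⟨1, 1, by ring⟩ ?_ ?_
  · have he0 : Ideal.Quotient.mk (Ideal.span {e}) e = 0 :=
      Ideal.Quotient.eq_zero_iff_mem.2 (Ideal.mem_span_singleton_self _)
    generalize Ideal.Quotient.mk (Ideal.span {e}) = f at he0
    have h₁' := congr_arg f h₁
    simp only [map_add, map_mul, map_pow, map_sub, map_one, he0, sub_zero, map_zero] at h₁'
    refine hasIntegralUnits_of_equation (r := 1) hM le_rfl hq (by rwa [pow_one]) ?_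
    have ht0 : Ideal.Quotient.mk (Ideal.span {f t₁}) (f t₁) = 0 :=
      Ideal.Quotient.eq_zero_iff_mem.2 (Ideal.mem_span_singleton_self _)
    have he1 : Ideal.Quotient.mk (Ideal.span {f t₁}) (f e) = 0 := by rw [he0, map_zero]
    obtain ⟨g, hg⟩ : ∃ g, g = (Ideal.Quotient.mk (Ideal.span {f t₁})).comp f := ⟨_, rfl⟩
    have hge : g e = 0 := by rw [hg]; exact he1
    have hgt : g t₁ = 0 := by rw [hg]; exact ht0
    have hgx : g x = 0 := by
      have : Ideal.span {e, t₁} ≤ RingHom.ker g := by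
        rw [Ideal.span_le]
        rintro _ (rfl | rfl)
        exacts [hge, hgt]
      exact this hx
    have h₂' := congr_arg g h₂
    simp only [map_add, map_mul, map_pow, map_sub, map_one, hgx, add_zero, map_zero] at h₂'
    refine hasIntegralUnits_of_equation hM' hr hq h₂' ?_
    have h3 : Subsingleton (_ ⧸ Ideal.span {g t₂}) := by
      rw [Ideal.Quotient.subsingleton_iff, Ideal.eq_top_iff_one]
      have : Ideal.span {e, t₁, t₂} ≤ (Ideal.span {g t₂}).comap g := by
        rw [Ideal.span_le]
        rintro _ (rfl | rfl | rfl)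
        · rw [SetLike.mem_coe, Ideal.mem_comap, hge]; exact zero_mem _
        · rw [SetLike.mem_coe, Ideal.mem_comap, hgt]; exact zero_mem _
        · exact Ideal.mem_span_singleton_self _
      have h1 : (1 : S) ∈ (Ideal.span {g t₂}).comap g := this (htop ▸ trivial)
      rwa [Ideal.mem_comap, map_one] at h1
    exact hasIntegralUnits_of_subsingleton
  · have he0 : Ideal.Quotient.mk (Ideal.span {1 - e}) (1 - e) = 0 :=
      Ideal.Quotient.eq_zero_iff_mem.2 (Ideal.mem_span_singleton_self _)
    rw [map_sub, map_one, sub_eq_zero] at he0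
    have h₁' := congr_arg (Ideal.Quotient.mk (Ideal.span {1 - e})) h₁
    simp only [map_add, map_mul, map_pow, map_sub, map_one, ← he0, map_zero] at h₁'
    exact hasIntegralUnits_of_sub_one hM hM0 hq hq' h₁'

end IntegralUnits

/-! ### Integral units provide disjoint copies over a finite ℤ-algebra -/

section Copies

/-- A scheme whose functions contain `m` integral units has a morphism to the spectrum of a finite
`ℤ`-algebra over which affine space has `m` disjoint sections. -/
theorem exists_isDisjointCopies {T : Scheme.{u}} {d m : ℕ} (hd : 0 < d)
    (h : HasIntegralUnits m Γ(T, ⊤)) :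
    ∃ (B : Type u) (_ : CommRing B), Module.Finite ℤ B ∧
      Nonempty (T ⟶ Spec (CommRingCat.of B)) ∧
      ∃ s : Fin m → (Spec (CommRingCat.of B) ⟶
        𝔸(ULift.{u} (Fin d); Spec (CommRingCat.of B))), IsDisjointCopies s := by
  classical
  obtain ⟨b, hb, hc⟩ := h
  choose c hci hc using fun x : {x : Fin m × Fin m // x.1 ≠ x.2} => hc x.1.1 x.1.2 x.2
  let G : Set Γ(T, ⊤) := Set.range b ∪ Set.range c
  -- Integrality makes B finite over ℤ; the inverses are adjoined so that the differences are
  -- already units in B.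
  let B := Algebra.adjoin ℤ G
  have hG : ∀ x ∈ G, IsIntegral ℤ x := by
    rintro _ (⟨k, rfl⟩ | ⟨k, rfl⟩)
    exacts [hb k, hci k]
  have hfg : (Subalgebra.toSubmodule B).FG :=
    fg_adjoin_of_finite ((Set.finite_range b).union (Set.finite_range c)) hG
  have hfin : Module.Finite ℤ B := Module.Finite.iff_fg.2 hfg
  let β : Fin m → B := fun k => ⟨b k, Algebra.subset_adjoin (Or.inl ⟨k, rfl⟩)⟩
  have hβ : ∀ k l, k ≠ l → IsUnit (β k - β l) := fun k l hkl =>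
    IsUnit.of_mul_eq_one ⟨c ⟨(k, l), hkl⟩, Algebra.subset_adjoin (Or.inr ⟨_, rfl⟩)⟩
      (Subtype.ext (hc ⟨(k, l), hkl⟩))
  let R := Spec (CommRingCat.of B)
  let γ : Fin m → Γ(R, ⊤) := fun k => (Scheme.ΓSpecIso (CommRingCat.of B)).inv (β k)
  have hγ : ∀ k l, k ≠ l → IsUnit (γ k - γ l) := fun k l hkl => by
    have := (hβ k l hkl).map (Scheme.ΓSpecIso (CommRingCat.of B)).inv.hom
    rwa [map_sub] at this
  let o : ULift.{u} (Fin d) := ⟨0, hd⟩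
  let s : Fin m → (R ⟶ 𝔸(ULift.{u} (Fin d); R)) := fun k =>
    AffineSpace.homOfVector (𝟙 R) fun l => if l = o then γ k else 0
  have hs : ∀ k, s k ≫ (𝔸(ULift.{u} (Fin d); R) ↘ R) = 𝟙 R := fun k =>
    AffineSpace.homOfVector_over _ _
  have hsc : ∀ k, (s k).appTop (AffineSpace.coord R o) = γ k := fun k => by
    rw [AffineSpace.homOfVector_appTop_coord, if_pos rfl]
  refine ⟨B, inferInstance, hfin, ⟨T.toSpecΓ ≫ Spec.map (CommRingCat.ofHom B.val.toRingHom)⟩, s, hs,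
    fun k l hkl => Set.disjoint_left.2 ?_⟩
  rintro _ ⟨x, rfl⟩ ⟨y, hy⟩
  -- The k-th section has first coordinate γ k and all others 0. This function vanishes on it and
  -- restricts to a unit on the l-th section.
  let f : Γ(𝔸(ULift.{u} (Fin d); R), ⊤) :=
    AffineSpace.coord R o - (𝔸(ULift.{u} (Fin d); R) ↘ R).appTop (γ k)
  have hf : ∀ l, (s l).appTop f = γ l - γ k := by
    intro l
    have h1 : (𝔸(ULift.{u} (Fin d); R) ↘ R).appTop ≫ (s l).appTop = 𝟙 _ := by
      rw [← Scheme.Hom.comp_appTop, hs, Scheme.Hom.id_appTop]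
    have h2 := ConcreteCategory.congr_hom h1 (γ k)
    rw [map_sub, hsc]
    congr 1
  have hx : s k ⁻¹ᵁ (𝔸(ULift.{u} (Fin d); R)).basicOpen f = ⊥ := by
    rw [Scheme.preimage_basicOpen_top, hf, sub_self, Scheme.basicOpen_zero]
  have hy' : s l ⁻¹ᵁ (𝔸(ULift.{u} (Fin d); R)).basicOpen f = ⊤ := by
    rw [Scheme.preimage_basicOpen_top, hf, Scheme.basicOpen_of_isUnit _ (hγ l k (Ne.symm hkl))]
  have h1 : s l y ∈ (𝔸(ULift.{u} (Fin d); R)).basicOpen f := by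
    have : y ∈ s l ⁻¹ᵁ (𝔸(ULift.{u} (Fin d); R)).basicOpen f := hy' ▸ trivial
    exact this
  rw [hy] at h1
  have : x ∈ s k ⁻¹ᵁ (𝔸(ULift.{u} (Fin d); R)).basicOpen f := h1
  rw [hx] at this
  exact this

end Copies

/-- Keeps the number of generators under base change, so bounds fixed over A serve for every T. -/
theorem span_range_of_isPushout {R S R' S' : CommRingCat.{u}} {f : R ⟶ S} {g : R ⟶ R'}
    {f' : S ⟶ S'} {g' : R' ⟶ S'} (h : IsPushout f g f' g') {N : ℕ} (e : Fin N → S)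
    (he : letI := f.hom.toAlgebra
      Submodule.span R (Set.range e) = ⊤) :
    letI := g'.hom.toAlgebra
    Submodule.span R' (Set.range fun k => f' (e k)) = ⊤ := by
  let _ : Algebra R S := f.hom.toAlgebra
  let _ : Algebra R R' := g.hom.toAlgebra
  let _ : Algebra S S' := f'.hom.toAlgebra
  let _ : Algebra R' S' := g'.hom.toAlgebra
  let _ : Algebra R S' := (f ≫ f').hom.toAlgebra
  have : IsScalarTower R S S' := .of_algebraMap_eq' rfl
  have : IsScalarTower R R' S' := .of_algebraMap_eq' (congr_arg CommRingCat.Hom.hom h.w)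
  have hp : Algebra.IsPushout R R' S S' := CommRingCat.isPushout_iff_isPushout.1 h.flip
  rw [eq_top_iff]
  intro x _
  refine hp.out.inductionOn x _ (zero_mem _) (fun s => ?_) (fun r y hy => Submodule.smul_mem _ r hy)
    (fun y y' hy hy' => add_mem hy hy')
  have hs : s ∈ Submodule.span R (Set.range e) := he ▸ trivial
  induction hs using Submodule.span_induction with
  | mem s hs =>
    obtain ⟨k, rfl⟩ := hs
    exact Submodule.subset_span ⟨k, rfl⟩
  | zero => rw [map_zero]; exact zero_mem _
  | add s s' _ _ hs hs' => rw [map_add]; exact add_mem hs hs'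
  | smul r s _ hs =>
    rw [LinearMap.map_smul, ← algebraMap_smul R' r]
    exact Submodule.smul_mem _ _ hs

/-! ### Counting sections of Y and producing one more -/

section LargeUnits

variable {A : Type u} [CommRing A] {d : ℕ} {C : Scheme.{u}} {p : C ⟶ Spec (CommRingCat.of A)}
  {hp : SmoothOfRelativeDimension d p} {hC : IsAffine C} {F : (Punctured A d)ᵒᵖ ⥤ Pointed.{v}}
  {U V : Punctured A d} {j : U ⟶ Punctured.ofAffine p hC hp} {k : V ⟶ U} {a : F.obj (op U)}
  {Y Z : Scheme.{u}} {i : Y ⟶ C} {z : Z ⟶ C}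

/-- Good sections of affine space exist over the finite étale `Y`-schemes allowed in the extension
hypothesis, where `y` is the structure morphism of `Y`. -/
def HasGoodSections (F : (Punctured A d)ᵒᵖ ⥤ Pointed.{v}) {Y : Scheme.{u}}
    (y : Y ⟶ Spec (CommRingCat.of A)) [IsFinite y] [Etale y] : Prop :=
  ∀ (T : Scheme.{u}) (q : T ⟶ Y) [IsFinite q] [Etale q] (m : ℕ),
    (∀ t : T, m ≤ y.finrank ((q ≫ y) t)) →
    (∃ (B : Type u) (_ : CommRing B), Module.Finite ℤ B ∧
      Nonempty (T ⟶ Spec (CommRingCat.of B)) ∧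
      ∃ s : Fin m → (Spec (CommRingCat.of B) ⟶
        𝔸(ULift.{u} (Fin d); Spec (CommRingCat.of B))), IsDisjointCopies s) →
    ∃ s : Fin m → (T ⟶ 𝔸(ULift.{u} (Fin d); T)), IsGoodSections F (q ≫ y) s

theorem HasGoodSections.exists_isGoodSections {y : Y ⟶ Spec (CommRingCat.of A)} [IsFinite y]
    [Etale y] (hA : HasGoodSections F y) (hd : 0 < d) {T : Scheme.{u}}
    (t : T ⟶ Spec (CommRingCat.of A)) [IsFinite t] [Etale t] (q : T ⟶ Y) (hq : q ≫ y = t) {m : ℕ}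
    (hm : ∀ τ : T, m ≤ y.finrank (t τ)) (h : HasIntegralUnits m Γ(T, ⊤)) :
    ∃ s : Fin m → (T ⟶ 𝔸(ULift.{u} (Fin d); T)), IsGoodSections F t s := by
  subst hq
  have : IsFinite q := IsFinite.of_comp q y
  have : Etale q := Etale.of_comp q y
  exact hA T q m hm (exists_isDisjointCopies hd h)

/-- Over the residue field at τ, disjoint sections become distinct points of Y over one point of
Spec A. This verifies the degree condition in the hypothesis on F. -/
theorem le_finrank_of_disjoint [Mono i] [IsFinite (i ≫ p)] [Flat (i ≫ p)] {T : Scheme.{u}}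
    (t : T ⟶ Spec (CommRingCat.of A)) {m : ℕ} (y : Fin m → (T ⟶ Y))
    (σ : Fin m → (T ⟶ pullback p t)) (hσ : ∀ l, σ l ≫ pullback.fst p t = y l ≫ i)
    (hσ' : ∀ l, σ l ≫ pullback.snd p t = 𝟙 T)
    (hdisj : Pairwise fun l l' => Disjoint (Set.range (σ l)) (Set.range (σ l'))) (τ : T) :
    m ≤ (i ≫ p).finrank (t τ) := by
  have hy : ∀ l, y l ≫ i ≫ p = t := fun l => by
    rw [← Category.assoc, ← hσ, Category.assoc, pullback.condition, reassoc_of% hσ']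
  let o : Spec (CommRingCat.of (T.residueField τ)) ⟶ T := T.fromSpecResidueField τ
  let w : Spec (CommRingCat.of (T.residueField τ)) :=
    (inferInstance : Nonempty (PrimeSpectrum (T.residueField τ))).some
  have := card_le_finrank (i ≫ p) (o ≫ t) (fun l => o ≫ y l)
    (fun l => by rw [Category.assoc, hy]) (injective_comp_of_disjoint i p t y σ hσ hσ' hdisj o) w
  rwa [Scheme.Hom.comp_apply, show o w = τ from Scheme.fromSpecResidueField_apply τ w] at this

/-- A bound independent of T, which stops the induction on the number of sections. -/
theorem le_of_disjoint [Mono i] [IsAffine Y] {T : Scheme.{u}} [Nonempty T] {N : ℕ}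
    (e : Fin N → Γ(Y, ⊤))
    (he : letI := (i ≫ p).appTop.hom.toAlgebra
      Submodule.span Γ(Spec (CommRingCat.of A), ⊤) (Set.range e) = ⊤)
    (t : T ⟶ Spec (CommRingCat.of A)) {m : ℕ} (y : Fin m → (T ⟶ Y))
    (σ : Fin m → (T ⟶ pullback p t)) (hσ : ∀ l, σ l ≫ pullback.fst p t = y l ≫ i)
    (hσ' : ∀ l, σ l ≫ pullback.snd p t = 𝟙 T)
    (hdisj : Pairwise fun l l' => Disjoint (Set.range (σ l)) (Set.range (σ l'))) :
    m ≤ N := by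
  have hy : ∀ l, y l ≫ i ≫ p = t := fun l => by
    rw [← Category.assoc, ← hσ, Category.assoc, pullback.condition, reassoc_of% hσ']
  let τ : T := (inferInstance : Nonempty T).some
  let o : Spec (CommRingCat.of (T.residueField τ)) ⟶ T := T.fromSpecResidueField τ
  exact card_le_of_span (i ≫ p) e he (o ≫ t) (fun l => o ≫ y l)
    (fun l => by rw [Category.assoc, hy]) (injective_comp_of_disjoint i p t y σ hσ hσ' hdisj o)

/-- The complement of the sections in the preimage of `Y` carries one section more. -/
theorem exists_additional_section [IsClosedImmersion i] [IsFinite (i ≫ p)] [Etale (i ≫ p)]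
    {T : Scheme.{u}} (t : T ⟶ Spec (CommRingCat.of A)) [IsFinite t] [Etale t] {m : ℕ}
    (ρ : Fin m → (T ⟶ pullback i (pullback.fst p t)))
    (hρ : ∀ l, ρ l ≫ pullback.snd i (pullback.fst p t) ≫ pullback.snd p t = 𝟙 T)
    (hdisj : Pairwise fun l l' => Disjoint (Set.range (ρ l ≫ pullback.snd i (pullback.fst p t)))
      (Set.range (ρ l' ≫ pullback.snd i (pullback.fst p t)))) :
    ∃ (T' : Scheme.{u}) (o : T' ⟶ pullback i (pullback.fst p t)) (y : Fin (m + 1) → (T' ⟶ Y))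
      (σ : Fin (m + 1) → (T' ⟶ pullback p (o ≫ pullback.snd i (pullback.fst p t) ≫
        pullback.fst p t ≫ p))), IsOpenImmersion o ∧ IsClosedImmersion o ∧
      Set.range o = (⋃ l, Set.range (ρ l))ᶜ ∧
      (∀ l, σ l ≫ pullback.fst p _ = y l ≫ i) ∧ (∀ l, σ l ≫ pullback.snd p _ = 𝟙 T') ∧
      Pairwise fun l l' => Disjoint (Set.range (σ l)) (Set.range (σ l')) := by
  have hfin : IsFinite (pullback.snd i (pullback.fst p t) ≫ pullback.fst p t ≫ p) := by
    rw [← reassoc_of% (pullback.condition (f := i) (g := pullback.fst p t))]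
    infer_instance
  have het : Etale (pullback.snd i (pullback.fst p t) ≫ pullback.fst p t ≫ p) :=
    etale_pullback_snd _
  have hO : IsClopen (⋃ l, Set.range (ρ l)) := by
    refine isClopen_iUnion_of_finite fun l => ?_
    have : Mono (ρ l ≫ pullback.snd i (pullback.fst p t) ≫ pullback.snd p t) := by
      rw [hρ]; infer_instance
    have : Mono (ρ l) := mono_of_mono (ρ l) (pullback.snd i (pullback.fst p t) ≫ pullback.snd p t)
    have h1 : ρ l ≫ pullback.snd i (pullback.fst p t) ≫ pullback.fst p t ≫ p = t := by
      rw [pullback.condition, reassoc_of% hρ]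
    exact isClopen_range_of_mono (ρ l) _ (by rwa [h1]) (by rwa [h1])
  let Q : (pullback i (pullback.fst p t)).Opens := ⟨(⋃ l, Set.range (ρ l))ᶜ, hO.compl.isOpen⟩
  have hQ : Set.range Q.ι = (⋃ l, Set.range (ρ l))ᶜ := Q.range_ι
  have hcl : IsClosedImmersion Q.ι := isClosedImmersion_of_isClosed Q hO.compl.isClosed
  let t' := Q.ι ≫ pullback.snd i (pullback.fst p t) ≫ pullback.fst p t ≫ p
  obtain ⟨r, hr0⟩ : ∃ r : (Q : Scheme.{u}) ⟶ T,
    r = Q.ι ≫ pullback.snd i (pullback.fst p t) ≫ pullback.snd p t := ⟨_, rfl⟩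
  have hr : r ≫ t = t' := by simp only [hr0, t', Category.assoc, pullback.condition]
  let π : pullback p t' ⟶ pullback p t := pullback.lift (pullback.fst _ _) (pullback.snd _ _ ≫ r)
    (by rw [Category.assoc, hr, pullback.condition])
  -- Index 0 is the tautological Y-point of the complement Q; the other points are the old ones
  -- pulled back to Q.
  let y : Fin (m + 1) → ((Q : Scheme.{u}) ⟶ Y) :=
    Fin.cases (Q.ι ≫ pullback.fst _ _) fun l => r ≫ ρ l ≫ pullback.fst _ _
  have hy : ∀ l, y l ≫ i ≫ p = t' := by
    intro l
    refine Fin.cases ?_ (fun l => ?_) l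
    · change (Q.ι ≫ pullback.fst _ _) ≫ i ≫ p = _
      rw [Category.assoc, reassoc_of% (pullback.condition (f := i) (g := pullback.fst p t))]
    · change (r ≫ ρ l ≫ pullback.fst _ _) ≫ i ≫ p = _
      rw [Category.assoc, Category.assoc,
        reassoc_of% (pullback.condition (f := i) (g := pullback.fst p t)), pullback.condition,
        reassoc_of% hρ l, hr]
  let σ : Fin (m + 1) → ((Q : Scheme.{u}) ⟶ pullback p t') := fun l =>
    pullback.lift (y l ≫ i) (𝟙 _) (by rw [Category.assoc, hy, Category.id_comp])
  have hσ₁ : ∀ l, σ l ≫ pullback.fst p t' = y l ≫ i := fun l => pullback.lift_fst _ _ _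
  have hσ₂ : ∀ l, σ l ≫ pullback.snd p t' = 𝟙 _ := fun l => pullback.lift_snd _ _ _
  have hπ₁ : π ≫ pullback.fst p t = pullback.fst p t' := pullback.lift_fst _ _ _
  have hπ₂ : π ≫ pullback.snd p t = pullback.snd p t' ≫ r := pullback.lift_snd _ _ _
  -- Disjointness is tested after projecting to C ×_A T, where the new section becomes Q itself,
  -- which misses the old sections.
  have h0 : σ 0 ≫ π = Q.ι ≫ pullback.snd i (pullback.fst p t) := by
    apply pullback.hom_ext
    · rw [Category.assoc, hπ₁, hσ₁, Category.assoc, ← pullback.condition]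
      exact Category.assoc _ _ _
    · rw [Category.assoc, hπ₂, reassoc_of% hσ₂ 0, hr0, Category.assoc]
  have hs : ∀ l : Fin m, σ l.succ ≫ π = r ≫ ρ l ≫ pullback.snd i (pullback.fst p t) := by
    intro l
    apply pullback.hom_ext
    · rw [Category.assoc, hπ₁, hσ₁, Category.assoc, Category.assoc, ← pullback.condition]
      simp only [y, Fin.cases_succ, Category.assoc]
    · rw [Category.assoc, hπ₂, reassoc_of% hσ₂ l.succ, Category.assoc, Category.assoc, hρ,
        Category.comp_id]
  have hred : ∀ l l', Disjoint (Set.range (σ l ≫ π)) (Set.range (σ l' ≫ π)) →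
      Disjoint (Set.range (σ l)) (Set.range (σ l')) := by
    intro l l' h
    rw [Set.disjoint_left] at h ⊢
    rintro _ ⟨w, rfl⟩ ⟨w', hw'⟩
    exact h ⟨w, rfl⟩ ⟨w', by rw [Scheme.Hom.comp_apply, hw', Scheme.Hom.comp_apply]⟩
  have h0s : ∀ l : Fin m, Disjoint (Set.range (σ 0)) (Set.range (σ l.succ)) := by
    intro l
    refine hred _ _ ?_
    rw [h0, hs, Set.disjoint_left]
    rintro _ ⟨w, rfl⟩ ⟨w', hw'⟩
    rw [← Category.assoc, Scheme.Hom.comp_apply, Scheme.Hom.comp_apply] at hw'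
    have h1 := (pullback.snd i (pullback.fst p t)).isClosedEmbedding.injective hw'
    have h2 : Q.ι w ∈ (⋃ l, Set.range (ρ l))ᶜ := hQ ▸ ⟨w, rfl⟩
    exact h2 (Set.mem_iUnion.2 ⟨l, r w', h1⟩)
  refine ⟨Q, Q.ι, y, σ, inferInstance, hcl, hQ, hσ₁, hσ₂, fun l l' => ?_⟩
  refine Fin.cases (Fin.cases (fun h => absurd rfl h) (fun l' _ => h0s l') l') (fun l => ?_) l
  refine Fin.cases (fun _ => (h0s l).symm) (fun l' hl => ?_) l'
  refine hred _ _ ?_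
  rw [hs, hs]
  have hne : l ≠ l' := fun h => hl (congr_arg _ h)
  refine (hdisj hne).mono ?_ ?_
  all_goals
    rintro _ ⟨w, rfl⟩
    exact ⟨r w, by rw [Scheme.Hom.comp_apply r]⟩

end LargeUnits

/-! ### Induction on the number of disjoint sections -/

section LargeUnits

variable {A : Type u} [CommRing A] {d : ℕ} {C : Scheme.{u}} {p : C ⟶ Spec (CommRingCat.of A)}
  {hp : SmoothOfRelativeDimension d p} {hC : IsAffine C} {F : (Punctured A d)ᵒᵖ ⥤ Pointed.{v}}
  {U V : Punctured A d} {j : U ⟶ Punctured.ofAffine p hC hp} {k : V ⟶ U} {a : F.obj (op U)}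
  {Y Z : Scheme.{u}} {i : Y ⟶ C} {z : Z ⟶ C}

theorem span_pullback_appTop [IsFinite (z ≫ p)] {T : Scheme.{u}}
    (t : T ⟶ Spec (CommRingCat.of A)) [IsAffine T] {N : ℕ} (e : Fin N → Γ(Z, ⊤))
    (he : letI := (z ≫ p).appTop.hom.toAlgebra
      Submodule.span Γ(Spec (CommRingCat.of A), ⊤) (Set.range e) = ⊤) :
    letI := (pullback.snd z (pullback.fst p t) ≫ pullback.snd p t).appTop.hom.toAlgebra
    Submodule.span Γ(T, ⊤)
      (Set.range fun l => (pullback.fst z (pullback.fst p t)).appTop (e l)) = ⊤ := by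
  have : IsAffine Z := isAffine_of_isAffineHom (z ≫ p)
  have sq := (IsPullback.of_hasPullback z (pullback.fst p t)).flip.paste_horiz
    (IsPullback.of_hasPullback p t).flip
  exact span_range_of_isPushout (isPushout_appTop_of_isPullback sq.flip) e he

/-- Elements extend over `C ×_A T` if the functions on `T` contain sufficiently many integral units
and there are disjoint sections of `Y` over `T`. -/
theorem ExtendsOff.of_hasIntegralUnits [Finite (MaximalSpectrum A)] [IsClosedImmersion i]
    [IsClosedImmersion z] [IsFinite (i ≫ p)] [Etale (i ≫ p)] [IsFinite (z ≫ p)] (hd : 0 < d)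
    (hF : IsExcisive F) (hj : IsComplement j (Set.range i))
    (hk : IsComplement (k ≫ j) (Set.range z))
    (ha : (F.map k.op).toFun a = (F.obj (op V)).point) {ℓ : Y ⟶ Z} (hℓ : ℓ ≫ z = i)
    (hA : HasGoodSections F (i ≫ p)) {N N' n : ℕ} (e : Fin N → Γ(Z, ⊤))
    (he : letI := (z ≫ p).appTop.hom.toAlgebra
      Submodule.span Γ(Spec (CommRingCat.of A), ⊤) (Set.range e) = ⊤) (e' : Fin N' → Γ(Y, ⊤))
    (he' : letI := (i ≫ p).appTop.hom.toAlgebra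
      Submodule.span Γ(Spec (CommRingCat.of A), ⊤) (Set.range e') = ⊤)
    (hn : N + N * N < n) (hn' : N' ≤ n) (r : ℕ) : ∀ {T : Scheme.{u}}
    (t : T ⟶ Spec (CommRingCat.of A)) [IsFinite t] [Etale t] [IsAffine (pullback p t)] {m : ℕ}
    (_ : N' + 1 ≤ m + 1 + r)
    (y : Fin (m + 1) → (T ⟶ Y)) (σ : Fin (m + 1) → (T ⟶ pullback p t))
    (_ : ∀ l, σ l ≫ pullback.fst p t = y l ≫ i) (_ : ∀ l, σ l ≫ pullback.snd p t = 𝟙 T)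
    (_ : Pairwise fun l l' => Disjoint (Set.range (σ l)) (Set.range (σ l')))
    (_ : HasIntegralUnits n Γ(T, ⊤)),
    ExtendsOff p hp hC F j a (pullback.fst p t) ∅ := by
  have hYaff : IsAffine Y := isAffine_of_isAffineHom (i ≫ p)
  have hempty : ∀ {T : Scheme.{u}} (t : T ⟶ Spec (CommRingCat.of A)) [IsFinite t] [Etale t]
      [IsAffine (pullback p t)], IsEmpty T → ExtendsOff p hp hC F j a (pullback.fst p t) ∅ := by
    intro T t _ _ _ hT
    have hE : IsEmpty (pullback p t : Scheme.{u}) := ⟨fun w => hT.false (pullback.snd p t w)⟩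
    exact ExtendsOff.of_preimage hj (fun w _ => (hE.false w).elim) (isFiniteEtaleSubset_empty _)
  -- r bounds how many further sections are possible: at r = 0 there would be more than N' disjoint
  -- sections, so T is empty.
  induction r with
  | zero =>
    intro T t _ _ _ m hm y σ hσ hσ' hdisj _
    refine hempty t ?_
    by_contra hT
    rw [not_isEmpty_iff] at hT
    have := le_of_disjoint e' he' t y σ hσ hσ' hdisj
    omega
  | succ r ih =>
    intro T t _ _ _ m hm y σ hσ hσ' hdisj hunits
    rcases isEmpty_or_nonempty T with hT | hT
    · exact hempty t hT
    have hmN := le_of_disjoint e' he' t y σ hσ hσ' hdisj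
    have hTaff : IsAffine T := isAffine_of_isAffineHom t
    have hy : ∀ l, y l ≫ i ≫ p = t := fun l => by
      rw [← Category.assoc, ← hσ, Category.assoc, pullback.condition, reassoc_of% hσ']
    let ρ : Fin (m + 1) → (T ⟶ pullback i (pullback.fst p t)) := fun l =>
      pullback.lift (y l) (σ l) (hσ l).symm
    have hρσ : ∀ l, ρ l ≫ pullback.snd i (pullback.fst p t) = σ l := fun l => pullback.lift_snd _ _ _
    have hρ : ∀ l, ρ l ≫ pullback.snd i (pullback.fst p t) ≫ pullback.snd p t = 𝟙 T := fun l => by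
      rw [← Category.assoc, hρσ, hσ']
    have hdisj' : Pairwise fun l l' => Disjoint
        (Set.range (ρ l ≫ pullback.snd i (pullback.fst p t)))
        (Set.range (ρ l' ≫ pullback.snd i (pullback.fst p t))) := by
      simpa only [hρσ] using hdisj
    obtain ⟨T', o, y', σ', _, _, ho, hσ₁, hσ₂, hdisj₂⟩ := exists_additional_section t ρ hρ hdisj'
    have hfin : IsFinite (pullback.snd i (pullback.fst p t) ≫ pullback.fst p t ≫ p) := by
      rw [← reassoc_of% (pullback.condition (f := i) (g := pullback.fst p t))]
      infer_instance
    have hfinZ : IsFinite (pullback.snd z (pullback.fst p t) ≫ pullback.fst p t ≫ p) := by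
      rw [← reassoc_of% (pullback.condition (f := z) (g := pullback.fst p t))]
      infer_instance
    have het : Etale (pullback.snd i (pullback.fst p t) ≫ pullback.fst p t ≫ p) :=
      etale_pullback_snd _
    have hT'fin : IsFinite (o ≫ pullback.snd i (pullback.fst p t) ≫ pullback.fst p t ≫ p) :=
      inferInstance
    have hT'et : Etale (o ≫ pullback.snd i (pullback.fst p t) ≫ pullback.fst p t ≫ p) :=
      inferInstance
    have hT'aff : IsAffine T' :=
      isAffine_of_isAffineHom (o ≫ pullback.snd i (pullback.fst p t) ≫ pullback.fst p t ≫ p)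
    -- T' is the complement of the sections in Y_T. It carries one section more and inherits the
    -- integral units, so the element extends over C ×_A T', and then by excision off the sections
    -- over T.
    have h1 : ExtendsOff p hp hC F j a (pullback.fst p
        (o ≫ pullback.snd i (pullback.fst p t) ≫ pullback.fst p t ≫ p)) ∅ :=
      ih _ (by omega) y' σ' hσ₁ hσ₂ hdisj₂
        (hunits.map (o ≫ pullback.snd i (pullback.fst p t) ≫ pullback.snd p t).appTop.hom)
    have h2 := ExtendsOff.of_baseChange hF hj hfin _ o rfl h1
    rw [ho, compl_compl, Set.image_iUnion] at h2
    have h3 : ∀ l, pullback.snd i (pullback.fst p t) '' Set.range (ρ l) =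
        Set.range (ρ l ≫ pullback.snd i (pullback.fst p t)) := fun l => by
      rw [← Set.range_comp]
      exact congr_arg _ (funext fun x => (Scheme.Hom.comp_apply _ _ x).symm)
    simp only [h3] at h2
    have hms : Finite (MaximalSpectrum Γ(T, ⊤)) := finite_maximalSpectrum_appTop t
    have hsm : SmoothOfRelativeDimension d (pullback.snd p t) := by
      let P : MorphismProperty Scheme.{u} := @SmoothOfRelativeDimension.{u} d
      have : P.IsStableUnderBaseChange := smoothOfRelativeDimension_isStableUnderBaseChange d
      exact MorphismProperty.pullback_snd (P := P) p t hp
    obtain ⟨s, hs⟩ := hA.exists_isGoodSections hd t (y 0) (hy 0)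
      (le_finrank_of_disjoint t y σ hσ hσ' hdisj) (hunits.mono (hmN.trans hn'))
    obtain ⟨b, -, hb⟩ := hunits
    exact ExtendsOff.of_large hd hF hj hk ha hℓ hfin hfinZ (pullback.snd p t) t
      pullback.condition.symm _ (span_pullback_appTop t e he) hn b
      (fun l l' hl => (hb l l' hl).elim fun c hc => IsUnit.of_mul_eq_one c hc.2) ρ hρ hdisj' hs h2

end LargeUnits

/-! ### The equation of the étale covers -/

section Cover

open Polynomial

/-- The equation of the étale covers used to enlarge residue fields. -/
noncomputable def coverPoly {P : Type*} [CommRing P] (E : P[X]) (M q : ℕ) : P[X] :=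
  X + ((X ^ M - 1) * E) ^ q

variable {P : Type*} [CommRing P] {E : P[X]} {M q : ℕ}

theorem coverPoly_monic (hE : E.Monic) (hM : M ≠ 0) (hq : 2 ≤ q) (hE1 : 0 < E.natDegree) :
    (coverPoly E M q).Monic := by
  nontriviality P
  have h1 : (X ^ M - 1 : P[X]).Monic := by simpa using monic_X_pow_sub_C (1 : P) hM
  have h2 : (((X ^ M - 1) * E) ^ q).Monic := (h1.mul hE).pow q
  refine Monic.add_of_right h2 ?_
  rw [degree_X, degree_eq_natDegree h2.ne_zero, (h1.mul hE).natDegree_pow, h1.natDegree_mul hE]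
  norm_cast
  nlinarith

theorem map_coverPoly {S : Type*} [CommRing S] (f : P →+* S) :
    (coverPoly E M q).map f = coverPoly (E.map f) M q := by
  simp [coverPoly]

theorem aeval_coverPoly {S : Type*} [CommRing S] [Algebra P S] (t : S) :
    aeval t (coverPoly E M q) = t + ((t ^ M - 1) * aeval t E) ^ q := by
  simp [coverPoly]

theorem derivative_coverPoly : derivative (coverPoly E M q) =
    1 + C (q : P) * ((X ^ M - 1) * E) ^ (q - 1) * derivative ((X ^ M - 1) * E) := by
  rw [coverPoly, derivative_add, derivative_X, derivative_pow]

theorem eval_derivative_coverPoly_of_eq_zero (h : (q : P) = 0) (w : P) :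
    (derivative (coverPoly E M q)).eval w = 1 := by
  rw [derivative_coverPoly, h]
  simp

/-- The simple root 0 lifts the section to the cover. -/
theorem eval_zero_coverPoly (hq : 2 ≤ q) (h : E.coeff 0 = 0) :
    (coverPoly E M q).eval 0 = 0 ∧ (derivative (coverPoly E M q)).eval 0 = 1 := by
  rw [coeff_zero_eq_eval_zero] at h
  constructor
  · simp [coverPoly, h, show q ≠ 0 by omega]
  · rw [derivative_coverPoly]
    simp [h, show q - 1 ≠ 0 by omega]

/-- The rational number −1/q would be an integer. -/
theorem false_of_isIntegral_of_mul_eq {K : Type*} [Field K] [CharZero K] {x : K} (hx : IsIntegral ℤ x)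
    (hq : 2 ≤ q) (h : (q : K) * x = -1) : False := by
  have hq0 : (q : ℚ) ≠ 0 := by positivity
  have hqK : (q : K) ≠ 0 := by exact_mod_cast (by omega : q ≠ 0)
  have h1 : x = algebraMap ℚ K (-(1 / q)) := by
    rw [map_neg, map_div₀, map_one, map_natCast]
    field_simp
    linear_combination h
  rw [h1] at hx
  have h2 : IsIntegral ℤ (-(1 / q) : ℚ) :=
    (isIntegral_algHom_iff (algebraMap ℚ K).toIntAlgHom (algebraMap ℚ K).injective).1 hx
  obtain ⟨m, hm⟩ := IsIntegrallyClosed.isIntegral_iff.1 h2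
  have h3 : (m : ℚ) * q = -1 := by
    rw [show (m : ℚ) = algebraMap ℤ ℚ m from rfl, hm]
    field_simp
  have h4 : m * q = -1 := by exact_mod_cast h3
  have h5 : (q : ℤ) ∣ 1 := ⟨-m, by linarith⟩
  have := Int.le_of_dvd one_pos h5
  omega

/-- A root of a monic polynomial with integral coefficients is integral, and at it a vanishing
derivative would read 1 + q x = 0 with x integral. -/
theorem eval_derivative_coverPoly_ne_zero {K : Type*} [Field K] [CharZero K] {E : K[X]}
    (hE : E.Monic) (hE1 : 0 < E.natDegree) (hi : ∀ k, IsIntegral ℤ (E.coeff k)) (hM : M ≠ 0)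
    (hq : 2 ≤ q) {w : K} (hw : (coverPoly E M q).eval w = 0) :
    (derivative (coverPoly E M q)).eval w ≠ 0 := by
  intro hw'
  let O := integralClosure ℤ K
  have hl : E ∈ lifts (algebraMap O K) := by
    rw [lifts_iff_coeff_lifts]
    exact fun k => ⟨⟨E.coeff k, hi k⟩, rfl⟩
  obtain ⟨E₀, hE₀⟩ := hl
  rw [coe_mapRingHom] at hE₀
  have hinj : Function.Injective (algebraMap O K) := Subtype.val_injective
  have hmon : E₀.Monic := monic_of_injective hinj (by rwa [hE₀])
  have hdeg : 0 < E₀.natDegree := by rwa [← natDegree_map_eq_of_injective hinj, hE₀]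
  rw [← hE₀, ← map_coverPoly] at hw hw'
  have hwO : IsIntegral O w := ⟨_, coverPoly_monic hmon hM hq hdeg, by rwa [Polynomial.eval_map] at hw⟩
  have hwi : IsIntegral ℤ w := isIntegral_trans w hwO
  let w₀ : O := ⟨w, hwi⟩
  have h1 : (derivative (coverPoly E₀ M q)).eval w₀ = 0 := by
    apply hinj
    rw [map_zero, ← hw', derivative_map, Polynomial.eval_map, ← eval₂_at_apply]
    rfl
  rw [derivative_coverPoly, eval_add, eval_mul, eval_mul, eval_one, eval_C, mul_assoc] at h1
  have h2 := congr_arg (algebraMap O K) h1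
  rw [map_add, map_mul, map_one, map_zero, map_natCast] at h2
  exact false_of_isIntegral_of_mul_eq (x := algebraMap O K _) (Subtype.property _) hq
    (eq_neg_of_add_eq_zero_right h2)

end Cover

/-! ### Construction of the étale covers -/

section ExistsCover

open Polynomial

variable {R P : Type u} [CommRing R] [CommRing P] [Algebra R P] {E : P[X]} {M q : ℕ}

/-- Over V(J) the cover is étale without localizing: at a closed point where q = 0 the derivative is
1; elsewhere the residue field has characteristic zero and the coefficients are integral. Inverting
the derivative therefore preserves finiteness over V(J). -/
theorem isUnit_derivative_root {J : Ideal P} [Module.Finite R (P ⧸ J)]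
    (hq : 2 ≤ q) (hqR : ∀ y : Ideal R, y.IsMaximal → (q : R) ∈ y ∨ CharZero (R ⧸ y)) (hM : M ≠ 0)
    (hE : E.Monic) (hE1 : 0 < E.natDegree)
    (hi : ∀ z : Ideal P, z.IsMaximal → J ≤ z → (q : P) ∈ z ∨
      ∀ k, IsIntegral ℤ (Ideal.Quotient.mk z (E.coeff k))) :
    IsUnit (aeval (AdjoinRoot.root ((coverPoly E M q).map (Ideal.Quotient.mk J)))
      (derivative (coverPoly E M q))) := by
  let f : (P ⧸ J)[X] := (coverPoly E M q).map (Ideal.Quotient.mk J)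
  have hf : f.Monic := (coverPoly_monic hE hM hq hE1).map _
  have hfin : Module.Finite (P ⧸ J) (AdjoinRoot f) := hf.finite_adjoinRoot
  have hfinR : Module.Finite R (AdjoinRoot f) := Module.Finite.trans (P ⧸ J) _
  change IsUnit (aeval (AdjoinRoot.root f) (derivative (coverPoly E M q)))
  by_contra hu
  obtain ⟨m, hm, hmem⟩ := exists_max_ideal_of_mem_nonunits hu
  let K := AdjoinRoot f ⧸ m
  let _ : Field K := Ideal.Quotient.field m
  let π : P →+* K := (Ideal.Quotient.mk m).comp (algebraMap P (AdjoinRoot f))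
  let w : K := Ideal.Quotient.mk m (AdjoinRoot.root f)
  have hev : ∀ g : P[X], Ideal.Quotient.mk m (aeval (AdjoinRoot.root f) g) = (g.map π).eval w := by
    intro g
    rw [aeval_def, hom_eval₂, Polynomial.eval_map]
  have hw : (coverPoly (E.map π) M q).eval w = 0 := by
    rw [← map_coverPoly, ← hev]
    have h1 : aeval (AdjoinRoot.root f) (coverPoly E M q) = 0 := by
      rw [← aeval_map_algebraMap (P ⧸ J), Ideal.Quotient.algebraMap_eq, AdjoinRoot.aeval_eq,
        AdjoinRoot.mk_self]
    rw [h1, map_zero]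
  have hw' : (derivative (coverPoly (E.map π) M q)).eval w = 0 := by
    rw [← map_coverPoly, derivative_map, ← hev]
    exact Ideal.Quotient.eq_zero_iff_mem.2 hmem
  have hz1 : (m.comap (algebraMap (P ⧸ J) (AdjoinRoot f))).IsMaximal :=
    Ideal.isMaximal_comap_of_isIntegral_of_isMaximal m
  have hy : (m.comap (algebraMap R (AdjoinRoot f))).IsMaximal :=
    Ideal.isMaximal_comap_of_isIntegral_of_isMaximal m
  let z := (m.comap (algebraMap (P ⧸ J) (AdjoinRoot f))).comap (Ideal.Quotient.mk J)
  have hz : z.IsMaximal := Ideal.comap_isMaximal_of_surjective _ Ideal.Quotient.mk_surjective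
  have hπz : ∀ x, x ∈ z ↔ π x = 0 := fun x => (Ideal.Quotient.eq_zero_iff_mem (I := m)).symm
  have hJz : J ≤ z := fun x hx => by
    have h0 : Ideal.Quotient.mk J x ∈ m.comap (algebraMap (P ⧸ J) (AdjoinRoot f)) := by
      rw [Ideal.Quotient.eq_zero_iff_mem.2 hx]
      exact zero_mem _
    exact h0
  by_cases hqK : (q : K) = 0
  · rw [eval_derivative_coverPoly_of_eq_zero hqK] at hw'
    exact one_ne_zero hw'
  · have hq1 : (q : P) ∉ z := fun h => hqK (by rw [hπz, map_natCast] at h; exact h)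
    have hint := (hi z hz hJz).resolve_left hq1
    have hchar := (hqR _ hy).resolve_left fun h => hqK (by
      rw [Ideal.mem_comap, map_natCast] at h
      have := Ideal.Quotient.eq_zero_iff_mem.2 h
      rwa [map_natCast] at this)
    have hK : CharZero K := charZero_of_injective_ringHom
      (f := Ideal.quotientMap m (algebraMap R (AdjoinRoot f)) le_rfl)
      (Ideal.quotientMap_injective)
    refine eval_derivative_coverPoly_ne_zero (hE.map π) (by rwa [hE.natDegree_map]) (fun k => ?_)
      hM hq hw hw'
    rw [coeff_map]
    exact (hint k).map (Ideal.Quotient.lift z π fun x hx => (hπz x).1 hx).toIntAlgHom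

/-- The étale cover with the equation `coverPoly E M q`. -/
theorem exists_cover {J : Ideal P} [Module.Finite R (P ⧸ J)] (δ : P →ₐ[R] R)
    (hq : 2 ≤ q) (hqR : ∀ y : Ideal R, y.IsMaximal → (q : R) ∈ y ∨ CharZero (R ⧸ y)) (hM : M ≠ 0)
    (hE : E.Monic) (hE1 : 0 < E.natDegree) (hδ : δ (E.coeff 0) = 0)
    (hi : ∀ z : Ideal P, z.IsMaximal → J ≤ z → (q : P) ∈ z ∨
      ∀ k, IsIntegral ℤ (Ideal.Quotient.mk z (E.coeff k))) :
    ∃ (P' : Type u) (_ : CommRing P') (_ : Algebra P P') (_ : Algebra R P')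
      (_ : IsScalarTower R P P') (t : P') (δ' : P' →ₐ[R] R), Algebra.Etale P P' ∧
      t + ((t ^ M - 1) * aeval t E) ^ q = 0 ∧ (∀ x, δ' (algebraMap P P' x) = δ x) ∧
      RingHom.ker δ' = (RingHom.ker δ).map (algebraMap P P') ⊔ Ideal.span {t} ∧
      (∀ {S : Type u} [CommRing S] (φ ψ : P' →+* S),
        φ.comp (algebraMap P P') = ψ.comp (algebraMap P P') → φ t = ψ t → φ = ψ) ∧
      Module.Finite R (P' ⧸ J.map (algebraMap P P')) := by
  -- The cover adjoins a root and inverts the derivative at it, which makes it étale over all of P.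
  let G : StandardEtalePair P := ⟨coverPoly E M q, coverPoly_monic hE hM hq hE1,
    derivative (coverPoly E M q), 1, 0, 1, by ring⟩
  let _ : Algebra R G.Ring := ((algebraMap P G.Ring).comp (algebraMap R P)).toAlgebra
  have htower : IsScalarTower R P G.Ring := .of_algebraMap_eq' rfl
  have hext : ∀ {S : Type u} [CommRing S] (φ ψ : G.Ring →+* S),
      φ.comp (algebraMap P G.Ring) = ψ.comp (algebraMap P G.Ring) → φ G.X = ψ G.X → φ = ψ := by
    intro S _ φ ψ h hX
    let _ : Algebra P S := (φ.comp (algebraMap P G.Ring)).toAlgebra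
    let φ' : G.Ring →ₐ[P] S := { φ with commutes' := fun r => rfl }
    let ψ' : G.Ring →ₐ[P] S := { ψ with commutes' := fun r => (RingHom.congr_fun h r).symm }
    have : φ' = ψ' := StandardEtalePair.hom_ext hX
    exact congr_arg (fun θ : G.Ring →ₐ[P] S => (θ : G.Ring →+* S)) this
  obtain ⟨δ', hδ', hδX⟩ : ∃ δ' : G.Ring →ₐ[R] R, (∀ x, δ' (algebraMap P G.Ring x) = δ x) ∧
      δ' G.X = 0 := by
    let _ : Algebra P R := (δ : P →+* R).toAlgebra
    have h0 := eval_zero_coverPoly (M := M) (E := E.map (δ : P →+* R)) hq (by rw [coeff_map]; exact hδ)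
    have hae : ∀ g : P[X], aeval (0 : R) g = (g.map (δ : P →+* R)).eval 0 := fun g => by
      rw [Polynomial.eval_map]; rfl
    have hmap : G.HasMap (0 : R) := by
      constructor
      · rw [hae, map_coverPoly, h0.1]
      · rw [hae, ← derivative_map, map_coverPoly, h0.2]
        exact isUnit_one
    refine ⟨{ G.lift 0 hmap with commutes' := fun r => ?_ }, fun x => ?_, ?_⟩
    · exact ((G.lift 0 hmap).commutes (algebraMap R P r)).trans (δ.commutes r)
    · exact (G.lift 0 hmap).commutes x
    · exact G.lift_X 0 hmap
  refine ⟨G.Ring, inferInstance, inferInstance, inferInstance, htower, G.X, δ', inferInstance, ?_,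
    hδ', ?_, hext, ?_⟩
  · have h1 := (StandardEtalePair.hasMap_X (P := G)).1
    exact (aeval_coverPoly G.X).symm.trans h1
  · apply le_antisymm
    · let I := (RingHom.ker δ).map (algebraMap P G.Ring) ⊔ Ideal.span {G.X}
      -- Modulo I the quotient map factors through δ', since the two maps agree on P and on the
      -- root; so I contains the kernel.
      have h1 : (Ideal.Quotient.mk I) = ((Ideal.Quotient.mk I).comp (algebraMap R G.Ring)).comp
          (δ' : G.Ring →+* R) := by
        refine hext _ _ ?_ ?_
        · ext x
          change Ideal.Quotient.mk I (algebraMap P G.Ring x) =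
            Ideal.Quotient.mk I (algebraMap R G.Ring (δ' (algebraMap P G.Ring x)))
          rw [hδ', Ideal.Quotient.eq, IsScalarTower.algebraMap_apply R P G.Ring, ← map_sub]
          refine Ideal.mem_sup_left (Ideal.mem_map_of_mem _ ?_)
          rw [RingHom.mem_ker, map_sub, AlgHom.commutes, Algebra.algebraMap_self_apply, sub_self]
        · change Ideal.Quotient.mk I G.X = Ideal.Quotient.mk I (algebraMap R G.Ring (δ' G.X))
          rw [hδX, map_zero, map_zero, Ideal.Quotient.eq_zero_iff_mem]
          exact Ideal.mem_sup_right (Ideal.mem_span_singleton_self _)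
      intro x hx
      have h2 := RingHom.congr_fun h1 x
      have h3 : δ' x = 0 := hx
      rw [RingHom.comp_apply, RingHom.coe_coe, h3, map_zero] at h2
      exact Ideal.Quotient.eq_zero_iff_mem.1 h2
    · refine sup_le (Ideal.map_le_iff_le_comap.2 fun x hx => ?_) ?_
      · rw [Ideal.mem_comap, RingHom.mem_ker, hδ']
        exact hx
      · rw [Ideal.span_singleton_le_iff_mem]
        exact hδX
  -- Over P ⧸ J the derivative is already a unit, so the restricted cover is a quotient of the
  -- finite algebra obtained by adjoining the root alone.
  · let f : (P ⧸ J)[X] := (coverPoly E M q).map (Ideal.Quotient.mk J)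
    have hf : f.Monic := (coverPoly_monic hE hM hq hE1).map _
    have hfin : Module.Finite (P ⧸ J) (AdjoinRoot f) := hf.finite_adjoinRoot
    have hfinR : Module.Finite R (AdjoinRoot f) := Module.Finite.trans (P ⧸ J) _
    have hroot : aeval (AdjoinRoot.root f) (coverPoly E M q) = 0 := by
      rw [← aeval_map_algebraMap (P ⧸ J), Ideal.Quotient.algebraMap_eq, AdjoinRoot.aeval_eq,
        AdjoinRoot.mk_self]
    have hmap : G.HasMap (AdjoinRoot.root f) :=
      ⟨hroot, isUnit_derivative_root hq hqR hM hE hE1 hi⟩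
    let θ := G.lift (AdjoinRoot.root f) hmap
    let J' := J.map (algebraMap P G.Ring)
    let κ : P ⧸ J →+* G.Ring ⧸ J' := Ideal.quotientMap J' (algebraMap P G.Ring)
      Ideal.le_comap_map
    have hκ : f.eval₂ κ (Ideal.Quotient.mk J' G.X) = 0 := by
      have h1 : κ.comp (Ideal.Quotient.mk J) =
          (Ideal.Quotient.mk J').comp (algebraMap P G.Ring) := rfl
      rw [eval₂_map, h1, ← hom_eval₂]
      have h2 := (StandardEtalePair.hasMap_X (P := G)).1
      rw [aeval_def] at h2
      rw [h2, map_zero]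
    let l : AdjoinRoot f →+* G.Ring ⧸ J' := AdjoinRoot.lift κ (Ideal.Quotient.mk J' G.X) hκ
    have hl : l.comp (θ : G.Ring →+* AdjoinRoot f) = Ideal.Quotient.mk J' := by
      refine hext _ _ ?_ ?_
      · ext x
        change l (θ (algebraMap P G.Ring x)) = Ideal.Quotient.mk J' (algebraMap P G.Ring x)
        rw [θ.commutes]
        exact AdjoinRoot.lift_of hκ
      · change l (θ G.X) = Ideal.Quotient.mk J' G.X
        rw [show θ G.X = AdjoinRoot.root f from G.lift_X _ _]
        exact AdjoinRoot.lift_root hκ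
    have hls : Function.Surjective l := fun r => by
      obtain ⟨x, rfl⟩ := Ideal.Quotient.mk_surjective r
      exact ⟨θ x, RingHom.congr_fun hl x⟩
    have h3 : l.comp (algebraMap R (AdjoinRoot f)) = algebraMap R (G.Ring ⧸ J') := by
      ext r
      exact AdjoinRoot.lift_of hκ (x := Ideal.Quotient.mk J (algebraMap R P r))
    have h4 : (algebraMap R (G.Ring ⧸ J')).Finite := by
      rw [← h3]
      exact (RingHom.Finite.of_surjective l hls).comp (RingHom.finite_algebraMap.2 hfinR)
    exact RingHom.finite_algebraMap.1 h4

end ExistsCover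

/-! ### Common roots of cover equations -/

section Separation

open Polynomial

/-- Polynomials over a field form an integrally closed domain, so each of f and g divides the other.
-/
theorem eq_of_pow_eq_pow_of_monic {K : Type*} [Field K] {f g : K[X]} (hf : f.Monic) (hg : g.Monic)
    {q : ℕ} (hq : q ≠ 0) (h : f ^ q = g ^ q) : f = g := by
  have h1 : f ∣ g := (IsIntegrallyClosed.pow_dvd_pow_iff hq).1 h.dvd
  have h2 : g ∣ f := (IsIntegrallyClosed.pow_dvd_pow_iff hq).1 h.symm.dvd
  exact eq_of_monic_of_associated hf hg (associated_of_dvd_dvd h1 h2)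

/-- Two cover equations with a common root. -/
theorem eq_or_eq_zero_of_common_root {K : Type*} [Field K] {f g : K[X]} (hf : f.Monic) (hg : g.Monic)
    {M q : ℕ} (hM : M ≠ 0) (hq : q ≠ 0)
    (h : f ^ q ≠ g ^ q → ∀ u : K, u ≠ 0 → (f ^ q - g ^ q).eval u = 0 → u ^ M = 1) {u : K}
    (hu : u + ((u ^ M - 1) * f.eval u) ^ q = 0) (hu' : u + ((u ^ M - 1) * g.eval u) ^ q = 0) :
    f = g ∨ f.eval 0 = 0 ∧ g.eval 0 = 0 := by
  by_cases h0 : u = 0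
  · subst h0
    right
    simpa [hM, hq] using And.intro hu hu'
  · left
    -- If u ^ M = 1, the equation reads u = 0. Otherwise subtracting the equations makes u a root of
    -- f ^ q − g ^ q, and such nonzero roots were assumed to satisfy u ^ M = 1.
    have h1 : u ^ M ≠ 1 := fun h1 => h0 (by simpa [h1, hq] using hu)
    by_contra hne
    refine h1 (h (fun h2 => hne (eq_of_pow_eq_pow_of_monic hf hg hq h2)) u h0 ?_)
    have h2 : (u ^ M - 1) ^ q * ((f ^ q - g ^ q).eval u) = 0 := by
      rw [eval_sub, eval_pow, eval_pow]
      rw [mul_pow] at hu hu'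
      linear_combination hu - hu'
    exact (mul_eq_zero.1 h2).resolve_left (pow_ne_zero _ (sub_ne_zero.2 h1))

theorem exists_pow_eq_one_of_finite {K : Type*} [Monoid K] {U : Set K} (hU : U.Finite)
    (h : ∀ u ∈ U, ∃ m : ℕ, m ≠ 0 ∧ u ^ m = 1) : ∃ M : ℕ, M ≠ 0 ∧ ∀ u ∈ U, u ^ M = 1 := by
  induction U, hU using Set.Finite.induction_on with
  | empty => exact ⟨1, one_ne_zero, fun u hu => hu.elim⟩
  | insert _ _ ih =>
    obtain ⟨M, hM, hM'⟩ := ih fun u hu => h u (Or.inr hu)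
    obtain ⟨m, hm, hm'⟩ := h _ (Or.inl rfl)
    refine ⟨m * M, mul_ne_zero hm hM, ?_⟩
    rintro u (rfl | hu)
    · rw [pow_mul, hm', one_pow]
    · rw [mul_comm, pow_mul, hM' u hu, one_pow]

/-- A nonzero element algebraic over a finite field lies in a finite field. -/
theorem exists_pow_eq_one_of_isAlgebraic (k : Type*) {K : Type*} [Field k] [Finite k] [Field K]
    [Algebra k K] [Algebra.IsAlgebraic k K] {u : K} (hu : u ≠ 0) : ∃ m : ℕ, m ≠ 0 ∧ u ^ m = 1 := by
  have hi : IsIntegral k u := Algebra.IsIntegral.isIntegral u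
  have : FiniteDimensional k (IntermediateField.adjoin k {u}) :=
    IntermediateField.adjoin.finiteDimensional hi
  have : Finite (IntermediateField.adjoin k {u}) := Module.finite_of_finite k
  let w : IntermediateField.adjoin k {u} := ⟨u, IntermediateField.mem_adjoin_simple_self k u⟩
  have hw : w ≠ 0 := fun h => hu (congr_arg Subtype.val h)
  have h1 : IsOfFinOrder (Units.mk0 w hw) := isOfFinOrder_of_finite _
  obtain ⟨m, hm, hm'⟩ := isOfFinOrder_iff_pow_eq_one.1 h1
  refine ⟨m, hm.ne', ?_⟩
  have h2 := congr_arg (fun v : (IntermediateField.adjoin k {u})ˣ => ((v : IntermediateField.adjoin k {u}) : K)) hm'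
  simpa [w] using h2

end Separation

/-! ### Prescribed values at closed points -/

section ChineseRemainder

variable {P : Type*} [CommRing P]

/-- The Chinese remainder theorem within the ideal I: the prescribed values must vanish at points of
V(I), and elsewhere I imposes no condition. -/
theorem exists_mem_forall_sub_mem (I : Ideal P) {Zs : Type*} [Finite Zs] (Z : Zs → Ideal P)
    (hZ : ∀ z, (Z z).IsMaximal) (hinj : Function.Injective Z) (v : Zs → P)
    (hv : ∀ z, I ≤ Z z → v z ∈ Z z) : ∃ c ∈ I, ∀ z, c - v z ∈ Z z := by
  have hcop : Pairwise fun z w => IsCoprime (Z z) (Z w) := fun z w h =>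
    Ideal.isCoprime_of_isMaximal fun h' => h (hinj h')
  have h1 : ∀ z, ∃ w ∈ I, I ≤ Z z ∨ w - 1 ∈ Z z := by
    intro z
    by_cases h : I ≤ Z z
    · exact ⟨0, zero_mem _, Or.inl h⟩
    · have h2 : I ⊔ Z z = ⊤ := by
        rw [sup_comm]
        by_contra hne
        have := (hZ z).eq_of_le hne le_sup_left
        exact h (this ▸ le_sup_right)
      obtain ⟨w, hw, x, hx, hwx⟩ := Submodule.mem_sup.1 (h2 ▸ trivial : (1 : P) ∈ I ⊔ Z z)
      refine ⟨w, hw, Or.inr ?_⟩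
      rw [← hwx, sub_add_cancel_left]
      exact neg_mem hx
  choose w hw hw' using h1
  obtain ⟨c, hc⟩ := Ideal.exists_forall_sub_mem_ideal hcop v
  have := Fintype.ofFinite Zs
  -- An element of I equal to 1 at every point off V(I); it moves an ordinary solution into I.
  let ε := 1 - ∏ z, (1 - w z)
  have hε : ε ∈ I := by
    rw [← Ideal.Quotient.eq_zero_iff_mem, map_sub, map_prod, map_one, sub_eq_zero]
    refine (Finset.prod_eq_one fun z _ => ?_).symm
    rw [map_sub, map_one, Ideal.Quotient.eq_zero_iff_mem.2 (hw z), sub_zero]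
  refine ⟨ε * c, I.mul_mem_right _ hε, fun z => ?_⟩
  rcases hw' z with h | h
  · exact sub_mem ((Z z).mul_mem_right _ (h hε)) (hv z h)
  · have h1 : ε - 1 ∈ Z z := by
      rw [show ε - 1 = -∏ z, (1 - w z) by simp only [ε]; ring]
      refine neg_mem (Ideal.mem_of_dvd _ (Finset.dvd_prod_of_mem _ (Finset.mem_univ z)) ?_)
      rw [← neg_sub]
      exact neg_mem h
    rw [show ε * c - v z = (ε - 1) * c + (c - v z) by ring]
    exact add_mem ((Z z).mul_mem_right _ h1) (hc z)

/-- Lift a generator of the cyclic group of units of the finite residue field: every nonzero residue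
is a power of it. -/
theorem exists_generator_of_finite (z : Ideal P) [z.IsMaximal] [Finite (P ⧸ z)] :
    ∃ θ, θ ∉ z ∧ ∀ {K : Type u} [Field K] (φ ψ : P →+* K), RingHom.ker φ = z →
      RingHom.ker ψ = z → φ θ = ψ θ → φ = ψ := by
  let _ : Field (P ⧸ z) := Ideal.Quotient.field z
  obtain ⟨g, hg⟩ := IsCyclic.exists_generator (α := (P ⧸ z)ˣ)
  obtain ⟨θ, hθ⟩ := Ideal.Quotient.mk_surjective (g : P ⧸ z)
  refine ⟨θ, fun h => g.ne_zero (by rw [← hθ, Ideal.Quotient.eq_zero_iff_mem.2 h]), ?_⟩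
  intro K _ φ ψ hφ hψ h
  ext x
  by_cases hx : x ∈ z
  · rw [show φ x = 0 by rw [← RingHom.mem_ker, hφ]; exact hx,
      show ψ x = 0 by rw [← RingHom.mem_ker, hψ]; exact hx]
  · have hx0 : Ideal.Quotient.mk z x ≠ 0 := fun h => hx (Ideal.Quotient.eq_zero_iff_mem.1 h)
    obtain ⟨m, hm⟩ := mem_powers_iff_mem_zpowers.2 (hg (Units.mk0 _ hx0))
    have h1 : θ ^ m - x ∈ z := by
      rw [← Ideal.Quotient.eq, map_pow, hθ]
      simpa using congr_arg Units.val hm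
    have h2 : ∀ φ : P →+* K, RingHom.ker φ = z → φ x = φ θ ^ m := by
      intro φ hφ
      rw [← map_pow, eq_comm, ← sub_eq_zero, ← map_sub, ← RingHom.mem_ker, hφ]
      exact h1
    rw [h2 φ hφ, h2 ψ hψ, h]

end ChineseRemainder

/-! ### A polynomial whose specializations separate points -/

section SeparatingPolynomial

open Polynomial

variable {R P : Type u} [CommRing R] [CommRing P] [Algebra R P]

theorem finite_maximalSpectrum_of_quotient [Finite (MaximalSpectrum R)] (J : Ideal P)
    [Module.Finite R (P ⧸ J)] : Finite {z : MaximalSpectrum P // J ≤ z.asIdeal} := by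
  have h1 : Finite (MaximalSpectrum (P ⧸ J)) := finite_maximalSpectrum_of_finite R (P ⧸ J)
  have hmax : ∀ z : {z : MaximalSpectrum P // J ≤ z.asIdeal},
      (z.1.asIdeal.map (Ideal.Quotient.mk J)).IsMaximal ∧
      (z.1.asIdeal.map (Ideal.Quotient.mk J)).comap (Ideal.Quotient.mk J) = z.1.asIdeal := by
    intro z
    have hcm : (z.1.asIdeal.map (Ideal.Quotient.mk J)).comap (Ideal.Quotient.mk J) = z.1.asIdeal := by
      rw [Ideal.comap_map_of_surjective _ Ideal.Quotient.mk_surjective, ← RingHom.ker_eq_comap_bot,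
        Ideal.mk_ker, sup_eq_left.2 z.2]
    have := z.1.isMaximal
    refine ⟨(Ideal.map_eq_top_or_isMaximal_of_surjective _ Ideal.Quotient.mk_surjective
      this).resolve_left fun htop => ?_, hcm⟩
    rw [htop, Ideal.comap_top] at hcm
    exact this.ne_top hcm.symm
  refine Finite.of_injective (fun z => (⟨_, (hmax z).1⟩ : MaximalSpectrum (P ⧸ J))) fun z w h => ?_
  have h2 := congr_arg (fun m : MaximalSpectrum (P ⧸ J) => m.asIdeal.comap (Ideal.Quotient.mk J)) h
  dsimp only at h2
  rw [(hmax z).2, (hmax w).2] at h2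
  exact Subtype.ext (MaximalSpectrum.ext h2)

theorem eq_of_ker_le {S : Type*} [CommRing S] [Algebra R S] (δ : P →ₐ[R] R) (φ ψ : P →ₐ[R] S)
    (hφ : RingHom.ker δ ≤ RingHom.ker φ) (hψ : RingHom.ker δ ≤ RingHom.ker ψ) : φ = ψ := by
  have key : ∀ φ : P →ₐ[R] S, RingHom.ker δ ≤ RingHom.ker φ →
      ∀ x, φ x = algebraMap R S (δ x) := by
    intro φ hφ x
    have h1 : x - algebraMap R P (δ x) ∈ RingHom.ker φ := hφ (by
      rw [RingHom.mem_ker, map_sub, AlgHom.commutes, Algebra.algebraMap_self_apply, sub_self])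
    rw [RingHom.mem_ker, map_sub, AlgHom.commutes, sub_eq_zero] at h1
    exact h1
  ext x
  rw [key φ hφ, key ψ hψ]

/-- A polynomial whose specializations separate the geometric points with finite residue fields. -/
theorem exists_separating_polynomial [Finite (MaximalSpectrum R)] (J : Ideal P)
    [Module.Finite R (P ⧸ J)] (δ : P →ₐ[R] R) :
    ∃ (r : ℕ) (D : P[X]), 1 ≤ r ∧ D.degree < r ∧ (∀ k, D.coeff k ∈ RingHom.ker δ) ∧
      (∀ z : Ideal P, z.IsMaximal → J ≤ z → Finite (P ⧸ z) ∨ ∀ k, D.coeff k ∈ z) ∧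
      ∀ (y : Ideal R) [y.IsMaximal], Finite (R ⧸ y) →
        ∀ φ ψ : P →ₐ[R] AlgebraicClosure y.ResidueField, J ≤ RingHom.ker φ → J ≤ RingHom.ker ψ →
          (D.map (φ : P →+* AlgebraicClosure y.ResidueField) =
              D.map (ψ : P →+* AlgebraicClosure y.ResidueField) ∨
            φ (D.coeff 0) = 0 ∧ ψ (D.coeff 0) = 0) → φ = ψ := by
  classical
  let Zs := {z : MaximalSpectrum P // J ≤ z.asIdeal}
  have hZs : Finite Zs := finite_maximalSpectrum_of_quotient (R := R) J
  have := Fintype.ofFinite Zs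
  let Z : Zs → Ideal P := fun z => z.1.asIdeal
  have hZ : ∀ z, (Z z).IsMaximal := fun z => z.1.isMaximal
  have hinj : Function.Injective Z := fun z w h => Subtype.ext (MaximalSpectrum.ext h)
  let I := RingHom.ker δ
  have hθ : ∀ z : Zs, ∃ θ : P, Finite (P ⧸ Z z) → θ ∉ Z z ∧
      ∀ {K : Type u} [Field K] (φ ψ : P →+* K), RingHom.ker φ = Z z →
        RingHom.ker ψ = Z z → φ θ = ψ θ → φ = ψ := by
    intro z
    by_cases h : Finite (P ⧸ Z z)
    · obtain ⟨θ, hθ⟩ := exists_generator_of_finite.{u} (Z z)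
      exact ⟨θ, fun _ => hθ⟩
    · exact ⟨0, fun h' => absurd h' h⟩
  choose θ hθ using hθ
  -- The points to be encoded: those with finite residue field off the section. The coefficient c₀
  -- is 1 at these and 0 elsewhere; `c z` is a generator at z, if z is such a point, and 0 at all
  -- others.
  let G : Zs → Prop := fun z => Finite (P ⧸ Z z) ∧ ¬I ≤ Z z
  obtain ⟨c₀, hc₀I, hc₀⟩ := exists_mem_forall_sub_mem I Z hZ hinj (fun z => if G z then 1 else 0)
    (fun z hz => by rw [if_neg fun h => h.2 hz]; exact zero_mem _)
  choose c hcI hc using fun z => exists_mem_forall_sub_mem I Z hZ hinj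
    (fun w => if w = z ∧ G z then θ z else 0) (fun w hw => by
      rw [if_neg (by rintro ⟨rfl, h⟩; exact h.2 hw)]; exact zero_mem _)
  let m := Fintype.card Zs
  let v : Fin (m + 1) → P := Fin.cases c₀ fun k => c ((Fintype.equivFin Zs).symm k)
  have hvI : ∀ k, v k ∈ I := fun k => Fin.cases hc₀I (fun k => hcI _) k
  have hcoeff : ∀ k, (ofFn (m + 1) v).coeff k = 0 ∨ ∃ l, (ofFn (m + 1) v).coeff k = v l := by
    intro k
    by_cases hk : k < m + 1
    · exact Or.inr ⟨⟨k, hk⟩, ofFn_coeff_eq_val_of_lt v hk⟩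
    · exact Or.inl (ofFn_coeff_eq_zero_of_ge v (not_lt.1 hk))
  have h0 : (ofFn (m + 1) v).coeff 0 = c₀ := ofFn_coeff_eq_val_of_lt v (Nat.succ_pos m)
  have hcz : ∀ z, (ofFn (m + 1) v).coeff ((Fintype.equivFin Zs z : ℕ) + 1) = c z := by
    intro z
    rw [ofFn_coeff_eq_val_of_lt v (Nat.succ_lt_succ (Fintype.equivFin Zs z).2)]
    change c ((Fintype.equivFin Zs).symm (Fintype.equivFin Zs z)) = c z
    rw [Equiv.symm_apply_apply]
  have hvZ : ∀ z, ¬Finite (P ⧸ Z z) → ∀ k, v k ∈ Z z := by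
    intro z hz k
    refine Fin.cases ?_ (fun k => ?_) k
    · have h1 := hc₀ z
      rwa [if_neg fun h : G z => hz h.1, sub_zero] at h1
    · have h1 := hc ((Fintype.equivFin Zs).symm k) z
      rwa [if_neg (by rintro ⟨rfl, h⟩; exact hz h.1), sub_zero] at h1
  refine ⟨m + 1, ofFn (m + 1) v, by omega, ofFn_degree_lt v, fun k => ?_, fun z hz hJz => ?_, ?_⟩
  · rcases hcoeff k with h | ⟨l, h⟩ <;> rw [h]
    exacts [zero_mem _, hvI l]
  · by_cases hfin : Finite (P ⧸ z)
    · exact Or.inl hfin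
    · right
      intro k
      rcases hcoeff k with h | ⟨l, h⟩ <;> rw [h]
      exacts [zero_mem _, hvZ ⟨⟨z, hz⟩, hJz⟩ hfin l]
  · intro y _ hy φ ψ hφ hψ h
    obtain ⟨hφm, hφy⟩ := comap_ker_geometric_point φ hφ
    obtain ⟨hψm, hψy⟩ := comap_ker_geometric_point ψ hψ
    let zφ : Zs := ⟨⟨_, hφm⟩, hφ⟩
    let zψ : Zs := ⟨⟨_, hψm⟩, hψ⟩
    have hfφ : Finite (P ⧸ Z zφ) := finite_quotient_of_comap_eq hy hφ hφy
    have hfψ : Finite (P ⧸ Z zψ) := finite_quotient_of_comap_eq hy hψ hψy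
    have hval : ∀ x w : P, x - w ∈ Z zφ → φ x = φ w := fun x w hx => by
      have : φ (x - w) = 0 := hx
      rwa [map_sub, sub_eq_zero] at this
    have hval' : ∀ x w : P, x - w ∈ Z zψ → ψ x = ψ w := fun x w hx => by
      have : ψ (x - w) = 0 := hx
      rwa [map_sub, sub_eq_zero] at this
    have hc₀φ : φ c₀ = 0 → I ≤ RingHom.ker φ := by
      intro h1
      by_contra h2
      rw [hval _ _ (hc₀ zφ), if_pos ⟨hfφ, h2⟩, map_one] at h1
      exact one_ne_zero h1
    have hc₀ψ : ψ c₀ = 0 → I ≤ RingHom.ker ψ := by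
      intro h1
      by_contra h2
      rw [hval' _ _ (hc₀ zψ), if_pos ⟨hfψ, h2⟩, map_one] at h1
      exact one_ne_zero h1
    rw [h0] at h
    rcases h with h | ⟨h1, h2⟩
    -- If the specializations agree: on the section, c₀ shows that both points lie there, and the
    -- section determines them. Off it, `c zφ` is nonzero at the first point only over zφ, so both
    -- points lie over zφ and agree on its generator.
    · have hco : ∀ k, φ ((ofFn (m + 1) v).coeff k) = ψ ((ofFn (m + 1) v).coeff k) := fun k => by
        simpa using congr_arg (fun f : (AlgebraicClosure y.ResidueField)[X] => f.coeff k) h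
      by_cases hI : I ≤ Z zφ
      · have h1 : φ c₀ = 0 := hI hc₀I
        have h2 := hco 0
        rw [h0, h1] at h2
        exact eq_of_ker_le δ φ ψ hI (hc₀ψ h2.symm)
      · have hG : G zφ := ⟨hfφ, hI⟩
        have h1 := hco ((Fintype.equivFin Zs zφ : ℕ) + 1)
        rw [hcz, hval _ _ (hc zφ zφ), if_pos ⟨rfl, hG⟩] at h1
        have h2 : φ (θ zφ) ≠ 0 := fun h => (hθ zφ hfφ).1 h
        have h3 : zψ = zφ := by
          by_contra hne
          rw [hval' _ _ (hc zφ zψ), if_neg fun h => hne h.1, map_zero] at h1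
          exact h2 h1
        rw [hval' _ _ (hc zφ zψ), if_pos ⟨h3, hG⟩] at h1
        have h4 : RingHom.ker (ψ : P →+* AlgebraicClosure y.ResidueField) = Z zφ :=
          congr_arg Z h3
        have h5 := (hθ zφ hfφ).2 (φ : P →+* AlgebraicClosure y.ResidueField)
          (ψ : P →+* AlgebraicClosure y.ResidueField) rfl h4 h1
        exact AlgHom.coe_ringHom_injective h5
    · exact eq_of_ker_le δ φ ψ (hc₀φ h1) (hc₀ψ h2)

end SeparatingPolynomial

/-! ### The separating cover and the tower of covers -/

section Tower

open Polynomial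

variable {R P : Type u} [CommRing R] [CommRing P] [Algebra R P]

theorem exists_forall_dvd {ι : Type*} [Finite ι] {p : ι → ℕ → Prop}
    (h : ∀ i, ∃ m, m ≠ 0 ∧ ∀ k, m ∣ k → p i k) (n : ℕ) (hn : n ≠ 0) :
    ∃ m, m ≠ 0 ∧ n ∣ m ∧ ∀ i, p i m := by
  choose m hm hm' using h
  have := Fintype.ofFinite ι
  refine ⟨n * ∏ i, m i, mul_ne_zero hn (Finset.prod_ne_zero_iff.2 fun i _ => hm i),
    dvd_mul_right _ _, fun i => hm' i _ ?_⟩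
  exact (Finset.dvd_prod_of_mem m (Finset.mem_univ i)).mul_left _

/-- An even number divisible by all positive residue characteristics. -/
theorem exists_even_residue_char (R : Type*) [CommRing R] [Finite (MaximalSpectrum R)] :
    ∃ q : ℕ, 2 ≤ q ∧ Even q ∧ ∀ y : Ideal R, y.IsMaximal → (q : R) ∈ y ∨ CharZero (R ⧸ y) := by
  have h : ∀ y : MaximalSpectrum R, ∃ m, m ≠ 0 ∧ ∀ k, m ∣ k →
      (((k : ℕ) : R) ∈ y.asIdeal ∨ CharZero (R ⧸ y.asIdeal)) := by
    intro y
    have := y.isMaximal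
    obtain ⟨p, hp⟩ := CharP.exists (R ⧸ y.asIdeal)
    rcases eq_or_ne p 0 with rfl | hp0
    · exact ⟨1, one_ne_zero, fun k _ => Or.inr (CharP.charP_to_charZero (R ⧸ y.asIdeal))⟩
    · refine ⟨p, hp0, fun k hk => Or.inl ?_⟩
      rw [← Ideal.Quotient.eq_zero_iff_mem, map_natCast]
      exact (CharP.cast_eq_zero_iff (R ⧸ y.asIdeal) p k).2 hk
  obtain ⟨q, hq, h2, hq'⟩ := exists_forall_dvd h 2 two_ne_zero
  exact ⟨q, Nat.le_of_dvd (Nat.pos_of_ne_zero hq) h2, even_iff_two_dvd.2 h2,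
    fun y hy => hq' ⟨y, hy⟩⟩

/-- The roots that have to be avoided are roots of unity. -/
theorem exists_exponent [Finite (MaximalSpectrum R)] (J : Ideal P) [Module.Finite R (P ⧸ J)]
    (E : P[X]) (q n : ℕ) : ∃ M, M ≠ 0 ∧ n.factorial ∣ M ∧ ∀ (y : Ideal R) [y.IsMaximal],
      Finite (R ⧸ y) → ∀ φ ψ : P →ₐ[R] AlgebraicClosure y.ResidueField,
        J ≤ RingHom.ker φ → J ≤ RingHom.ker ψ →
        (E.map (φ : P →+* AlgebraicClosure y.ResidueField)) ^ q ≠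
          (E.map (ψ : P →+* AlgebraicClosure y.ResidueField)) ^ q →
        ∀ u : AlgebraicClosure y.ResidueField, u ≠ 0 →
          ((E.map (φ : P →+* AlgebraicClosure y.ResidueField)) ^ q -
            (E.map (ψ : P →+* AlgebraicClosure y.ResidueField)) ^ q).eval u = 0 → u ^ M = 1 := by
  let p : MaximalSpectrum R → ℕ → Prop := fun y M => ∀ (_ : y.asIdeal.IsMaximal),
      Finite (R ⧸ y.asIdeal) → ∀ φ ψ : P →ₐ[R] AlgebraicClosure y.asIdeal.ResidueField,
        J ≤ RingHom.ker φ → J ≤ RingHom.ker ψ →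
        (E.map (φ : P →+* AlgebraicClosure y.asIdeal.ResidueField)) ^ q ≠
          (E.map (ψ : P →+* AlgebraicClosure y.asIdeal.ResidueField)) ^ q →
        ∀ u : AlgebraicClosure y.asIdeal.ResidueField, u ≠ 0 →
          ((E.map (φ : P →+* AlgebraicClosure y.asIdeal.ResidueField)) ^ q -
            (E.map (ψ : P →+* AlgebraicClosure y.asIdeal.ResidueField)) ^ q).eval u = 0 → u ^ M = 1
  have h : ∀ y, ∃ m, m ≠ 0 ∧ ∀ k, m ∣ k → p y k := by
    intro y
    have hy := y.isMaximal
    by_cases hfin : Finite (R ⧸ y.asIdeal)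
    swap
    · exact ⟨1, one_ne_zero, fun k _ _ h => absurd h hfin⟩
    obtain ⟨N, e, he⟩ := Module.Finite.exists_fin (R := R) (M := P ⧸ J)
    have hΦ := (card_geometric_point_le e he y.asIdeal).1
    let Φ := {φ : P →ₐ[R] AlgebraicClosure y.asIdeal.ResidueField // J ≤ RingHom.ker φ}
    let f : Φ × Φ → (AlgebraicClosure y.asIdeal.ResidueField)[X] := fun x =>
      (E.map (x.1.1 : P →+* AlgebraicClosure y.asIdeal.ResidueField)) ^ q -
        (E.map (x.2.1 : P →+* AlgebraicClosure y.asIdeal.ResidueField)) ^ q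
    -- There are finitely many pairs of geometric points, hence finitely many roots to avoid; each
    -- is algebraic over a finite field, so it is a root of unity.
    let U : Set (AlgebraicClosure y.asIdeal.ResidueField) :=
      {u | u ≠ 0 ∧ ∃ x : Φ × Φ, u ∈ (f x).rootSet (AlgebraicClosure y.asIdeal.ResidueField)}
    have hU : U.Finite := by
      refine (Set.finite_iUnion fun x : Φ × Φ =>
        (f x).rootSet_finite (AlgebraicClosure y.asIdeal.ResidueField)).subset ?_
      rintro u ⟨-, x, hx⟩
      exact Set.mem_iUnion.2 ⟨x, hx⟩
    have hk : Finite y.asIdeal.ResidueField :=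
      Finite.of_surjective _ y.asIdeal.bijective_algebraMap_quotient_residueField.2
    obtain ⟨m, hm, hm'⟩ := exists_pow_eq_one_of_finite hU fun u hu =>
      exists_pow_eq_one_of_isAlgebraic y.asIdeal.ResidueField hu.1
    refine ⟨m, hm, fun k hk _ _ φ ψ hφ hψ hne u hu hroot => ?_⟩
    obtain ⟨l, rfl⟩ := hk
    have h1 : u ∈ U := by
      refine ⟨hu, (⟨φ, hφ⟩, ⟨ψ, hψ⟩), ?_⟩
      rw [mem_rootSet]
      exact ⟨sub_ne_zero.2 hne, by rw [coe_aeval_eq_eval]; exact hroot⟩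
    rw [pow_mul, hm' u h1, one_pow]
  obtain ⟨M, hM, hMn, hM'⟩ := exists_forall_dvd h n.factorial n.factorial_ne_zero
  exact ⟨M, hM, hMn, fun y hy => hM' ⟨y, hy⟩ hy⟩

/-- The étale cover whose coordinate separates geometric points over finite residue fields. -/
theorem exists_separating_cover [Nontrivial R] [Finite (MaximalSpectrum R)] (J : Ideal P)
    [Module.Finite R (P ⧸ J)] (δ : P →ₐ[R] R) {q : ℕ}
    (hq : 2 ≤ q) (hqR : ∀ y : Ideal R, y.IsMaximal → (q : R) ∈ y ∨ CharZero (R ⧸ y)) (n : ℕ) :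
    ∃ (P' : Type u) (_ : CommRing P') (_ : Algebra P P') (_ : Algebra R P')
      (_ : IsScalarTower R P P') (t : P') (δ' : P' →ₐ[R] R) (M r : ℕ) (D : P[X]),
      Algebra.Etale P P' ∧ n.factorial ∣ M ∧ 1 ≤ r ∧ (∀ k, D.coeff k ∈ RingHom.ker δ) ∧
      t + ((t ^ M - 1) * (t ^ r + aeval t D)) ^ q = 0 ∧ (∀ x, δ' (algebraMap P P' x) = δ x) ∧
      RingHom.ker δ' = (RingHom.ker δ).map (algebraMap P P') ⊔ Ideal.span {t} ∧
      Module.Finite R (P' ⧸ J.map (algebraMap P P')) ∧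
      ∀ (y : Ideal R) [y.IsMaximal], Finite (R ⧸ y) →
        ∀ φ ψ : P' →ₐ[R] AlgebraicClosure y.ResidueField,
          J.map (algebraMap P P') ≤ RingHom.ker φ → J.map (algebraMap P P') ≤ RingHom.ker ψ →
          φ t = ψ t → φ = ψ := by
  obtain ⟨r, D, hr, hD, hDδ, hDz, hsep⟩ := exists_separating_polynomial J δ
  have hE : (X ^ r + D).Monic := monic_X_pow_add hD
  obtain ⟨M, hM, hMn, hM'⟩ := exists_exponent (R := R) J (X ^ r + D) q n
  have hcoeff0 : (X ^ r + D).coeff 0 = D.coeff 0 := by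
    rw [coeff_add, coeff_X_pow, if_neg (by omega), zero_add]
  have hP : Nontrivial P := (δ : P →+* R).domain_nontrivial
  have hdeg : 0 < (X ^ r + D).natDegree := by
    have : (X ^ r + D).natDegree = r := natDegree_eq_of_degree_eq_some (by
      rw [degree_add_eq_left_of_degree_lt (by rwa [degree_X_pow]), degree_X_pow])
    omega
  -- At a finite residue field q is zero; at an infinite one the coefficients of D vanish, leaving X
  -- ^ r with integral coefficients.
  have hi : ∀ z : Ideal P, z.IsMaximal → J ≤ z → (q : P) ∈ z ∨
      ∀ k, IsIntegral ℤ (Ideal.Quotient.mk z ((X ^ r + D).coeff k)) := by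
    intro z hz hJz
    rcases hDz z hz hJz with hfin | hk
    · left
      have hy : (z.comap (algebraMap R P)).IsMaximal := by
        have h1 : Module.Finite R (P ⧸ z) :=
          Module.Finite.of_surjective (Ideal.Quotient.factorₐ R hJz).toLinearMap
            (Ideal.Quotient.factor_surjective hJz)
        have h2 := Ideal.isMaximal_comap_of_isIntegral_of_isMaximal (R := R) (⊥ : Ideal (P ⧸ z))
        rwa [IsScalarTower.algebraMap_eq R P (P ⧸ z), ← Ideal.comap_comap,
          Ideal.Quotient.algebraMap_eq, ← RingHom.ker_eq_comap_bot, Ideal.mk_ker] at h2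
      have hfin' : Finite (R ⧸ z.comap (algebraMap R P)) :=
        Finite.of_injective _ (Ideal.quotientMap_injective (I := z) (f := algebraMap R P))
      have h1 := (hqR _ hy).resolve_right fun hchar =>
        _root_.not_finite (R ⧸ z.comap (algebraMap R P))
      rwa [Ideal.mem_comap, map_natCast] at h1
    · right
      intro k
      rw [coeff_add, map_add, Ideal.Quotient.eq_zero_iff_mem.2 (hk k), add_zero, coeff_X_pow]
      split_ifs
      · rw [map_one]; exact isIntegral_one
      · rw [map_zero]; exact isIntegral_zero
  obtain ⟨P', _, _, _, _, t, δ', het, ht, hδ', hker, hext, hfin⟩ := exists_cover (J := J) δ hq hqR hM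
    hE hdeg (by rw [hcoeff0]; exact hDδ 0) hi
  refine ⟨P', inferInstance, inferInstance, inferInstance, inferInstance, t, δ', M, r, D, het, hMn,
    hr, hDδ, by rw [← ht]; simp, hδ', hker, hfin, ?_⟩
  intro y _ hy φ ψ hφ hψ hφψ
  let φ₀ : P →ₐ[R] AlgebraicClosure y.ResidueField := φ.comp (IsScalarTower.toAlgHom R P P')
  let ψ₀ : P →ₐ[R] AlgebraicClosure y.ResidueField := ψ.comp (IsScalarTower.toAlgHom R P P')
  have hφ₀ : J ≤ RingHom.ker φ₀ := fun x hx => hφ (Ideal.mem_map_of_mem _ hx)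
  have hψ₀ : J ≤ RingHom.ker ψ₀ := fun x hx => hψ (Ideal.mem_map_of_mem _ hx)
  have hroot : ∀ φ : P' →ₐ[R] AlgebraicClosure y.ResidueField,
      φ t + ((φ t ^ M - 1) * (((X ^ r + D).map
        (φ.comp (IsScalarTower.toAlgHom R P P') : P →+* AlgebraicClosure y.ResidueField)).eval
          (φ t))) ^ q = 0 := by
    intro φ
    have h1 := congr_arg φ ht
    have h2 : φ (aeval t (X ^ r + D)) = ((X ^ r + D).map
        (φ.comp (IsScalarTower.toAlgHom R P P') : P →+* AlgebraicClosure y.ResidueField)).eval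
          (φ t) := by
      rw [Polynomial.eval_map, aeval_def]
      exact hom_eval₂ _ _ (φ : P' →+* AlgebraicClosure y.ResidueField) _
    rw [map_add, map_pow, map_mul, map_sub, map_pow, map_one, map_zero, h2] at h1
    exact h1
  have hmap : ∀ φ : P →+* AlgebraicClosure y.ResidueField,
      (X ^ r + D).map φ = X ^ r + D.map φ := fun φ => by simp
  have h0 : ∀ φ : P →+* AlgebraicClosure y.ResidueField,
      ((X ^ r + D).map φ).eval 0 = φ (D.coeff 0) := fun φ => by
    rw [← coeff_zero_eq_eval_zero, coeff_map, hcoeff0]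
  -- The common coordinate is a root of both specialized equations. So the specializations coincide,
  -- or both have constant term 0; these are the two cases in which D separates.
  have key := eq_or_eq_zero_of_common_root (hE.map (φ₀ : P →+* AlgebraicClosure y.ResidueField))
    (hE.map (ψ₀ : P →+* AlgebraicClosure y.ResidueField)) hM (by omega : q ≠ 0)
    (hM' y hy φ₀ ψ₀ hφ₀ hψ₀) (hroot φ) (by rw [hφψ]; exact hroot ψ)
  rw [h0, h0, hmap, hmap, add_right_inj] at key
  have h1 := hsep y hy φ₀ ψ₀ hφ₀ hψ₀ key
  have h2 := hext (φ : P' →+* AlgebraicClosure y.ResidueField)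
    (ψ : P' →+* AlgebraicClosure y.ResidueField)
    (congr_arg (fun χ : P →ₐ[R] AlgebraicClosure y.ResidueField =>
      (χ : P →+* AlgebraicClosure y.ResidueField)) h1) hφψ
  exact AlgHom.coe_ringHom_injective h2

/-- A complementary function of the section in the preimage of `Y` that is `0` or `1` at the closed
points. -/
theorem exists_idempotent_lift [Finite (MaximalSpectrum R)] (J I L : Ideal P)
    [Module.Finite R (P ⧸ J)] {e : P} (he : e * (1 - e) ∈ I) (hL : L = I ⊔ Ideal.span {e}) :
    ∃ e' : P, e' * (1 - e') ∈ I ∧ L = I ⊔ Ideal.span {e'} ∧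
      ∀ z : Ideal P, z.IsMaximal → J ≤ z → e' ∈ z ∨ e' - 1 ∈ z := by
  classical
  let Zs := {z : MaximalSpectrum P // J ≤ z.asIdeal}
  have hZs : Finite Zs := finite_maximalSpectrum_of_quotient (R := R) J
  -- w ∈ I matches e at the closed points off V(I), so e − w vanishes there. On V(I) it remains
  -- idempotent, hence 0 or 1 at each point; this is the integrality needed for the first cover.
  obtain ⟨w, hw, hwz⟩ := exists_mem_forall_sub_mem I (fun z : Zs => z.1.asIdeal)
    (fun z => z.1.isMaximal) (fun z w h => Subtype.ext (MaximalSpectrum.ext h))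
    (fun z => if I ≤ z.1.asIdeal then 0 else e) fun z hz => by rw [if_pos hz]; exact zero_mem _
  have h1 : (e - w) * (1 - (e - w)) ∈ I := by
    rw [show (e - w) * (1 - (e - w)) = e * (1 - e) + w * (2 * e - 1 - w) by ring]
    exact add_mem he (I.mul_mem_right _ hw)
  refine ⟨e - w, h1, ?_, ?_⟩
  · rw [hL]
    apply le_antisymm
    · refine sup_le le_sup_left ((Ideal.span_singleton_le_iff_mem _).2 ?_)
      have h2 : e - w + w ∈ I ⊔ Ideal.span {e - w} :=
        add_mem (Ideal.mem_sup_right (Ideal.mem_span_singleton_self _)) (Ideal.mem_sup_left hw)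
      rwa [sub_add_cancel] at h2
    · refine sup_le le_sup_left ((Ideal.span_singleton_le_iff_mem _).2 ?_)
      exact sub_mem (Ideal.mem_sup_right (Ideal.mem_span_singleton_self _)) (Ideal.mem_sup_left hw)
  · intro z hz hJz
    by_cases hI : I ≤ z
    · refine (hz.isPrime.mem_or_mem (hI h1)).imp_right fun h => ?_
      rw [← neg_sub]
      exact neg_mem h
    · left
      have h2 := hwz ⟨⟨z, hz⟩, hJz⟩
      rw [if_neg hI] at h2
      rw [← neg_sub]
      exact neg_mem h2

/-- The tower of two étale covers: the first provides integral units off the section, the second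
also separates the geometric points over finite residue fields. -/
theorem exists_tower [Nontrivial R] [Finite (MaximalSpectrum R)] (J I : Ideal P)
    [Module.Finite R (P ⧸ J)] (δ : P →ₐ[R] R) {e : P} (he : e * (1 - e) ∈ I)
    (hδ : RingHom.ker δ = I ⊔ Ideal.span {e}) (n : ℕ) :
    ∃ (P' : Type u) (_ : CommRing P') (_ : Algebra P P') (_ : Algebra R P')
      (_ : IsScalarTower R P P') (δ' : P' →ₐ[R] R), Algebra.Etale P P' ∧
      (∀ x, δ' (algebraMap P P' x) = δ x) ∧ Module.Finite R (P' ⧸ J.map (algebraMap P P')) ∧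
      (∀ (y : Ideal R) [y.IsMaximal], Finite (R ⧸ y) → ∃ t ∈ RingHom.ker δ',
        ∀ φ ψ : P' →ₐ[R] AlgebraicClosure y.ResidueField,
          J.map (algebraMap P P') ≤ RingHom.ker φ → J.map (algebraMap P P') ≤ RingHom.ker ψ →
          φ t = ψ t → φ = ψ) ∧
      ∀ {S : Type u} [CommRing S] (f : P' →+* S), (∀ x ∈ I, f (algebraMap P P' x) = 0) →
        (RingHom.ker δ').map f = ⊤ → HasIntegralUnits n S := by
  obtain ⟨q, hq, hq2, hqR⟩ := exists_even_residue_char R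
  obtain ⟨e', he', hδe, hez⟩ := exists_idempotent_lift (R := R) J I _ he hδ
  have hP : Nontrivial P := (δ : P →+* R).domain_nontrivial
  have heδ : e' ∈ RingHom.ker δ := by
    rw [hδe]; exact Ideal.mem_sup_right (Ideal.mem_span_singleton_self _)
  -- With E = X − e' the equation has constant term 1 where e' = 1, and the root 0 lifts the section
  -- where e' = 0.
  obtain ⟨P₁, _, _, _, _, t₁, δ₁, het₁, ht₁, hδ₁, hker₁, -, hfin₁⟩ := exists_cover (J := J)
    (E := X - C e') δ hq hqR n.factorial_ne_zero (monic_X_sub_C e')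
    (by rw [natDegree_X_sub_C]; exact one_pos)
    (by
      rw [coeff_sub, coeff_X_zero, coeff_C_zero, zero_sub, map_neg, neg_eq_zero]
      exact heδ)
    (fun z hz hJz => Or.inr fun k => by
      have hint : IsIntegral ℤ (Ideal.Quotient.mk z e') := by
        rcases hez z hz hJz with h | h
        · rw [Ideal.Quotient.eq_zero_iff_mem.2 h]; exact isIntegral_zero
        · have h1 := Ideal.Quotient.eq.2 h
          rw [map_one] at h1
          rw [h1]; exact isIntegral_one
      rw [coeff_sub, coeff_X, coeff_C, map_sub]
      refine IsIntegral.sub ?_ ?_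
      · split_ifs
        · rw [map_one]; exact isIntegral_one
        · rw [map_zero]; exact isIntegral_zero
      · split_ifs
        · exact hint
        · rw [map_zero]; exact isIntegral_zero)
  obtain ⟨P₂, _, _, _, _, t₂, δ₂, M, r, D, het₂, hM, hr, hD, ht₂, hδ₂, hker₂, hfin₂, hsep⟩ :=
    exists_separating_cover (J.map (algebraMap P P₁)) δ₁ hq hqR n
  let _ : Algebra P P₂ := ((algebraMap P₁ P₂).comp (algebraMap P P₁)).toAlgebra
  have tower₁ : IsScalarTower P P₁ P₂ := .of_algebraMap_eq' rfl
  have tower₂ : IsScalarTower R P P₂ := .of_algebraMap_eq fun x => by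
    rw [IsScalarTower.algebraMap_apply R P₁ P₂, IsScalarTower.algebraMap_apply R P P₁]
    rfl
  have hJ : J.map (algebraMap P P₂) = (J.map (algebraMap P P₁)).map (algebraMap P₁ P₂) :=
    (Ideal.map_map _ _).symm
  refine ⟨P₂, inferInstance, inferInstance, inferInstance, tower₂, δ₂, Algebra.Etale.comp P P₁ P₂,
    fun x => (hδ₂ _).trans (hδ₁ x), by rw [hJ]; exact hfin₂, ?_, ?_⟩
  · intro y _ hy
    refine ⟨t₂, ?_, ?_⟩
    · rw [hker₂]; exact Ideal.mem_sup_right (Ideal.mem_span_singleton_self _)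
    · rw [hJ]; exact hsep y hy
  · intro S _ f hf htop
    let f₁ : P₁ →+* S := f.comp (algebraMap P₁ P₂)
    let f₀ : P →+* S := f.comp (algebraMap P P₂)
    have hf0 : ∀ x, f₁ (algebraMap P P₁ x) = f₀ x := fun x => rfl
    -- Since f kills I, the kernel of the first section becomes generated by e' and t₁. The
    -- coefficients of D lie in that kernel, which gives the membership required of x.
    have hk₁ : (RingHom.ker δ₁).map f₁ ≤ Ideal.span {f₀ e', f₁ t₁} := by
      rw [hker₁, hδe, Ideal.map_sup, Ideal.map_sup, Ideal.map_sup, Ideal.map_map, Ideal.map_map,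
        Ideal.map_span, Ideal.map_span, Set.image_singleton, Set.image_singleton]
      refine sup_le (sup_le ?_ ?_) ?_
      · rw [Ideal.map_le_iff_le_comap]
        intro x hx
        have h1 : (f₁.comp (algebraMap P P₁)) x = 0 := hf x hx
        rw [Ideal.mem_comap, h1]
        exact zero_mem _
      · exact Ideal.span_mono (by simp [hf0])
      · exact Ideal.span_mono (by simp)
    refine hasIntegralUnits_of_tower (e := f₀ e') (t₁ := f₁ t₁) (t₂ := f t₂)
      (x := f (aeval t₂ D)) (M := n.factorial) (M' := M) (r := r) (q := q) dvd_rfl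
      n.factorial_ne_zero hM hr hq hq2 ?_ ?_ ?_ ?_ ?_
    · have := hf _ he'
      change f₀ (e' * (1 - e')) = 0 at this
      rwa [map_mul, map_sub, map_one] at this
    · have := congr_arg f₁ ht₁
      simpa [hf0] using this
    · have := congr_arg f ht₂
      simpa using this
    · rw [aeval_eq_sum_range, map_sum]
      refine Ideal.sum_mem _ fun k _ => ?_
      rw [Algebra.smul_def, map_mul]
      exact Ideal.mul_mem_right _ _ (hk₁ (Ideal.mem_map_of_mem f₁ (hD k)))
    · rw [eq_top_iff, ← htop, hker₂, Ideal.map_sup, Ideal.map_map, Ideal.map_span,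
        Set.image_singleton]
      refine sup_le (hk₁.trans (Ideal.span_mono ?_)) (Ideal.span_mono (by simp))
      rintro _ (rfl | rfl) <;> simp

end Tower

/-! ### Geometric form of the tower -/

/-- A closed immersion that factors through an open and closed subscheme is cut out by one more
function that is idempotent modulo the given one. -/
theorem exists_ker_eq_sup_span {X D T : Scheme.{u}} [IsAffine X] [IsAffine D] [IsAffine T]
    (ρ : T ⟶ D) [IsClosedImmersion ρ] [IsOpenImmersion ρ] (δ : D ⟶ X) [IsClosedImmersion δ] :
    ∃ e : Γ(X, ⊤), e * (1 - e) ∈ RingHom.ker δ.appTop.hom ∧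
      RingHom.ker (ρ ≫ δ).appTop.hom = RingHom.ker δ.appTop.hom ⊔ Ideal.span {e} := by
  have h1 : Spec.map ρ.appTop = T.isoSpec.inv ≫ ρ ≫ D.isoSpec.hom := by
    rw [Iso.eq_inv_comp]
    exact (Scheme.isoSpec_hom_naturality ρ)
  have h2 : IsOpenImmersion (Spec.map ρ.appTop) := by
    rw [h1]
    infer_instance
  have hρ := (IsClosedImmersion.isAffine_surjective_of_isAffine ρ).2
  have hδ := (IsClosedImmersion.isAffine_surjective_of_isAffine δ).2
  obtain ⟨c, hc, hk⟩ := (isOpenImmersion_SpecMap_iff_of_surjective _ hρ).1 h2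
  obtain ⟨e, he⟩ := hδ c
  have he' : δ.appTop.hom e = c := he
  refine ⟨e, ?_, ?_⟩
  · rw [RingHom.mem_ker, map_mul, map_sub, map_one, he', mul_sub, mul_one, hc.eq, sub_self]
  · have h3 : RingHom.ker (ρ ≫ δ).appTop.hom =
        (RingHom.ker ρ.appTop.hom).comap δ.appTop.hom := by
      rw [Scheme.Hom.comp_appTop, CommRingCat.hom_comp, RingHom.comap_ker]
    rw [h3, hk, ← he', ← Set.image_singleton, ← Ideal.map_span, Ideal.comap_map_of_surjective' _ hδ,
      sup_comm]

/-- An étale algebra over the ring of functions on an affine scheme, as a scheme. -/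
theorem exists_etale_of_ringHom {X₀ Y : Scheme.{u}} [IsAffine X₀] [IsAffine Y] (s : Y ⟶ X₀)
    {P : Type u} [CommRing P] (φ : Γ(X₀, ⊤) →+* P) (hφ : φ.Etale) (δ : P →+* Γ(Y, ⊤))
    (h : δ.comp φ = s.appTop.hom) :
    ∃ (X : Scheme.{u}) (_ : IsAffine X) (o : X ⟶ X₀) (ε : P ≃+* Γ(X, ⊤)) (s' : Y ⟶ X), Etale o ∧
      (∀ x, o.appTop.hom x = ε (φ x)) ∧ s' ≫ o = s ∧ ∀ x, s'.appTop.hom (ε x) = δ x := by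
  let o : Spec (CommRingCat.of P) ⟶ X₀ := Spec.map (CommRingCat.ofHom φ) ≫ X₀.isoSpec.inv
  let s' : Y ⟶ Spec (CommRingCat.of P) := Y.isoSpec.hom ≫ Spec.map (CommRingCat.ofHom δ)
  have h1 : Etale (Spec.map (CommRingCat.ofHom φ)) := (HasRingHomProperty.Spec_iff (P := @Etale)).2 hφ
  refine ⟨Spec (CommRingCat.of P), inferInstance, o,
    (Scheme.ΓSpecIso (CommRingCat.of P)).symm.commRingCatIsoToRingEquiv, s',
    inferInstanceAs (Etale (_ ≫ _)), ?_, ?_, ?_⟩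
  · intro x
    have h4 : X₀.isoSpec.inv.appTop = (Scheme.ΓSpecIso Γ(X₀, ⊤)).inv := by
      have h5 : X₀.isoSpec.inv.appTop ≫ X₀.isoSpec.hom.appTop = 𝟙 _ := by
        rw [← Scheme.Hom.comp_appTop, Iso.hom_inv_id, Scheme.Hom.id_appTop]
      rw [Scheme.isoSpec_hom, Scheme.toSpecΓ_appTop] at h5
      exact (Iso.comp_hom_eq_id _).1 h5
    have h3 : o.appTop = CommRingCat.ofHom φ ≫ (Scheme.ΓSpecIso (CommRingCat.of P)).inv := by
      rw [Scheme.ΓSpecIso_inv_naturality]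
      exact (Scheme.Hom.comp_appTop _ _).trans (by rw [h4]; rfl)
    exact congr_arg (fun f => f.hom x) h3
  · have h2 : CommRingCat.ofHom φ ≫ CommRingCat.ofHom δ = s.appTop := by
      ext x
      exact congr_arg (fun f : Γ(X₀, ⊤) →+* Γ(Y, ⊤) => f x) h
    change (Y.isoSpec.hom ≫ Spec.map (CommRingCat.ofHom δ)) ≫ Spec.map (CommRingCat.ofHom φ) ≫
      X₀.isoSpec.inv = s
    rw [Category.assoc, ← Spec.map_comp_assoc, h2, Scheme.isoSpec_hom_naturality_assoc,
      Iso.hom_inv_id, Category.comp_id]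
  · intro x
    have h3 : (Scheme.ΓSpecIso (CommRingCat.of P)).inv ≫ s'.appTop = CommRingCat.ofHom δ := by
      have h4 : s'.appTop = (Spec.map (CommRingCat.ofHom δ)).appTop ≫
          (Scheme.ΓSpecIso Γ(Y, ⊤)).hom := by
        rw [← Scheme.toSpecΓ_appTop]
        exact Scheme.Hom.comp_appTop _ _
      rw [h4, ← Scheme.ΓSpecIso_inv_naturality_assoc]
      exact (congr_arg (fun f => CommRingCat.ofHom δ ≫ f)
        (Iso.inv_hom_id (Scheme.ΓSpecIso Γ(Y, ⊤)))).trans (Category.comp_id _)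
    exact congr_arg (fun f => f.hom x) h3

theorem isFinite_of_appTop {X Y : Scheme.{u}} {f : X ⟶ Y} [IsAffine Y] (hX : IsAffine X)
    (hf : f.appTop.hom.Finite) : IsFinite f := by
  have h1 : f = X.isoSpec.hom ≫ Spec.map f.appTop ≫ Y.isoSpec.inv := by
    rw [Scheme.isoSpec_hom_naturality_assoc, Iso.hom_inv_id, Category.comp_id]
  have h2 : IsFinite (Spec.map f.appTop) := (IsFinite.SpecMap_iff _).2 hf
  rw [h1]
  infer_instance

/-- Over a scheme `Y` with a section there is an étale cover, to which the section lifts, such that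
a function vanishing on the lift separates points over the closed points with finite residue fields,
and such that closed subschemes disjoint from the lift have sufficiently many integral units. -/
theorem exists_etale_separating {X₀ Y Z₀ D₀ : Scheme.{u}} [IsAffine X₀] [IsAffine Y]
    [Nontrivial Γ(Y, ⊤)] [Finite (MaximalSpectrum Γ(Y, ⊤))] (ζ : Z₀ ⟶ X₀) [IsClosedImmersion ζ]
    (δ : D₀ ⟶ X₀) [IsClosedImmersion δ] (x₀ : X₀ ⟶ Y) [IsFinite (ζ ≫ x₀)] (ρ : Y ⟶ D₀)
    [IsClosedImmersion ρ] [IsOpenImmersion ρ] (hρ : (ρ ≫ δ) ≫ x₀ = 𝟙 Y) (n : ℕ) :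
    ∃ (X : Scheme.{u}) (_ : IsAffine X) (o : X ⟶ X₀) (s : Y ⟶ X), Etale o ∧ s ≫ o = ρ ≫ δ ∧
      (∀ {W : Scheme.{u}} (w : W ⟶ X) [IsClosedImmersion w] (l : W ⟶ Z₀), l ≫ ζ = w ≫ o →
        IsFinite (w ≫ o ≫ x₀) ∧
        letI := (o ≫ x₀).appTop.hom.toAlgebra
        ∀ (y : Ideal Γ(Y, ⊤)) [y.IsMaximal], Finite (Γ(Y, ⊤) ⧸ y) →
          ∃ f ∈ RingHom.ker s.appTop.hom,
            ∀ φ ψ : Γ(X, ⊤) →ₐ[Γ(Y, ⊤)] AlgebraicClosure y.ResidueField,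
              RingHom.ker w.appTop.hom ≤ RingHom.ker φ →
              RingHom.ker w.appTop.hom ≤ RingHom.ker ψ → φ f = ψ f → φ = ψ) ∧
      ∀ {W : Scheme.{u}} (w : W ⟶ X) [IsClosedImmersion w] (l : W ⟶ D₀), l ≫ δ = w ≫ o →
        Disjoint (Set.range s) (Set.range w) → HasIntegralUnits n Γ(W, ⊤) := by
  have : IsAffine D₀ := isAffine_of_isAffineHom δ
  let _ : Algebra Γ(Y, ⊤) Γ(X₀, ⊤) := x₀.appTop.hom.toAlgebra
  obtain ⟨e, he, he'⟩ := exists_ker_eq_sup_span ρ δ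
  obtain ⟨N, b, hb⟩ := exists_span_appTop_of_isFinite (ζ ≫ x₀)
  obtain ⟨b', hb'⟩ := finite_quotient_ker ζ x₀ b hb
  have hmf : Module.Finite Γ(Y, ⊤) (Γ(X₀, ⊤) ⧸ RingHom.ker ζ.appTop.hom) :=
    ⟨(Submodule.fg_def).2 ⟨_, Set.finite_range b', hb'⟩⟩
  obtain ⟨P, _, _, _, _, δ', hét, hδ', hfin, hsep, hunits⟩ := exists_tower
    (RingHom.ker ζ.appTop.hom) (RingHom.ker δ.appTop.hom) (sectionAlgHom (ρ ≫ δ) x₀ hρ) he he' n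
  obtain ⟨X, hX, o, ε, s, ho, hoε, hs, hsδ⟩ := exists_etale_of_ringHom (ρ ≫ δ)
    (algebraMap Γ(X₀, ⊤) P) ((RingHom.etale_algebraMap).2 hét) δ'.toRingHom
    (RingHom.ext fun x => hδ' x)
  have hker : ∀ {W V : Scheme.{u}} (w : W ⟶ X) (l : W ⟶ V) (v : V ⟶ X₀), l ≫ v = w ≫ o →
      ∀ x ∈ RingHom.ker v.appTop.hom, w.appTop.hom (ε (algebraMap Γ(X₀, ⊤) P x)) = 0 := by
    intro W V w l v hl x hx
    rw [← hoε]
    have h1 : (w ≫ o).appTop.hom x = l.appTop.hom (v.appTop.hom x) := by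
      rw [← hl, Scheme.Hom.comp_appTop]
      rfl
    rw [(RingHom.mem_ker).1 hx, map_zero, Scheme.Hom.comp_appTop] at h1
    exact h1
  have hox : ∀ r, (o ≫ x₀).appTop.hom r = ε (algebraMap Γ(Y, ⊤) P r) := by
    intro r
    rw [Scheme.Hom.comp_appTop, IsScalarTower.algebraMap_apply Γ(Y, ⊤) Γ(X₀, ⊤) P]
    exact hoε _
  refine ⟨X, hX, o, s, ho, hs, fun {W} w _ l hl => ⟨?_, ?_⟩, fun {W} w _ l hl hdisj => ?_⟩
  · obtain ⟨hW, hw⟩ := IsClosedImmersion.isAffine_surjective_of_isAffine w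
    refine isFinite_of_appTop hW ?_
    have hle : ∀ x ∈ (RingHom.ker ζ.appTop.hom).map (algebraMap Γ(X₀, ⊤) P),
        (w.appTop.hom.comp ε.toRingHom) x = 0 := fun x hx => by
      refine (Ideal.map_le_iff_le_comap.2 ?_ : _ ≤ RingHom.ker (w.appTop.hom.comp ε.toRingHom)) hx
      exact fun x hx => hker w l ζ hl x hx
    have h1 : (w ≫ o ≫ x₀).appTop.hom = (Ideal.Quotient.lift _ _ hle).comp
        (algebraMap Γ(Y, ⊤) (P ⧸ (RingHom.ker ζ.appTop.hom).map (algebraMap Γ(X₀, ⊤) P))) := by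
      ext r
      rw [Scheme.Hom.comp_appTop]
      exact congr_arg w.appTop.hom (hox r)
    rw [h1]
    refine RingHom.Finite.comp (RingHom.Finite.of_surjective _ ?_) ((RingHom.finite_algebraMap).2 hfin)
    refine Ideal.Quotient.lift_surjective_of_surjective _ _ ?_
    exact hw.comp ε.surjective
  · intro y hy hfy
    let _ : Algebra Γ(Y, ⊤) Γ(X, ⊤) := (o ≫ x₀).appTop.hom.toAlgebra
    obtain ⟨f, hf, hsepf⟩ := hsep y hfy
    let ε' : P →ₐ[Γ(Y, ⊤)] Γ(X, ⊤) := { ε.toRingHom with commutes' := fun r => (hox r).symm }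
    have hε : ∀ φ : Γ(X, ⊤) →ₐ[Γ(Y, ⊤)] AlgebraicClosure y.ResidueField,
        RingHom.ker w.appTop.hom ≤ RingHom.ker φ →
        (RingHom.ker ζ.appTop.hom).map (algebraMap Γ(X₀, ⊤) P) ≤ RingHom.ker (φ.comp ε') :=
      fun φ hφ => Ideal.map_le_iff_le_comap.2 fun x hx => hφ (hker w l ζ hl x hx)
    refine ⟨ε f, (hsδ f).trans hf, fun φ ψ hφ hψ h => ?_⟩
    have h2 := hsepf (φ.comp ε') (ψ.comp ε') (hε φ hφ) (hε ψ hψ) h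
    ext x
    obtain ⟨x, rfl⟩ := ε.surjective x
    exact congr_arg (fun f : P →ₐ[Γ(Y, ⊤)] AlgebraicClosure y.ResidueField => f x) h2
  · obtain ⟨hW, hw⟩ := IsClosedImmersion.isAffine_surjective_of_isAffine w
    refine hunits (w.appTop.hom.comp ε.toRingHom) (fun x hx => hker w l δ hl x hx) ?_
    have hss : Function.Surjective s.appTop.hom := surjective_appTop_of_section s (o ≫ x₀)
      (by rw [← Category.assoc, hs, hρ])
    -- Disjointness from s makes the kernel of the section generate the unit ideal on W, as the
    -- integral units require.
    have hco := isCoprime_ker_of_disjoint_range s w hss hw hdisj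
    have h1 : RingHom.ker s.appTop.hom = (RingHom.ker δ').map ε.toRingHom := by
      ext x
      obtain ⟨x, rfl⟩ := ε.surjective x
      rw [RingHom.mem_ker, hsδ]
      refine ⟨fun h => Ideal.mem_map_of_mem ε.toRingHom h, fun h => ?_⟩
      obtain ⟨x', hx', hxx⟩ := (Ideal.mem_map_iff_of_surjective ε.toRingHom ε.surjective).1 h
      rwa [← ε.injective hxx]
    rw [← Ideal.map_map, ← h1, eq_top_iff]
    rw [Ideal.isCoprime_iff_sup_eq] at hco
    have h2 := congr_arg (Ideal.map w.appTop.hom) hco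
    rw [Ideal.map_sup, Ideal.map_top, (Ideal.map_eq_bot_iff_le_ker _).2 le_rfl, sup_bot_eq] at h2
    exact h2.ge

/-! ### Conclusion -/

section Extension

variable {A : Type u} [CommRing A] {d : ℕ} {C : Scheme.{u}} {p : C ⟶ Spec (CommRingCat.of A)}
  {hp : SmoothOfRelativeDimension d p} {hC : IsAffine C} {F : (Punctured A d)ᵒᵖ ⥤ Pointed.{v}}
  {U V : Punctured A d} {j : U ⟶ Punctured.ofAffine p hC hp} {k : V ⟶ U} {a : F.obj (op U)}
  {Y Z : Scheme.{u}} {i : Y ⟶ C} {z : Z ⟶ C}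

/-- Y is clopen in the preimage of Y in X through s, and is the whole preimage in C; excision along
it descends the extension. -/
theorem ExtendsOff.id_of_etale [IsClosedImmersion i] [IsFinite (i ≫ p)] [Etale (i ≫ p)]
    (hF : IsExcisive F) (hj : IsComplement j (Set.range i)) {X : Scheme.{u}} {g : X ⟶ C}
    [IsAffine X] [Etale g] (hfin : IsFinite (pullback.snd i g ≫ g ≫ p)) (s : Y ⟶ X)
    (hs : s ≫ g = i) (h : ExtendsOff p hp hC F j a g ∅) :
    ExtendsOff p hp hC F j a (𝟙 C) ∅ := by
  let ρ : Y ⟶ pullback i g := pullback.lift (𝟙 Y) s (by rw [Category.id_comp, hs])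
  let ρ' : Y ⟶ pullback i (𝟙 C) := pullback.lift (𝟙 Y) i (by simp)
  have hρs : ρ ≫ pullback.snd i g = s := pullback.lift_snd _ _ _
  have hρf : ρ ≫ pullback.fst i g = 𝟙 Y := pullback.lift_fst _ _ _
  have hρs' : ρ' ≫ pullback.snd i (𝟙 C) = i := pullback.lift_snd _ _ _
  have hρf' : ρ' ≫ pullback.fst i (𝟙 C) = 𝟙 Y := pullback.lift_fst _ _ _
  have hmono : Mono ρ := mono_of_mono_fac hρf
  have hmono' : Mono ρ' := mono_of_mono_fac hρf'
  have hfin' : IsFinite (pullback.snd i (𝟙 C) ≫ 𝟙 C ≫ p) := by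
    rw [← reassoc_of% (pullback.condition (f := i) (g := 𝟙 C)), Category.id_comp]
    infer_instance
  have het : Etale (pullback.snd i g ≫ g ≫ p) := etale_pullback_snd g
  have hcomp : ρ ≫ pullback.snd i g ≫ g ≫ p = i ≫ p := by rw [reassoc_of% hρs, reassoc_of% hs]
  have hcomp' : ρ' ≫ pullback.snd i (𝟙 C) ≫ 𝟙 C ≫ p = i ≫ p := by
    rw [reassoc_of% hρs', Category.id_comp]
  have hcl : IsClopen (Set.range ρ) := isClopen_range_of_mono ρ (pullback.snd i g ≫ g ≫ p)
    (by rw [hcomp]; infer_instance) (by rw [hcomp]; infer_instance)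
  have h1 : ExtendsOff p hp hC F j a g (pullback.snd i g '' (Set.range ρ)ᶜ) :=
    h.mono (Set.empty_subset _) (isFiniteEtaleSubset_pullback_image g hfin hcl.compl)
  have h2 := ExtendsOff.excision_of_mono hF hj g (Category.comp_id g) hfin hfin' ρ ρ'
    (by rw [reassoc_of% hρs, hs, hρs']) (by rw [hcomp']; infer_instance)
    (by rw [hcomp']; infer_instance) h1
  have h3 : Set.range ρ' = Set.univ := by
    have : IsIso ρ' := by
      have h4 : IsIso (ρ' ≫ pullback.fst i (𝟙 C)) := by rw [hρf']; infer_instance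
      exact IsIso.of_isIso_comp_right ρ' (pullback.fst i (𝟙 C))
    exact ρ'.surjective.range_eq
  rwa [h3, Set.compl_univ, Set.image_empty] at h2

theorem ExtendsOff.id [Finite (MaximalSpectrum A)] [IsClosedImmersion i]
    [IsClosedImmersion z] [IsFinite (i ≫ p)] [Etale (i ≫ p)] [IsFinite (z ≫ p)] (hd : 0 < d)
    (hF : IsExcisive F) (hj : IsComplement j (Set.range i))
    (hk : IsComplement (k ≫ j) (Set.range z))
    (ha : (F.map k.op).toFun a = (F.obj (op V)).point) {ℓ : Y ⟶ Z} (hℓ : ℓ ≫ z = i)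
    (hA : HasGoodSections F (i ≫ p)) : ExtendsOff p hp hC F j a (𝟙 C) ∅ := by
  have hYaff : IsAffine Y := isAffine_of_isAffineHom (i ≫ p)
  rcases isEmpty_or_nonempty Y with hY | hY
  · refine ExtendsOff.of_preimage hj ?_ (isFiniteEtaleSubset_empty _)
    rintro _ ⟨y, -⟩
    exact (hY.false y).elim
  have hYnt : Nontrivial Γ(Y, ⊤) := by
    have : Nonempty (⊤ : Y.Opens) := hY.map fun y => ⟨y, trivial⟩
    exact Scheme.component_nontrivial Y ⊤
  have hms : Finite (MaximalSpectrum Γ(Y, ⊤)) := finite_maximalSpectrum_appTop (i ≫ p)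
  let t : Y ⟶ Spec (CommRingCat.of A) := i ≫ p
  let x₀ : pullback p t ⟶ Y := pullback.snd p t
  let g₀ : pullback p t ⟶ C := pullback.fst p t
  have hsm : SmoothOfRelativeDimension d x₀ := by
    let P : MorphismProperty Scheme.{u} := @SmoothOfRelativeDimension.{u} d
    have : P.IsStableUnderBaseChange := smoothOfRelativeDimension_isStableUnderBaseChange d
    exact MorphismProperty.pullback_snd (P := P) p t hp
  let Δ₀ : Y ⟶ pullback p t := pullback.lift i (𝟙 Y) (Category.id_comp _).symm
  have hΔf : Δ₀ ≫ g₀ = i := pullback.lift_fst _ _ _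
  have hΔs : Δ₀ ≫ x₀ = 𝟙 Y := pullback.lift_snd _ _ _
  let ρ₀ : Y ⟶ pullback i g₀ := pullback.lift (𝟙 Y) Δ₀ (by rw [Category.id_comp, hΔf])
  have hρf : ρ₀ ≫ pullback.fst i g₀ = 𝟙 Y := pullback.lift_fst _ _ _
  have hρs : ρ₀ ≫ pullback.snd i g₀ = Δ₀ := pullback.lift_snd _ _ _
  have hcond : x₀ ≫ t = g₀ ≫ p := pullback.condition.symm
  have hg₀ : IsFinite g₀ ∧ Etale g₀ :=
    ⟨inferInstanceAs (IsFinite (pullback.fst p t)), inferInstanceAs (Etale (pullback.fst p t))⟩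
  obtain ⟨hg₀f, hg₀e⟩ := hg₀
  have hfin₀ : ∀ {W : Scheme.{u}} (w : W ⟶ C) [IsFinite (w ≫ p)],
      IsFinite (pullback.snd w g₀ ≫ g₀ ≫ p) := by
    intro W w _
    rw [← reassoc_of% (pullback.condition (f := w) (g := g₀))]
    infer_instance
  have het₀ : Etale (pullback.snd i g₀ ≫ g₀ ≫ p) := etale_pullback_snd g₀
  have hfin₁ := hfin₀ i
  have hmono : Mono ρ₀ := mono_of_mono_fac hρf
  have hcomp : ρ₀ ≫ pullback.snd i g₀ ≫ g₀ ≫ p = t := by rw [reassoc_of% hρs, reassoc_of% hΔf]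
  obtain ⟨hρc, hρo⟩ := isClosedImmersion_isOpenImmersion_of_mono ρ₀ (pullback.snd i g₀ ≫ g₀ ≫ p)
    (by rw [hcomp]; infer_instance) (by rw [hcomp]; infer_instance)
  have hζfin : IsFinite (pullback.snd z g₀ ≫ x₀) :=
    isFinite_of_comp_eq _ x₀ t (by rw [hcond]; exact hfin₀ z)
  have hX₀ : IsAffine (pullback p t) := isAffine_of_isAffineHom g₀
  obtain ⟨N, e, he⟩ := exists_span_appTop_of_isFinite (z ≫ p)
  obtain ⟨N', e', he'⟩ := exists_span_appTop_of_isFinite (i ≫ p)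
  -- The number of units exceeds N + N * N, for the generic choice of coordinates, and is at least
  -- N', for the good sections.
  obtain ⟨X, hX, o, s, ho, hs, hsep, hunits⟩ := exists_etale_separating (pullback.snd z g₀)
    (pullback.snd i g₀) x₀ ρ₀ (by rw [hρs, hΔs]) (N + N * N + 1 + N')
  let g : X ⟶ C := o ≫ g₀
  let x : X ⟶ Y := o ≫ x₀
  have hge : Etale g := inferInstanceAs (Etale (o ≫ g₀))
  have hos : Smooth o := inferInstance
  have hxs : SmoothOfRelativeDimension d x := by
    have h1 := smoothOfRelativeDimension_comp (n := 0) (m := d) o x₀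
    rwa [zero_add] at h1
  have hx : x ≫ t = g ≫ p := by
    change (o ≫ x₀) ≫ t = (o ≫ g₀) ≫ p
    rw [Category.assoc, hcond, Category.assoc]
  have hsg : s ≫ g = i := by
    change s ≫ o ≫ g₀ = i
    rw [reassoc_of% hs, reassoc_of% hρs, hΔf]
  have hsx : s ≫ x = 𝟙 Y := by
    change s ≫ o ≫ x₀ = 𝟙 Y
    rw [reassoc_of% hs, reassoc_of% hρs, hΔs]
  have hlift : ∀ {W : Scheme.{u}} (w : W ⟶ C),
      ∃ l : pullback w g ⟶ pullback w g₀, l ≫ pullback.snd w g₀ = pullback.snd w g ≫ o := fun w =>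
    ⟨pullback.lift (pullback.fst w g) (pullback.snd w g ≫ o)
      (by rw [Category.assoc]; exact pullback.condition), pullback.lift_snd _ _ _⟩
  obtain ⟨lz, hlz⟩ := hlift z
  obtain ⟨li, hli⟩ := hlift i
  obtain ⟨hfinx, hsep⟩ := hsep (pullback.snd z g) lz hlz
  have hfinZ : IsFinite (pullback.snd z g ≫ g ≫ p) := by
    have h1 : pullback.snd z g ≫ g ≫ p = (pullback.snd z g ≫ x) ≫ t :=
      (congr_arg (pullback.snd z g ≫ ·) hx.symm).trans (Category.assoc _ _ _).symm
    have h2 : IsFinite (pullback.snd z g ≫ x) := hfinx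
    rw [h1]
    infer_instance
  have hfin : IsFinite (pullback.snd i g ≫ g ≫ p) := by
    let c : pullback i g ⟶ pullback z g := pullback.lift (pullback.fst i g ≫ ℓ) (pullback.snd i g)
      (by rw [Category.assoc, hℓ, pullback.condition])
    have hc : c ≫ pullback.snd z g = pullback.snd i g := pullback.lift_snd _ _ _
    have hcc : IsClosedImmersion c := by
      have h1 : IsClosedImmersion (c ≫ pullback.snd z g) := by rw [hc]; infer_instance
      exact IsClosedImmersion.of_comp c (pullback.snd z g)
    rw [← hc, Category.assoc]
    infer_instance
  let ρ : Y ⟶ pullback i g := pullback.lift (𝟙 Y) s (by rw [Category.id_comp, hsg])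
  have hρs' : ρ ≫ pullback.snd i g = s := pullback.lift_snd _ _ _
  have hρf' : ρ ≫ pullback.fst i g = 𝟙 Y := pullback.lift_fst _ _ _
  have hmono' : Mono ρ := mono_of_mono_fac hρf'
  have het : Etale (pullback.snd i g ≫ g ≫ p) := etale_pullback_snd g
  have hcomp' : ρ ≫ pullback.snd i g ≫ g ≫ p = t := by rw [reassoc_of% hρs', reassoc_of% hsg]
  have hcl : IsClopen (Set.range ρ) := isClopen_range_of_mono ρ (pullback.snd i g ≫ g ≫ p)
    (by rw [hcomp']; infer_instance) (by rw [hcomp']; infer_instance)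
  let O : (pullback i g).Opens := ⟨(Set.range ρ)ᶜ, hcl.compl.isOpen⟩
  have hO : IsClosedImmersion O.ι := isClosedImmersion_of_isClosed O hcl.compl.isClosed
  obtain ⟨T, ι, hι, hι', hrange⟩ : ∃ (T : Scheme.{u}) (ι : T ⟶ pullback i g), IsClosedImmersion ι ∧
      IsOpenImmersion ι ∧ Set.range ι = (Set.range ρ)ᶜ := ⟨O, O.ι, hO, inferInstance, O.range_ι⟩
  have hunitsT : HasIntegralUnits (N + N * N + 1 + N') Γ(T, ⊤) := by
    refine hunits (ι ≫ pullback.snd i g) (ι ≫ li) (by rw [Category.assoc, hli, Category.assoc]) ?_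
    rw [Set.disjoint_left]
    rintro _ ⟨y, rfl⟩ ⟨w, hw⟩
    rw [← hρs', Scheme.Hom.comp_apply, Scheme.Hom.comp_apply] at hw
    have h1 := (pullback.snd i g).isClosedEmbedding.injective hw
    have h2 : ι w ∈ (Set.range ρ)ᶜ := hrange ▸ Set.mem_range_self w
    exact h2 ⟨y, h1.symm⟩
  have hTf : IsFinite (ι ≫ pullback.snd i g ≫ g ≫ p) := inferInstance
  have hTe : Etale (ι ≫ pullback.snd i g ≫ g ≫ p) := inferInstance
  obtain ⟨τ, hτ⟩ : ∃ τ, τ = ι ≫ pullback.snd i g ≫ g ≫ p := ⟨_, rfl⟩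
  rw [← hτ] at hTf hTe
  have haff : IsAffine (pullback p τ) := isAffine_of_isAffineHom (pullback.fst p τ)
  have h1 : ExtendsOff p hp hC F j a (pullback.fst p τ) ∅ := by
    -- The induction starts from the one tautological section of Y over T, with room for N' more.
    refine ExtendsOff.of_hasIntegralUnits (m := 0) hd hF hj hk ha hℓ hA e he e' he'
      (n := N + N * N + 1 + N') (by omega) (by omega) N' τ (by omega)
      (fun _ => ι ≫ pullback.fst i g)
      (fun _ => pullback.lift (ι ≫ pullback.fst i g ≫ i) (𝟙 T) ?_) ?_ ?_ ?_ hunitsT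
    · rw [Category.id_comp, hτ, Category.assoc, Category.assoc, pullback.condition_assoc]
    · intro _
      rw [pullback.lift_fst, Category.assoc]
    · intro _
      exact pullback.lift_snd _ _ _
    · intro l l' hl
      exact (hl (Subsingleton.elim (α := Fin 1) l l')).elim
  have h2 := ExtendsOff.of_baseChange hF hj hfin τ ι hτ.symm h1
  rw [hrange, compl_compl, ← Set.range_comp] at h2
  have h3 : ExtendsOff p hp hC F j a g (Set.range (ρ ≫ pullback.snd i g)) := h2
  -- One section is always permitted: the degree of Y is at least 1 at the image of each of its
  -- points, and no unit differences are needed.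
  obtain ⟨b, hb⟩ := hA.exists_isGoodSections hd t (𝟙 Y) (Category.id_comp _) (m := 1)
    (fun y => Scheme.Hom.one_le_finrank_map _ y) hasIntegralUnits_one
  refine ExtendsOff.id_of_etale hF hj hfin s hsg ?_
  refine ExtendsOff.of_separating hd hF hj hk ha hℓ hfin hfinZ x t hx ρ
    (by rw [reassoc_of% hρs', hsx]) ?_ hb h3
  rw [hρs']
  exact hsep

end Extension

end Extension

theorem mainTheorem9 {A : Type u} [CommRing A] [Finite (MaximalSpectrum A)]
    (d : ℕ) (hd : 0 < d)
    {C Y : Scheme.{u}} (p : C ⟶ Spec (CommRingCat.of A))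
    (hC : IsAffine C) (hp : SmoothOfRelativeDimension d p)
    (i : Y ⟶ C) [IsClosedImmersion i] [IsFinite (i ≫ p)] [Etale (i ≫ p)]
    (F : (Extension.Punctured A d)ᵒᵖ ⥤ Pointed.{v}) (hF : Extension.IsExcisive F)
    (hA : ∀ (T : Scheme.{u}) (q : T ⟶ Y) [IsFinite q] [Etale q] (m : ℕ),
      (∀ t : T, m ≤ (i ≫ p).finrank ((q ≫ i ≫ p) t)) →
      (∃ (B : Type u) (_ : CommRing B), Module.Finite ℤ B ∧
        Nonempty (T ⟶ Spec (CommRingCat.of B)) ∧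
        ∃ s : Fin m → (Spec (CommRingCat.of B) ⟶
          𝔸(ULift.{u} (Fin d); Spec (CommRingCat.of B))), Extension.IsDisjointCopies s) →
      ∃ s : Fin m → (T ⟶ 𝔸(ULift.{u} (Fin d); T)), Extension.IsDisjointCopies s ∧
        ∀ (Z : Scheme.{u}) (z : Z ⟶ 𝔸(ULift.{u} (Fin d); T)),
          IsClosedImmersion z → IsFinite (z ≫ (𝔸(ULift.{u} (Fin d); T) ↘ T)) →
          (∀ k, ∃ l : T ⟶ Z, l ≫ z = s k) →
          Extension.KerSurjective F (Extension.Punctured.affineSpace d (q ≫ i ≫ p))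
            (⋃ k, Set.range (s k)) (Set.range z))
    (Z : Scheme.{u}) (z : Z ⟶ C) (hz : IsClosedImmersion z) (hZ : IsFinite (z ≫ p))
    (hYZ : ∃ l : Y ⟶ Z, l ≫ z = i) :
    Extension.KerSurjective F (Extension.Punctured.ofAffine p hC hp)
      (Set.range i) (Set.range z) := by
  intro U V j k hj hk a ha
  obtain ⟨ℓ, hℓ⟩ := hYZ
  have h := Extension.ExtendsOff.id (hC := hC) (hp := hp) hd hF hj hk ha hℓ hA
  -- C with structure morphism 𝟙 C ≫ p is a different object of the category; `c` is the identity on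
  -- C, viewed as a morphism to it.
  let c : Extension.Punctured.ofAffine p hC hp ⟶ Extension.Punctured.ofEtale p hp (𝟙 C) :=
    Extension.Punctured.homMk (M := Extension.Punctured.ofAffine p hC hp)
      (N := Extension.Punctured.ofEtale p hp (𝟙 C)) (𝟙 C) (by
        change 𝟙 C ≫ 𝟙 C ≫ p = p
        rw [Category.id_comp, Category.id_comp])
  have h1 := (h.extendsTo (𝟙 C) (Category.id_comp _) (K' := ∅) (by simp) (𝟙 _)
    Extension.isComplement_id).comp c
  have h2 : c ≫ 𝟙 _ ≫ Extension.Punctured.ofEtaleHom p hp hC (𝟙 C) = 𝟙 _ := by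
    refine Extension.Punctured.hom_ext ?_
    change 𝟙 C ≫ 𝟙 C ≫ 𝟙 C = 𝟙 C
    rw [Category.id_comp, Category.id_comp]
  rw [h2] at h1
  obtain ⟨b, hb⟩ := h1
  -- Tested on U itself, the universal condition says that `b` restricts to `a`.
  have h3 := hb U j (𝟙 U) (by rw [Category.comp_id, Category.id_comp])
  rw [Extension.map_id_apply] at h3
  refine ⟨b, ?_, h3⟩
  rw [Extension.map_comp_apply, h3, ha]
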